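/- **Setting.** Let $I=[l,r]\subset[-\infty,\infty]$ with $l<0<r$. Let $\mathbf s:(l,r)\to\mathbb R$ be increasing (not necessarily strictly, nor left or right continuous), non-constant, with $\mathbf s(0-)=\mathbf s(0)=\mathbf s(0+)=0$; put $\mathbf s(l):=\lim_{x\downarrow l}\mathbf s(x)$, $\mathbf s(r):=\lim_{x\uparrow r}\mathbf s(x)$ (possibly infinite), $\mathbf s(l-):=\mathbf s(l)$, $\mathbf s(r+):=\mathbf s(r)$. Let $\mathfrak m$ be a positive measure on $I$ with $\mathfrak m([a,b])<\infty$ whenever $[a,b]\subset(l,r)$ and $\mathfrak m(\{0\})=0$. Put $D^\pm=\{x\in I:\mathbf s(x)\ne\mathbf s(x\pm)\}$, $D=D^+\cup D^-$, $D^0=D^+\cap D^-$; let $U$ be the set of $x\in I$ such that $\mathbf s$ is constant on a neighbourhood of $x$ in $I$, and let $(c_n,d_n)$ be the connected components of $U\setminus\{l,r\}$. Such a component is *isolated* if $c_n,d_n\in D\cup\{l,r\}$. The endpoint $r$ is *approachable* if $\mathbf s(r)<\infty$, and *reflecting* if moreover $\mathfrak m((a,r))<\infty$ for some $a<r$ and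 $\mathfrak m(\{r\})<\infty$; similarly for $l$. Assume: * (DK) $l$ (resp. $r$) is reflecting if it is an endpoint of an isolated component; * (DM) $I\setminus U\subset\operatorname{supp}\mathfrak m$; $\mathfrak m(\{x\})>0$ for $x\in D^0$; and for every isolated component $(c,d)$, the interval with endpoints $c,d$ which contains $c$ iff $c\notin D^+$ and $d$ iff $d\notin D^-$ has positive $\mathfrak m$-measure. **The form $(\mathscr E,\mathscr F)$.** Let $\mu_d^+=\sum_x(\mathbf s(x+)-\mathbf s(x))\delta_x$ and $\mu_d^-=\sum_x(\mathbf s(x)-\mathbf s(x-))\delta_x$. Write $\int_{(0,x)}=-\int_{[x,0)}$ and $\int_{(0,x]}=-\int_{(x,0)}$ for $x<0$. Let $\mathbf s_c(x)=\mathbf s(x)-\int_{(0,x)}d\mu_d^+-\int_{(0,x]}d\mu_d^-$ (continuous and increasing on $(l,r)$) and let $\mu_c$ be its Lebesgue–Stieltjes measure. Let $\mathscr S$ be the space of functions on $(l,r)$ of the form $$f(x)=c_0+\int_{(0,x)}g^c\,d\mu_c+\int_{(0,x)}g^+\,d\mu_d^++\int_{(0,x]}g^-\,d\mu_d^-,\qquad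 c_0\in\mathbb R,\ g^c\in L^2(\mu_c),\ g^\pm\in L^2(\mu_d^\pm),$$ extended to approachable endpoints by their limits (the densities are determined a.e. by $f$). Let $I_0$ be $I$ without its non-reflecting endpoints, let $\mathscr F$ be the set of $f\in\mathscr S\cap L^2(I_0,\mathfrak m)$ with $f(j)=0$ at each approachable endpoint $j\notin I_0$, and for $f_1,f_2\in\mathscr F$ let $$\mathscr E(f_1,f_2)=\tfrac12\Big(\int g^c_1g^c_2\,d\mu_c+\int g_1^+g_2^+\,d\mu_d^++\int g_1^-g_2^-\,d\mu_d^-\Big).$$ **Its image regularization.** Put $\widehat l=\mathbf s(l)$, $\widehat r=\mathbf s(r)$. Let $\widehat I\subset\mathbb R$ be the set $\mathbf s(I)\cup\{\mathbf s(x-):x\in D^-\}\cup\{\mathbf s(x+):x\in D^+\}$ from which $\widehat l$ (resp. $\widehat r$) is removed if $l$ (resp. $r$) is not reflecting. Let $\widehat{\mathfrak m}=\mathfrak m\circ\mathbf s^{-1}$ on $\widehat I$. For $f\in\mathscr F$ let $\widehat f=\widehat\iota f$ be the function on $\widehat I$ given by $\widehat f(\mathbf s(x))=f(x)$ for $x\in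 I_0$ and $\widehat f(\mathbf s(x\pm))=f(x\pm)$ for $x\in D^\pm$ (at those of the points $\mathbf s(x),\mathbf s(x\pm)$ that lie in $\widehat I$). The image regularization is $\widehat{\mathscr F}=\widehat\iota(\mathscr F)$, $\widehat{\mathscr E}(\widehat f,\widehat g)=\mathscr E(f,g)$, regarded as a form on $L^2(\widehat I,\widehat{\mathfrak m})$. **The Brownian form.** Let $\widehat J$ be the interval with endpoints $\widehat l,\widehat r$ which contains $\widehat l$ (resp. $\widehat r$) iff $\widehat I$ does. Let $H^1_0(\widehat J)$ be the set of $u\in L^2(\widehat J)$ that are (locally) absolutely continuous on $(\widehat l,\widehat r)$ with $u'\in L^2(\widehat J)$ and with limit $0$ at every finite endpoint not in $\widehat J$, and let $\tfrac12\mathbf D(u,v)=\tfrac12\int_{\widehat J}u'v'\,dx$: this is the Dirichlet form on $L^2(\widehat J)$ of the Brownian motion on $\widehat J$ absorbed at finite open endpoints and reflected at finite closed endpoints. **Trace Dirichlet form.** Let $(\mathscr A,\mathscr D)$ be a regular Dirichlet form on $L^2(X)$ with extended Dirichlet space $\mathscr D_e$ (to which $\mathscr A$ is extended), and let $\mu$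 be a smooth measure on $X$ with quasi-support $Y$. The trace Dirichlet form of $(\mathscr A,\mathscr D)$ on $L^2(Y,\mu)$ has domain $\mathscr D_e|_Y\cap L^2(Y,\mu)$ (restrictions of quasi-continuous versions) and energy $\mathscr A(H\varphi,H\psi)$, where $H\varphi\in\mathscr D_e$ is the harmonic extension of $\varphi$: it is quasi-continuous, equals $\varphi$ on $Y$ ($\mu$-a.e.), and is $\mathscr A$-orthogonal to all elements of $\mathscr D_e$ whose quasi-continuous versions vanish quasi-everywhere on $Y$. **Theorem.** The measure $\widehat{\mathfrak m}$, extended by zero to $\widehat J$, is smooth with respect to $(\tfrac12\mathbf D,H^1_0(\widehat J))$ with quasi-support $\widehat I$, and the image regularization $(\widehat{\mathscr E},\widehat{\mathscr F})$ is the trace Dirichlet form of $(\tfrac12\mathbf D,H^1_0(\widehat J))$ on $L^2(\widehat I,\widehat{\mathfrak m})$. -/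

import Mathlib

open MeasureTheory Set Filter Topology
open scoped ENNReal

noncomputable section

/-! ## Symmetric forms on `L²` and trace Dirichlet forms -/

/-- A form on (a subset of) `L²(X, m)`: the domain and the values `𝓔(u, v)`.
Only the values on the domain are meaningful. -/
structure L2Form {X : Type*} [MeasurableSpace X] (m : Measure X) where
  dom : Set (Lp ℝ 2 m)
  energy : Lp ℝ 2 m → Lp ℝ 2 m → ℝ

namespace L2Form

section Basic

variable {X : Type*} [MeasurableSpace X] {m : Measure X} (E : L2Form m)

/-- `𝓔₁(u, u) = 𝓔(u, u) + (u, u)_m`. -/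
def energyOne (u : Lp ℝ 2 m) : ℝ := E.energy u u + ‖u‖ ^ 2

/-- `uₙ` is an `𝓔`-Cauchy sequence in the domain converging to `u` almost everywhere. -/
structure Approximates (un : ℕ → Lp ℝ 2 m) (u : X → ℝ) : Prop where
  mem : ∀ n, un n ∈ E.dom
  cauchy : ∀ ε > (0 : ℝ), ∃ N, ∀ i ≥ N, ∀ j ≥ N, E.energy (un i - un j) (un i - un j) < ε
  tendsto : ∀ᵐ x ∂m, Tendsto (fun n => un n x) atTop (𝓝 (u x))

/-- Membership in the extended Dirichlet space `𝓕ₑ`. -/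
def MemExtended (u : X → ℝ) : Prop := ∃ un, E.Approximates un u

/-- The extension of the form to `𝓕ₑ`: `𝓔(u, v) = c`, that is, `𝓔(uₙ, vₙ) → c` along
approximating sequences of `u` and `v`. -/
def HasExtEnergy (u v : X → ℝ) (c : ℝ) : Prop :=
  E.MemExtended u ∧ E.MemExtended v ∧
    ∀ un vn, E.Approximates un u → E.Approximates vn v →
      Tendsto (fun n => E.energy (un n) (vn n)) atTop (𝓝 c)

end Basic

section Quasi

variable {X : Type*} [MeasurableSpace X] [TopologicalSpace X] {m : Measure X} (E : L2Form m)

/-- The `1`-capacity of an open set. -/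
def capOpen (G : Set X) : ℝ≥0∞ :=
  ⨅ (u : Lp ℝ 2 m) (_ : u ∈ E.dom) (_ : ∀ᵐ x ∂m, x ∈ G → 1 ≤ u x),
    ENNReal.ofReal (E.energyOne u)

/-- The `1`-capacity of an arbitrary set. -/
def cap (A : Set X) : ℝ≥0∞ := ⨅ (G : Set X) (_ : IsOpen G) (_ : A ⊆ G), E.capOpen G

/-- `f` is quasi-continuous: for each `ε > 0` its restriction to the complement of some open set
of capacity less than `ε` is continuous. -/
def QuasiContinuous (f : X → ℝ) : Prop :=
  ∀ ε > (0 : ℝ≥0∞), ∃ G : Set X, IsOpen G ∧ E.cap G < ε ∧ ContinuousOn f Gᶜ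

/-- `A` is quasi-open: it differs from an open superset by a set of arbitrarily small capacity. -/
def QuasiOpen (A : Set X) : Prop :=
  ∀ ε > (0 : ℝ≥0∞), ∃ G : Set X, IsOpen G ∧ A ⊆ G ∧ E.cap (G \ A) < ε

/-- Quasi-closed sets are the complements of quasi-open sets. -/
def QuasiClosed (A : Set X) : Prop := E.QuasiOpen Aᶜ

/-- `μ` is a smooth measure: it charges no set of zero capacity, and there are increasing closed
sets `Fₙ` of finite `μ`-measure with `Cap(K \ Fₙ) → 0` for every compact `K`. -/
structure IsSmooth (μ : Measure X) : Prop where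
  zero_of_cap_zero : ∀ A : Set X, E.cap A = 0 → μ A = 0
  exhaustion : ∃ F : ℕ → Set X, Monotone F ∧ (∀ n, IsClosed (F n)) ∧ (∀ n, μ (F n) < ∞) ∧
    ∀ K : Set X, IsCompact K → Tendsto (fun n => E.cap (K \ F n)) atTop (𝓝 0)

/-- `S` is a quasi-support of `μ`: the smallest quasi-closed set (up to capacity zero) outside
which `μ` vanishes. -/
structure IsQuasiSupport (S : Set X) (μ : Measure X) : Prop where
  quasiClosed : E.QuasiClosed S
  null_compl : μ Sᶜ = 0
  minimal : ∀ S' : Set X, E.QuasiClosed S' → μ S'ᶜ = 0 → E.cap (S \ S') = 0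

/-- `h = H φ` is the harmonic extension of a function `φ` living on `Y ⊆ X` (included by `ι` and
equipped with the measure `μ`): a quasi-continuous element of `𝓕ₑ` which restricts to `φ` and is
`𝓔`-orthogonal to every element of `𝓕ₑ` whose quasi-continuous version vanishes quasi-everywhere
on `Y`. -/
structure IsHarmonicExtension {Y : Type*} [MeasurableSpace Y] (ι : Y → X) {μ : Measure Y}
    (φ : Lp ℝ 2 μ) (h : X → ℝ) : Prop where
  memExtended : E.MemExtended h
  quasiContinuous : E.QuasiContinuous h
  restrict : ∀ᵐ y ∂μ, φ y = h (ι y)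
  orthogonal : ∀ v : X → ℝ, E.MemExtended v → E.QuasiContinuous v →
    E.cap {x | x ∈ range ι ∧ v x ≠ 0} = 0 → E.HasExtEnergy h v 0

/-- `T` is the trace Dirichlet form of `E` on `L²(Y, μ)`, where `Y` is a subspace of `X` (included
by `ι`), and `μ` viewed as a measure on `X` is smooth with quasi-support `Y`:
the domain is `𝓕ₑ|_Y ∩ L²(Y, μ)` (restrictions of quasi-continuous versions), and the energy is
`𝓔(H φ, H ψ)`. -/
structure IsTraceDirichletForm {Y : Type*} [MeasurableSpace Y] [TopologicalSpace Y]
    (ι : Y → X) {μ : Measure Y} (T : L2Form μ) : Prop where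
  isEmbedding : IsEmbedding ι
  smooth : E.IsSmooth (μ.map ι)
  quasiSupport : E.IsQuasiSupport (range ι) (μ.map ι)
  mem_dom_iff : ∀ φ : Lp ℝ 2 μ, φ ∈ T.dom ↔
    ∃ u : X → ℝ, E.MemExtended u ∧ E.QuasiContinuous u ∧ ∀ᵐ y ∂μ, φ y = u (ι y)
  exists_harmonic : ∀ φ ∈ T.dom, ∃ h, E.IsHarmonicExtension ι φ h
  energy_eq : ∀ φ ∈ T.dom, ∀ ψ ∈ T.dom, ∀ h k, E.IsHarmonicExtension ι φ h →
    E.IsHarmonicExtension ι ψ k → E.HasExtEnergy h k (T.energy φ ψ)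

end Quasi

end L2Form

/-! ## The form of Brownian motion on an interval -/

/-- Lebesgue measure on `J ⊆ ℝ`. -/
def lebesgueOn (J : Set ℝ) : Measure J := (volume : Measure ℝ).comap Subtype.val

/-- `f` is absolutely continuous on the interior of the interval `J`, `f' ∈ L²(J)`, and `f`
vanishes at every finite endpoint of `J` which is not contained in `J`. -/
structure IsH1Function (J : Set ℝ) (f : ℝ → ℝ) : Prop where
  absolutelyContinuous : ∀ a ∈ interior J, ∀ b ∈ interior J, AbsolutelyContinuousOnInterval f a b
  deriv_memLp : MemLp (deriv f) 2 (volume.restrict J)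
  boundary : ∀ j ∈ closure J \ J, Tendsto f (𝓝[J] j) (𝓝 0)

/-- `f` is an absolutely continuous version of the class `u ∈ L²(J)`. -/
def IsH1Version (J : Set ℝ) (u : Lp ℝ 2 (lebesgueOn J)) (f : ℝ → ℝ) : Prop :=
  IsH1Function J f ∧ ∀ᵐ x ∂(lebesgueOn J), u x = f x

/-- The absolutely continuous version of a class `u ∈ H¹₀(J)` (unique on the interior of `J`). -/
def h1Version (J : Set ℝ) (u : Lp ℝ 2 (lebesgueOn J)) : ℝ → ℝ :=
  Classical.epsilon (IsH1Version J u)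

/-- The form `(½ 𝐃, H¹₀(J))` on `L²(J)` of the Brownian motion on the interval `J`, absorbed at
the finite endpoints not in `J` and reflected at the finite endpoints in `J`. -/
def brownianForm (J : Set ℝ) : L2Form (lebesgueOn J) where
  dom := {u | ∃ f, IsH1Version J u f}
  energy u v := 1 / 2 * ∫ x in J, deriv (h1Version J u) x * deriv (h1Version J v) x

/-! ## Lebesgue–Stieltjes measures on open intervals of the extended line -/

/-- Closed intervals of an open interval of the extended line are compact. -/
instance instCompactIccSpaceIooEReal (l r : EReal) : CompactIccSpace (Ioo l r) := by
  refine ⟨fun {a b} => ?_⟩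
  rw [Topology.IsEmbedding.subtypeVal.isCompact_iff]
  have h : (Subtype.val '' Icc a b : Set EReal) = Icc (a : EReal) b := by
    ext x
    constructor
    · rintro ⟨y, hy, rfl⟩
      exact hy
    · intro hx
      exact ⟨⟨x, a.2.1.trans_le hx.1, hx.2.trans_lt b.2.2⟩, hx, rfl⟩
  rw [h]
  exact isCompact_Icc

open Classical in
/-- The Lebesgue–Stieltjes measure, on the open interval `(l, r)` of the extended line, of an
increasing function `F` on `(l, r)`. -/
def lebesgueStieltjes (l r : EReal) (F : EReal → ℝ) : Measure EReal :=
  if hF : Monotone (fun x : Ioo l r => F x) then hF.stieltjesFunction.measure.map Subtype.val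
  else 0

/-! ## Discontinuous scales -/

/-- A triple `(I, 𝐬, 𝔪)` with `I = [l, r]`. The scale `s` is relevant on `(l, r)` only; the measure
`m` lives on `I`, which may contain `±∞`, and may charge the endpoints. -/
structure ScaleTriple where
  l : EReal
  r : EReal
  l_neg : l < 0
  r_pos : 0 < r
  s : ℝ → ℝ
  s_mono : MonotoneOn s {x : ℝ | l < x ∧ (x : EReal) < r}
  s_nonconst : ∃ x y : ℝ, (l < x ∧ (x : EReal) < r) ∧ (l < y ∧ (y : EReal) < r) ∧ s x ≠ s y
  s_zero : s 0 = 0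
  s_cont_zero : ContinuousAt s 0
  m : Measure EReal
  m_compl : m (Icc l r)ᶜ = 0
  m_radon : ∀ a b : EReal, l < a → b < r → m (Icc a b) < ∞
  m_zero : m {0} = 0

namespace ScaleTriple

variable (T : ScaleTriple)

/-- `𝐬(l) = lim_{x ↓ l} 𝐬(x)`, which is the infimum of `𝐬` by monotonicity. -/
def lhat : EReal := ⨅ (x : ℝ) (_ : T.l < x ∧ (x : EReal) < T.r), (T.s x : EReal)

/-- `𝐬(r) = lim_{x ↑ r} 𝐬(x)`, which is the supremum of `𝐬` by monotonicity. -/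
def rhat : EReal := ⨆ (x : ℝ) (_ : T.l < x ∧ (x : EReal) < T.r), (T.s x : EReal)

open Classical in
/-- The scale as a function on `I = [l, r]` (continued outside `I` by constants, in accordance with
the conventions `𝐬(l-) = 𝐬(l)` and `𝐬(r+) = 𝐬(r)`). -/
def sExt (x : EReal) : EReal :=
  if x ≤ T.l then T.lhat else if T.r ≤ x then T.rhat else T.s x.toReal

/-- `𝐬(x-)`. -/
def sLeft (x : EReal) : EReal := Function.leftLim T.sExt x

/-- `𝐬(x+)`. -/
def sRight (x : EReal) : EReal := Function.rightLim T.sExt x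

def Dplus : Set EReal := {x | x ∈ Icc T.l T.r ∧ T.sExt x ≠ T.sRight x}

def Dminus : Set EReal := {x | x ∈ Icc T.l T.r ∧ T.sExt x ≠ T.sLeft x}

def Dzero : Set EReal := T.Dplus ∩ T.Dminus

def D : Set EReal := T.Dplus ∪ T.Dminus

/-- The points of `I` near which (relatively to `I`) the scale is constant. -/
def U : Set EReal := {x | x ∈ Icc T.l T.r ∧
  ∃ V ∈ 𝓝 x, ∃ c : EReal, ∀ y ∈ V ∩ Icc T.l T.r, T.sExt y = c}

/-- `(c, d)` is one of the disjoint open intervals (connected components) `(cₙ, dₙ)` that make up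
`U \ {l, r}`. -/
def IsComponent (c d : EReal) : Prop :=
  c < d ∧ Ioo c d ⊆ T.U \ {T.l, T.r} ∧ c ∉ T.U \ {T.l, T.r} ∧ d ∉ T.U \ {T.l, T.r}

/-- `(c, d)` is an isolated interval. -/
def IsIsolatedInterval (c d : EReal) : Prop :=
  T.IsComponent c d ∧ c ∈ T.D ∪ {T.l, T.r} ∧ d ∈ T.D ∪ {T.l, T.r}

def ApproachableLeft : Prop := ⊥ < T.lhat

def ApproachableRight : Prop := T.rhat < ⊤

/-- `l` is reflecting: `𝐬(l) > -∞`, `𝔪((l, l + ε)) < ∞` for some `ε`, and `𝔪({l}) < ∞`. -/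
def ReflectingLeft : Prop :=
  T.ApproachableLeft ∧ (∃ b > T.l, T.m (Ioo T.l b) < ∞) ∧ T.m {T.l} < ∞

/-- `r` is reflecting: `𝐬(r) < ∞`, `𝔪((r - ε, r)) < ∞` for some `ε`, and `𝔪({r}) < ∞`. -/
def ReflectingRight : Prop :=
  T.ApproachableRight ∧ (∃ a < T.r, T.m (Ioo a T.r) < ∞) ∧ T.m {T.r} < ∞

/-- Condition (DK). -/
def DK : Prop := ∀ c d, T.IsIsolatedInterval c d →
  (c = T.l → T.ReflectingLeft) ∧ (d = T.r → T.ReflectingRight)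

/-- The interval ended by `c` and `d` which contains `c` iff `c ∉ D⁺`, and `d` iff `d ∉ D⁻`. -/
def closedUpInterval (c d : EReal) : Set EReal :=
  Ioo c d ∪ ({c} \ T.Dplus) ∪ ({d} \ T.Dminus)

/-- Condition (DM). -/
structure DM : Prop where
  support : Icc T.l T.r \ T.U ⊆ T.m.support
  isolated_point : ∀ x ∈ T.Dzero, 0 < T.m {x}
  isolated_interval : ∀ c d, T.IsIsolatedInterval c d → 0 < T.m (T.closedUpInterval c d)

/-! ### Absolute continuity with respect to the scale -/

/-- `μ_d⁺ = ∑ (𝐬(x+) - 𝐬(x)) δ_x`. -/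
def muPlus : Measure EReal :=
  Measure.sum fun x : Ioo T.l T.r => (T.sRight x - T.sExt x).toENNReal • Measure.dirac (x : EReal)

/-- `μ_d⁻ = ∑ (𝐬(x) - 𝐬(x-)) δ_x`. -/
def muMinus : Measure EReal :=
  Measure.sum fun x : Ioo T.l T.r => (T.sExt x - T.sLeft x).toENNReal • Measure.dirac (x : EReal)

end ScaleTriple

open Classical in
/-- `∫_{(0, x)} g dμ`, with the convention `∫_{(0, x)} = -∫_{[x, 0)}` for `x < 0`. -/
def openIntegral (μ : Measure EReal) (g : EReal → ℝ) (x : EReal) : ℝ :=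
  if 0 ≤ x then ∫ y in Ioo 0 x, g y ∂μ else -∫ y in Ico x 0, g y ∂μ

open Classical in
/-- `∫_{(0, x]} g dμ`, with the convention `∫_{(0, x]} = -∫_{(x, 0)}` for `x < 0`. -/
def halfOpenIntegral (μ : Measure EReal) (g : EReal → ℝ) (x : EReal) : ℝ :=
  if 0 ≤ x then ∫ y in Ioc 0 x, g y ∂μ else -∫ y in Ioo x 0, g y ∂μ

namespace ScaleTriple

variable (T : ScaleTriple)

/-- `𝐬_d⁺`: `μ_d⁺((0, x))` for `x ≥ 0` and `-μ_d⁺([x, 0))` for `x < 0`. -/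
def sdPlus (x : EReal) : ℝ := openIntegral T.muPlus (fun _ => 1) x

/-- `𝐬_d⁻`: `μ_d⁻((0, x])` for `x ≥ 0` and `-μ_d⁻((x, 0))` for `x < 0`. -/
def sdMinus (x : EReal) : ℝ := halfOpenIntegral T.muMinus (fun _ => 1) x

/-- The continuous part `𝐬_c = 𝐬 - 𝐬_d⁺ - 𝐬_d⁻` of the scale on `(l, r)`. -/
def sc (x : EReal) : ℝ := T.s x.toReal - T.sdPlus x - T.sdMinus x

/-- The Lebesgue–Stieltjes measure `μ_c` of `𝐬_c`. -/
def muC : Measure EReal := lebesgueStieltjes T.l T.r T.sc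

/-- The data of a decomposition `f = f^c + f⁺ + f⁻`: the constant `c₀` and the three densities
`df^c/dμ_c`, `df⁺/dμ_d⁺`, `df⁻/dμ_d⁻`. -/
structure Densities where
  const : ℝ
  cont : EReal → ℝ
  plus : EReal → ℝ
  minus : EReal → ℝ

/-- `p` is the derivative data of `f` with respect to the scale. -/
structure HasDensities (f : EReal → ℝ) (p : Densities) : Prop where
  cont_memLp : MemLp p.cont 2 T.muC
  plus_memLp : MemLp p.plus 2 T.muPlus
  minus_memLp : MemLp p.minus 2 T.muMinus
  eq : ∀ x ∈ Ioo T.l T.r, f x =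
    (p.const + openIntegral T.muC p.cont x) + openIntegral T.muPlus p.plus x +
      halfOpenIntegral T.muMinus p.minus x

/-- The class `𝒮` of functions absolutely continuous with respect to the scale. They are functions
on `(l, r)`, extended to approachable endpoints by their limits. -/
structure MemS (f : EReal → ℝ) : Prop where
  exists_densities : ∃ p, T.HasDensities f p
  left : T.ApproachableLeft → Tendsto f (𝓝[Ioo T.l T.r] T.l) (𝓝 (f T.l))
  right : T.ApproachableRight → Tendsto f (𝓝[Ioo T.l T.r] T.r) (𝓝 (f T.r))

/-- The interval `I₀`, obtained from `I` by taking out non-reflecting endpoints. -/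
def I0 : Set EReal := {x | x ∈ Icc T.l T.r ∧
  (x = T.l → T.ReflectingLeft) ∧ (x = T.r → T.ReflectingRight)}

/-- The domain `𝓕` of the Dirichlet form associated with the triple. -/
structure MemF (f : EReal → ℝ) : Prop where
  memS : T.MemS f
  memLp : MemLp f 2 (T.m.restrict T.I0)
  left : T.l ∉ T.I0 → T.ApproachableLeft → f T.l = 0
  right : T.r ∉ T.I0 → T.ApproachableRight → f T.r = 0

/-- The derivative data of `f ∈ 𝒮` (the densities are unique almost everywhere). -/
def densities (f : EReal → ℝ) : Densities :=
  @Classical.epsilon Densities ⟨⟨0, 0, 0, 0⟩⟩ (T.HasDensities f)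

/-- `𝓔(f, g) = ½ ∫_I (df/d𝐬)(dg/d𝐬) d𝐬`. -/
def energy (f g : EReal → ℝ) : ℝ :=
  1 / 2 * ((∫ x, (T.densities f).cont x * (T.densities g).cont x ∂T.muC) +
    (∫ x, (T.densities f).plus x * (T.densities g).plus x ∂T.muPlus) +
    ∫ x, (T.densities f).minus x * (T.densities g).minus x ∂T.muMinus)

/-! ### The image regularization -/

/-- `Î_𝐬`, the closure of `𝐬(I)` in the extended line. -/
def IhatS : Set EReal := T.sExt '' Icc T.l T.r ∪ T.sLeft '' T.Dminus ∪ T.sRight '' T.Dplus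

/-- The state space `Î ⊆ ℝ`, obtained from `Î_𝐬` by taking out non-reflecting endpoints. -/
def Ihat : Set ℝ := {y | (y : EReal) ∈ T.IhatS ∧
  ((y : EReal) = T.lhat → T.ReflectingLeft) ∧ ((y : EReal) = T.rhat → T.ReflectingRight)}

/-- The measure `𝔪̂ = 𝔪 ∘ 𝐬⁻¹` on `Î`. -/
def mhat : Measure T.Ihat := (T.m.map T.sExt).comap fun y : T.Ihat => ((y : ℝ) : EReal)

/-- The interval `Ĵ = ⟨l̂, r̂⟩`, which contains `l̂` (or `r̂`) iff `Î` does. -/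
def Jhat : Set ℝ := {y | (y : EReal) ∈ Icc T.lhat T.rhat ∧
  ((y : EReal) = T.lhat → y ∈ T.Ihat) ∧ ((y : EReal) = T.rhat → y ∈ T.Ihat)}

/-- `f̂ = ι̂ f`: the function on `Î` with `f̂(𝐬(x)) = f(x)` for `x ∈ I₀` and `f̂(𝐬(x±)) = f(x±)`
for `x ∈ D^±`. -/
structure IsImage (f : EReal → ℝ) (fhat : T.Ihat → ℝ) : Prop where
  at_point : ∀ x ∈ T.I0, ∀ y : T.Ihat, ((y : ℝ) : EReal) = T.sExt x → fhat y = f x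
  at_left : ∀ x ∈ T.Dminus, ∀ y : T.Ihat, ((y : ℝ) : EReal) = T.sLeft x →
    fhat y = Function.leftLim f x
  at_right : ∀ x ∈ T.Dplus, ∀ y : T.Ihat, ((y : ℝ) : EReal) = T.sRight x →
    fhat y = Function.rightLim f x

/-- The class `φ ∈ L²(Î, 𝔪̂)` is that of `ι̂ f` with `f ∈ 𝓕`. -/
def Represents (f : EReal → ℝ) (φ : Lp ℝ 2 T.mhat) : Prop :=
  T.MemF f ∧ ∃ fhat : T.Ihat → ℝ, T.IsImage f fhat ∧ ∀ᵐ y ∂T.mhat, φ y = fhat y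

/-- `ι̂⁻¹ φ ∈ 𝓕` for a class `φ` in the domain of the image regularization. -/
def preimage (φ : Lp ℝ 2 T.mhat) : EReal → ℝ := Classical.epsilon fun f => T.Represents f φ

/-- The image regularization `(𝓔̂, 𝓕̂)` on `L²(Î, 𝔪̂)`: `𝓕̂ = ι̂ 𝓕` and
`𝓔̂(φ, ψ) = 𝓔(ι̂⁻¹ φ, ι̂⁻¹ ψ)`. -/
def imageRegularization : L2Form T.mhat where
  dom := {φ | ∃ f, T.Represents f φ}
  energy φ ψ := T.energy (T.preimage φ) (T.preimage ψ)

theorem lhat_le_rhat : T.lhat ≤ T.rhat := by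
  have h0 : T.l < ((0 : ℝ) : EReal) ∧ ((0 : ℝ) : EReal) < T.r := ⟨T.l_neg, T.r_pos⟩
  exact (iInf₂_le (0 : ℝ) h0).trans
    (le_iSup₂ (f := fun (x : ℝ) (_ : T.l < x ∧ (x : EReal) < T.r) => (T.s x : EReal)) (0 : ℝ) h0)

theorem sExt_mem (x : EReal) : T.sExt x ∈ Icc T.lhat T.rhat := by
  unfold sExt
  split_ifs with h1 h2
  · exact ⟨le_rfl, T.lhat_le_rhat⟩
  · exact ⟨T.lhat_le_rhat, le_rfl⟩
  · have hx1 : T.l < x := not_le.1 h1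
    have hx2 : x < T.r := not_le.1 h2
    have hx : ((x.toReal : ℝ) : EReal) = x :=
      EReal.coe_toReal (ne_top_of_lt hx2) (ne_bot_of_gt hx1)
    have h : T.l < ((x.toReal : ℝ) : EReal) ∧ ((x.toReal : ℝ) : EReal) < T.r := by
      rw [hx]; exact ⟨hx1, hx2⟩
    exact ⟨iInf₂_le x.toReal h,
      le_iSup₂ (f := fun (x : ℝ) (_ : T.l < x ∧ (x : EReal) < T.r) => (T.s x : EReal)) x.toReal h⟩

theorem sExt_mono : Monotone T.sExt := by
  intro x y hxy
  by_cases hx : x ≤ T.l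
  · have : T.sExt x = T.lhat := if_pos hx
    rw [this]; exact (T.sExt_mem y).1
  by_cases hy : T.r ≤ y
  · have : T.sExt y = T.rhat := by
      unfold sExt
      rw [if_neg (fun h => hx (hxy.trans h)), if_pos hy]
    rw [this]; exact (T.sExt_mem x).2
  have hx1 : T.l < x := not_le.1 hx
  have hy2 : y < T.r := not_le.1 hy
  have hy1 : T.l < y := hx1.trans_le hxy
  have hx2 : x < T.r := hxy.trans_lt hy2
  have ex : ((x.toReal : ℝ) : EReal) = x :=
    EReal.coe_toReal (ne_top_of_lt hx2) (ne_bot_of_gt hx1)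
  have ey : ((y.toReal : ℝ) : EReal) = y :=
    EReal.coe_toReal (ne_top_of_lt hy2) (ne_bot_of_gt hy1)
  unfold sExt
  rw [if_neg hx, if_neg (not_le.2 hx2), if_neg (not_le.2 hy1), if_neg hy]
  refine EReal.coe_le_coe_iff.2 (T.s_mono ?_ ?_ ?_)
  · exact ⟨by rw [ex]; exact hx1, by rw [ex]; exact hx2⟩
  · exact ⟨by rw [ey]; exact hy1, by rw [ey]; exact hy2⟩
  · rw [← EReal.coe_le_coe_iff, ex, ey]; exact hxy

theorem sLeft_mem (x : EReal) : T.sLeft x ∈ Icc T.lhat T.rhat := by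
  unfold sLeft
  rcases eq_or_neBot (𝓝[<] x) with h | h
  · rw [leftLim_eq_of_eq_bot _ h]
    exact T.sExt_mem x
  · exact isClosed_Icc.mem_of_tendsto (T.sExt_mono.tendsto_leftLim x)
      (Eventually.of_forall T.sExt_mem)

theorem sRight_mem (x : EReal) : T.sRight x ∈ Icc T.lhat T.rhat := by
  unfold sRight
  rcases eq_or_neBot (𝓝[>] x) with h | h
  · rw [rightLim_eq_of_eq_bot _ h]
    exact T.sExt_mem x
  · exact isClosed_Icc.mem_of_tendsto (T.sExt_mono.tendsto_rightLim x)
      (Eventually.of_forall T.sExt_mem)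

theorem Ihat_subset_Jhat : T.Ihat ⊆ T.Jhat := by
  intro y hy
  refine ⟨?_, fun _ => hy, fun _ => hy⟩
  rcases hy.1 with (⟨x, -, hx⟩ | ⟨x, -, hx⟩) | ⟨x, -, hx⟩
  · rw [← hx]; exact T.sExt_mem x
  · rw [← hx]; exact T.sLeft_mem x
  · rw [← hx]; exact T.sRight_mem x

/-- The inclusion of `Î` into `Ĵ`. -/
def inclusion : T.Ihat → T.Jhat := Set.inclusion T.Ihat_subset_Jhat

end ScaleTriple

end

/-! The proof transfers everything to the line by means of the scale and compares primitives of
square integrable functions there.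

On an interval `J`, elements of the Brownian domain have continuous representatives, and a
one-dimensional Sobolev estimate bounds the capacity of all nonempty sets below by one positive
constant (`exists_le_cap`). Hence only the empty set has capacity zero, and "quasi-continuous" and
"quasi-closed" mean continuous and closed. The extended Dirichlet space consists of the primitives
`F` of functions `w` in L², with `w = 0` off `J` and `F = 0` at the finite endpoints missing from
`J`; the extended energy is half the integral of the product of the derivatives
(`exists_pair_of_memExtended`, `memExtended_of_pair`, `hasExtEnergy_iff`). Smoothness then reduces
to local finiteness (`isSmooth`). Being the quasi-support reduces to `Î` being closed in `Ĵ` and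
`𝔪̂` having full support on it, which is what (DM) provides (`mhat_pos`).

The bridge between the two forms is `quantile`, the generalized inverse of the scale. It splits
`(l̂, r̂)` into a continuous part, the gaps `(𝐬(x-), 𝐬(x)]` and the gaps `(𝐬(x), 𝐬(x+)]`, up to
endpoints, and carries Lebesgue measure on these to `μ_c`, `μ_d⁻` and `μ_d⁺` (`muC_eq`,
`measurePreserving_minus`, `measurePreserving_plus`). Composing the three densities of `f` with
`quantile` gives one function `spread p` on the line; its primitive `lift p` satisfies `f = lift p ∘
𝐬` and has the same energy as `f` (`intervalIntegral_spread`, `integral_spread_mul_spread`).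
Conversely, `F ∘ 𝐬` has densities for every primitive `F`: project the derivative of `F` onto the
functions of `quantile` (`exists_hasDensities`). So `𝓕̂` is the trace domain.

Finally, `lift p` is affine on the gaps, and so is the harmonic extension. Indeed `spread p` does
not distinguish a derivative from its projection, and if `F` vanishes on `Î`, then `F ∘ 𝐬 = 0` has
zero densities (`integral_spread_mul_eq_zero`). Full support of `𝔪̂` makes the harmonic extension
unique, and the energies coincide. -/

/-! ### Primitives of square integrable functions. -/

/-- `F` is a primitive of the square integrable function `w`. -/
structure IsL2Primitive (F w : ℝ → ℝ) : Prop where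
  memLp : MemLp w 2 volume
  sub_eq : ∀ a b, F b - F a = ∫ t in a..b, w t

theorem MeasureTheory.MemLp.intervalIntegrable_of_two {w : ℝ → ℝ} (hw : MemLp w 2 volume)
    (a b : ℝ) : IntervalIntegrable w volume a b :=
  have h : LocallyIntegrable w volume := hw.locallyIntegrable (by norm_num)
  intervalIntegrable_iff.2 ((h.integrableOn_isCompact isCompact_uIcc).mono_set uIoc_subset_uIcc)

namespace IsL2Primitive

variable {F G w z : ℝ → ℝ}

theorem of_integral (hw : MemLp w 2 volume) (c x₀ : ℝ) :
    IsL2Primitive (fun x => c + ∫ t in x₀..x, w t) w := by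
  refine ⟨hw, fun a b => ?_⟩
  rw [add_sub_add_left_eq_sub, intervalIntegral.integral_interval_sub_left]
  · exact hw.intervalIntegrable_of_two _ _
  · exact hw.intervalIntegrable_of_two _ _

theorem eq_add (h : IsL2Primitive F w) (a b : ℝ) : F b = F a + ∫ t in a..b, w t := by
  rw [← h.sub_eq a b]; ring

theorem add (hF : IsL2Primitive F w) (hG : IsL2Primitive G z) :
    IsL2Primitive (fun x => F x + G x) (fun x => w x + z x) := by
  refine ⟨hF.memLp.add hG.memLp, fun a b => ?_⟩
  rw [intervalIntegral.integral_add (hF.memLp.intervalIntegrable_of_two _ _)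
    (hG.memLp.intervalIntegrable_of_two _ _), ← hF.sub_eq, ← hG.sub_eq]
  ring

theorem const_mul (hF : IsL2Primitive F w) (c : ℝ) :
    IsL2Primitive (fun x => c * F x) (fun x => c * w x) := by
  refine ⟨hF.memLp.const_mul c, fun a b => ?_⟩
  rw [intervalIntegral.integral_const_mul, ← hF.sub_eq]
  ring

theorem sub (hF : IsL2Primitive F w) (hG : IsL2Primitive G z) :
    IsL2Primitive (fun x => F x - G x) (fun x => w x - z x) := by
  simpa [sub_eq_add_neg] using hF.add (hG.const_mul (-1))

theorem add_const (hF : IsL2Primitive F w) (c : ℝ) : IsL2Primitive (fun x => F x + c) w :=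
  ⟨hF.memLp, fun a b => by rw [← hF.sub_eq]; ring⟩

theorem continuous (hF : IsL2Primitive F w) : Continuous F := by
  have : F = fun x => F 0 + ∫ t in (0 : ℝ)..x, w t := funext fun x => hF.eq_add 0 x
  rw [this]
  exact continuous_const.add
    (intervalIntegral.continuous_primitive (fun a b => hF.memLp.intervalIntegrable_of_two a b) 0)

theorem absolutelyContinuousOnInterval (hF : IsL2Primitive F w) (a b : ℝ) :
    AbsolutelyContinuousOnInterval F a b := by
  have h1 : F = fun x => (∫ t in a..x, w t) - (-F a) := funext fun x => by
    rw [hF.eq_add a x]; ring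
  have h2 := (hF.memLp.intervalIntegrable_of_two a
    b).absolutelyContinuousOnInterval_intervalIntegral (c := a) left_mem_uIcc
  have h3 : AbsolutelyContinuousOnInterval (fun _ : ℝ => -F a) a b :=
    (LipschitzWith.const (-F a)).lipschitzOnWith.absolutelyContinuousOnInterval
  rw [h1]
  exact h2.sub h3

theorem ae_hasDerivAt (hF : IsL2Primitive F w) : ∀ᵐ x, HasDerivAt F (w x) x := by
  have h1 : F = fun x => F 0 + ∫ t in (0 : ℝ)..x, w t := funext fun x => hF.eq_add 0 x
  have h2 : LocallyIntegrable w volume := hF.memLp.locallyIntegrable (by norm_num)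
  filter_upwards [_root_.LocallyIntegrable.ae_hasDerivAt_integral h2] with x hx
  rw [h1]
  exact (hx 0).const_add _

theorem deriv_ae_eq (hF : IsL2Primitive F w) : deriv F =ᵐ[volume] w := by
  filter_upwards [hF.ae_hasDerivAt] with x hx using hx.deriv

/-- Restricting the derivative to `(p, q]` amounts to freezing the primitive outside `[p, q]`. -/
theorem clamp (hF : IsL2Primitive F w) (p q : ℝ) :
    IsL2Primitive (fun x => F (max p (min q x))) ((Ioc p q).indicator w) := by
  refine ⟨hF.memLp.indicator measurableSet_Ioc, fun a b => ?_⟩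
  wlog hab : a ≤ b generalizing a b
  · have := this b a (le_of_not_ge hab)
    rw [intervalIntegral.integral_symm, ← this]; ring
  rw [hF.sub_eq, intervalIntegral.integral_of_le (by gcongr), intervalIntegral.integral_of_le hab,
    setIntegral_indicator measurableSet_Ioc]
  -- Clamping the endpoints cuts `(a, b]` down to its part in `(p, q]`; for `q < p` both sets are
  -- empty.
  congr 2
  ext x
  simp only [mem_Ioc, mem_inter_iff, max_lt_iff, le_max_iff, le_min_iff, min_lt_iff]
  grind

end IsL2Primitive

/-- Cauchy–Schwarz for interval integrals. -/
theorem sq_intervalIntegral_le {w : ℝ → ℝ} (hw : MemLp w 2 volume) {a b : ℝ} :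
    (∫ t in a..b, w t) ^ 2 ≤ |b - a| * ∫ t, w t ^ 2 := by
  wlog hab : a ≤ b generalizing a b
  · have := this (le_of_not_ge hab)
    rwa [intervalIntegral.integral_symm, neg_sq, abs_sub_comm]
  have hI : Integrable (fun t => w t ^ 2) := hw.integrable_sq
  have h1 : (∫ t in a..b, w t) ^ 2 ≤ (b - a) * ∫ t in a..b, w t ^ 2 := by
    have hi := hw.intervalIntegrable_of_two a b
    have hi2 : IntervalIntegrable (fun t => w t ^ 2) volume a b := hI.intervalIntegrable
    rcases hab.eq_or_lt with rfl | hlt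
    · simp
    set m := (∫ t in a..b, w t) / (b - a) with hm
    -- The variance of `w` about its mean `m` is nonnegative; expanding it is the inequality.
    have h0 : 0 ≤ ∫ t in a..b, (w t - m) ^ 2 :=
      intervalIntegral.integral_nonneg hab fun _ _ => sq_nonneg _
    have h2 : ∫ t in a..b, (w t - m) ^ 2 =
        (∫ t in a..b, w t ^ 2) - 2 * m * (∫ t in a..b, w t) + m ^ 2 * (b - a) := by
      have : ∀ t, (w t - m) ^ 2 = (w t ^ 2 - (2 * m) * w t) + m ^ 2 := fun t => by ring
      simp_rw [this]
      rw [intervalIntegral.integral_add (hi2.sub (hi.const_mul _)) intervalIntegrable_const,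
        intervalIntegral.integral_sub hi2 (hi.const_mul _),
        intervalIntegral.integral_const_mul, intervalIntegral.integral_const, smul_eq_mul]
      ring
    have hpos : 0 < b - a := sub_pos.2 hlt
    have h3 : (∫ t in a..b, w t) = m * (b - a) := by rw [hm]; field_simp
    rw [h2, h3] at h0
    rw [h3]
    nlinarith
  refine h1.trans ?_
  rw [abs_of_nonneg (sub_nonneg.2 hab), intervalIntegral.integral_of_le hab]
  gcongr
  · exact ae_of_all _ fun _ => sq_nonneg _
  · exact Measure.restrict_le_self

/-! ### Continuous representatives and the extended domain of the Brownian form. -/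

/-- `F` and `w` are an absolutely continuous representative of an element of the extended domain
of `(½ 𝐃, H¹₀(J))` and its derivative. -/
structure IsDirichletPair (J : Set ℝ) (F w : ℝ → ℝ) : Prop extends IsL2Primitive F w where
  support : ∀ x ∉ J, w x = 0
  boundary : ∀ j ∈ closure J \ J, F j = 0

/-- Intervals whose finite endpoints outside of them form a bounded set, as is the case for all
nondegenerate intervals. -/
structure IsProperInterval (J : Set ℝ) : Prop where
  ordConnected : J.OrdConnected
  interior_nonempty : (interior J).Nonempty
  boundary_bounded : ∃ R : ℝ, ∀ j ∈ closure J \ J, |j| ≤ R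

namespace IsDirichletPair
variable {J : Set ℝ} {F G w z : ℝ → ℝ}

theorem sub' (hF : IsDirichletPair J F w) (hG : IsDirichletPair J G z) :
    IsDirichletPair J (fun x => F x - G x) (fun x => w x - z x) where
  toIsL2Primitive := hF.toIsL2Primitive.sub hG.toIsL2Primitive
  support x hx := by rw [hF.support x hx, hG.support x hx, sub_zero]
  boundary j hj := by rw [hF.boundary j hj, hG.boundary j hj, sub_zero]

theorem isH1Function (hF : IsDirichletPair J F w) : IsH1Function J F where
  absolutelyContinuous a _ b _ := hF.absolutelyContinuousOnInterval a b
  deriv_memLp := (hF.memLp.restrict J).ae_eq (ae_restrict_of_ae hF.deriv_ae_eq.symm)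
  boundary j hj := by
    have := (hF.continuous.tendsto j).mono_left (nhdsWithin_le_nhds (s := J))
    rwa [hF.boundary j hj] at this

end IsDirichletPair

namespace IsProperInterval
variable {J : Set ℝ} (hJ : IsProperInterval J)
include hJ

theorem convex : Convex ℝ J := hJ.ordConnected.convex

theorem measurableSet : MeasurableSet J := hJ.ordConnected.measurableSet

theorem closure_interior : closure (interior J) = closure J :=
  hJ.convex.closure_interior_eq_closure_of_nonempty_interior hJ.interior_nonempty

theorem interior_ae_eq : interior J =ᵐ[volume] J :=
  interior_ae_eq_of_null_frontier (hJ.convex.addHaar_frontier volume)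

theorem closure_ae_eq : closure J =ᵐ[volume] J :=
  closure_ae_eq_of_null_frontier (hJ.convex.addHaar_frontier volume)

theorem uIcc_subset_closure {a b : ℝ} (ha : a ∈ closure J) (hb : b ∈ closure J) :
    uIcc a b ⊆ closure J :=
  hJ.convex.closure.ordConnected.uIcc_subset ha hb

theorem intervalIntegral_indicator (w : ℝ → ℝ) {a b : ℝ} (ha : a ∈ closure J)
    (hb : b ∈ closure J) : ∫ t in a..b, J.indicator w t = ∫ t in a..b, w t := by
  apply intervalIntegral.integral_congr_ae
  filter_upwards [hJ.closure_ae_eq] with t ht htab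
  have : t ∈ closure J := hJ.uIcc_subset_closure ha hb (uIoc_subset_uIcc htab)
  exact indicator_of_mem (ht.mp this) w

/-- Integrals between points of `closure J` do not notice that the derivative has been cut off
outside `J`, because `J` differs from its closure by a null set. So only the values of `F` off the
closure change. -/
theorem exists_pair {F w : ℝ → ℝ} (hF : IsL2Primitive F w)
    (hb : ∀ j ∈ closure J \ J, F j = 0) :
    ∃ G, IsDirichletPair J G (J.indicator w) ∧ EqOn F G (closure J) := by
  obtain ⟨a, ha⟩ := hJ.interior_nonempty
  have ha' : a ∈ closure J := subset_closure (interior_subset ha)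
  have heq : EqOn F (fun x => F a + ∫ t in a..x, J.indicator w t) (closure J) := fun x hx => by
    simp only [hJ.intervalIntegral_indicator w ha' hx, ← hF.eq_add]
  refine ⟨_, ⟨IsL2Primitive.of_integral (hF.memLp.indicator hJ.measurableSet) (F a) a,
    fun x hx => indicator_of_notMem hx w, fun j hj => ?_⟩, heq⟩
  exact (heq hj.1).symm.trans (hb j hj)

/-- Since the derivative is square integrable up to the boundary, integrating it extends `f`
continuously from the interior, and the boundary values at excluded endpoints are limits along the
interior. Agreement stops at the interior: at an endpoint belonging to `J`, `IsH1Function` leaves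
`f` arbitrary. -/
theorem exists_pair_of_isH1Function {f : ℝ → ℝ} (hf : IsH1Function J f) :
    ∃ F, IsDirichletPair J F (J.indicator (deriv f)) ∧ EqOn f F (interior J) := by
  obtain ⟨a, ha⟩ := hJ.interior_nonempty
  have ha' : a ∈ closure J := subset_closure (interior_subset ha)
  have hw : MemLp (J.indicator (deriv f)) 2 volume :=
    (memLp_indicator_iff_restrict hJ.measurableSet).2 hf.deriv_memLp
  have hP := IsL2Primitive.of_integral hw (f a) a
  have heq : EqOn f (fun x => f a + ∫ t in a..x, J.indicator (deriv f) t) (interior J) := by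
    intro x hx
    have hx' : x ∈ closure J := subset_closure (interior_subset hx)
    simp only [hJ.intervalIntegral_indicator _ ha' hx',
      (hf.absolutelyContinuous a ha x hx).integral_deriv_eq_sub]
    ring
  refine ⟨_, ⟨hP, fun x hx => indicator_of_notMem hx _, fun j hj => ?_⟩, heq⟩
  have hj' : j ∈ closure (interior J) := by rw [hJ.closure_interior]; exact hj.1
  have : (𝓝[interior J] j).NeBot := mem_closure_iff_nhdsWithin_neBot.1 hj'
  have h1 : Tendsto f (𝓝[interior J] j) (𝓝 0) :=
    (hf.boundary j hj).mono_left (nhdsWithin_mono _ interior_subset)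
  have h2 := (hP.continuous.tendsto j).mono_left (nhdsWithin_le_nhds (s := interior J))
  refine tendsto_nhds_unique h2 (h1.congr' ?_)
  filter_upwards [self_mem_nhdsWithin] with x hx using heq hx

theorem measurePreserving_val :
    MeasurePreserving Subtype.val (lebesgueOn J) (volume.restrict J) :=
  measurePreserving_subtype_coe hJ.measurableSet

theorem ae_lebesgueOn_iff {p : ℝ → Prop} :
    (∀ᵐ x : J ∂(lebesgueOn J), p x) ↔ ∀ᵐ x ∂(volume.restrict J), p x := by
  rw [← hJ.measurePreserving_val.map_eq,
    (MeasurableEmbedding.subtype_coe hJ.measurableSet).ae_map_iff]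

/-- `J` lies in the closure of its interior, so a nonempty relatively open set contains a nonempty
open subset of the line. This upgrades almost everywhere equality of continuous functions to
equality on all of `J`, included endpoints too. -/
theorem isOpenPosMeasure : (lebesgueOn J).IsOpenPosMeasure := by
  refine ⟨fun U hU hne h0 => ?_⟩
  obtain ⟨V, hV, rfl⟩ := isOpen_induced_iff.1 hU
  obtain ⟨x, hx⟩ := hne
  have h1 : volume (V ∩ J) = 0 := by
    rw [← Measure.restrict_apply hV.measurableSet,
      ← hJ.measurePreserving_val.measure_preimage hV.nullMeasurableSet]
    exact h0
  have hx' : (x : ℝ) ∈ closure (interior J) := by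
    rw [hJ.closure_interior]; exact subset_closure x.2
  have h2 : (V ∩ interior J).Nonempty := mem_closure_iff.1 hx' V hV hx
  exact ((hV.inter isOpen_interior).measure_pos volume h2).ne'
    (measure_mono_null (inter_subset_inter_right V interior_subset) h1)

theorem eq_of_ae_eq {u v : J → ℝ} (hu : Continuous u) (hv : Continuous v)
    (h : u =ᵐ[lebesgueOn J] v) : u = v := by
  have := hJ.isOpenPosMeasure
  exact (hu.ae_eq_iff_eq (lebesgueOn J) hv).1 h

theorem eqOn_of_ae_eq {F G w z : ℝ → ℝ} (hF : IsDirichletPair J F w) (hG : IsDirichletPair J G z)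
    (h : ∀ᵐ x : J ∂(lebesgueOn J), F x = G x) : EqOn F G J := fun x hx =>
  congrFun (hJ.eq_of_ae_eq (hF.continuous.comp continuous_subtype_val)
    (hG.continuous.comp continuous_subtype_val) h) ⟨x, hx⟩

theorem deriv_ae_eq_of_eqOn {f g : ℝ → ℝ} (h : EqOn f g (interior J)) :
    deriv f =ᵐ[volume.restrict J] deriv g := by
  rw [← Measure.restrict_congr_set hJ.interior_ae_eq]
  filter_upwards [ae_restrict_mem isOpen_interior.measurableSet] with x hx
  exact (h.eventuallyEq_of_mem (isOpen_interior.mem_nhds hx)).deriv_eq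

theorem pair_ae_eq {F G w z : ℝ → ℝ} (hF : IsDirichletPair J F w) (hG : IsDirichletPair J G z)
    (h : EqOn F G J) : w =ᵐ[volume] z := by
  have h1 := hJ.deriv_ae_eq_of_eqOn (h.mono interior_subset)
  rw [EventuallyEq, ae_restrict_iff' hJ.measurableSet] at h1
  filter_upwards [h1, hF.deriv_ae_eq, hG.deriv_ae_eq] with x hx hFx hGx
  by_cases hxJ : x ∈ J
  · rw [← hFx, ← hGx, hx hxJ]
  · rw [hF.support x hxJ, hG.support x hxJ]

end IsProperInterval

theorem MeasureTheory.MemLp.inner_toLp {α : Type*} [MeasurableSpace α] {μ : Measure α}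
    {f g : α → ℝ} (hf : MemLp f 2 μ) (hg : MemLp g 2 μ) :
    inner ℝ (hf.toLp f) (hg.toLp g) = ∫ x, f x * g x ∂μ := by
  rw [L2.inner_def]
  apply integral_congr_ae
  filter_upwards [hf.coeFn_toLp, hg.coeFn_toLp] with x hx hy
  rw [hx, hy, real_inner_eq_re_inner ℝ]
  simp [mul_comm]

theorem MeasureTheory.MemLp.norm_toLp_sub_sq {α : Type*} [MeasurableSpace α] {μ : Measure α}
    {f g : α → ℝ} (hf : MemLp f 2 μ) (hg : MemLp g 2 μ) :
    ‖hf.toLp f - hg.toLp g‖ ^ 2 = ∫ x, (f x - g x) * (f x - g x) ∂μ := by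
  rw [← MemLp.toLp_sub, ← real_inner_self_eq_norm_sq, MemLp.inner_toLp]
  rfl

/-- The class `u ∈ L²(J)` has the representative `F` in the domain of `½ 𝐃`, with derivative
`w`. -/
structure IsDirichletVersion (J : Set ℝ) (u : Lp ℝ 2 (lebesgueOn J)) (F w : ℝ → ℝ) : Prop
    extends IsDirichletPair J F w where
  ae_eq : ∀ᵐ x : J ∂(lebesgueOn J), u x = F x

theorem IsDirichletVersion.sub {J : Set ℝ} {u v : Lp ℝ 2 (lebesgueOn J)} {F G w z : ℝ → ℝ}
    (hu : IsDirichletVersion J u F w) (hv : IsDirichletVersion J v G z) :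
    IsDirichletVersion J (u - v) (fun x => F x - G x) (fun x => w x - z x) where
  toIsDirichletPair := hu.toIsDirichletPair.sub' hv.toIsDirichletPair
  ae_eq := by
    filter_upwards [hu.ae_eq, hv.ae_eq, Lp.coeFn_sub u v] with x h1 h2 h3
    rw [h3, Pi.sub_apply, h1, h2]

theorem IsDirichletVersion.zero (J : Set ℝ) :
    IsDirichletVersion J 0 (fun _ => 0) (fun _ => 0) where
  memLp := MemLp.zero'
  sub_eq a b := by simp
  support _ _ := rfl
  boundary _ _ := rfl
  ae_eq := by
    filter_upwards [Lp.coeFn_zero ℝ 2 (lebesgueOn J)] with x hx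
    rw [hx]; rfl

namespace IsProperInterval
variable {J : Set ℝ} (hJ : IsProperInterval J)
include hJ

theorem exists_version_of_isH1Version {u : Lp ℝ 2 (lebesgueOn J)} {f : ℝ → ℝ}
    (hf : IsH1Version J u f) :
    ∃ F, IsDirichletVersion J u F (J.indicator (deriv f)) := by
  obtain ⟨F, hF, heq⟩ := hJ.exists_pair_of_isH1Function hf.1
  refine ⟨F, hF, ?_⟩
  have h1 : ∀ᵐ x : J ∂(lebesgueOn J), (x : ℝ) ∈ interior J := by
    refine (hJ.ae_lebesgueOn_iff (p := fun x => x ∈ interior J)).2 ?_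
    rw [← Measure.restrict_congr_set hJ.interior_ae_eq]
    exact ae_restrict_mem isOpen_interior.measurableSet
  filter_upwards [hf.2, h1] with x hx hx1
  rw [hx, heq hx1]

theorem mem_dom_iff {u : Lp ℝ 2 (lebesgueOn J)} :
    u ∈ (brownianForm J).dom ↔ ∃ F w, IsDirichletVersion J u F w := by
  constructor
  · rintro ⟨f, hf⟩
    obtain ⟨F, hF⟩ := hJ.exists_version_of_isH1Version hf
    exact ⟨F, _, hF⟩
  · rintro ⟨F, w, h⟩
    exact ⟨F, h.isH1Function, h.ae_eq⟩

theorem version_eqOn {u : Lp ℝ 2 (lebesgueOn J)} {F G w z : ℝ → ℝ}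
    (hF : IsDirichletVersion J u F w) (hG : IsDirichletVersion J u G z) : EqOn F G J := by
  refine hJ.eqOn_of_ae_eq hF.toIsDirichletPair hG.toIsDirichletPair ?_
  filter_upwards [hF.ae_eq, hG.ae_eq] with x h1 h2
  rw [← h1, h2]

theorem version_ae_eq {u : Lp ℝ 2 (lebesgueOn J)} {F G w z : ℝ → ℝ}
    (hF : IsDirichletVersion J u F w) (hG : IsDirichletVersion J u G z) : w =ᵐ[volume] z :=
  hJ.pair_ae_eq hF.toIsDirichletPair hG.toIsDirichletPair (hJ.version_eqOn hF hG)

/-- The version chosen by `h1Version` is not canonical, but its derivative is determined almost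
everywhere; hence the energy may be computed from any pair. -/
theorem deriv_h1Version_ae_eq {u : Lp ℝ 2 (lebesgueOn J)} {F w : ℝ → ℝ}
    (hF : IsDirichletVersion J u F w) :
    J.indicator (deriv (h1Version J u)) =ᵐ[volume] w := by
  have h : IsH1Version J u (h1Version J u) :=
    Classical.epsilon_spec (p := IsH1Version J u) ⟨F, hF.isH1Function, hF.ae_eq⟩
  obtain ⟨G, hG⟩ := hJ.exists_version_of_isH1Version h
  exact hJ.version_ae_eq hG hF

theorem energy_eq {u v : Lp ℝ 2 (lebesgueOn J)} {F G w z : ℝ → ℝ}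
    (hF : IsDirichletVersion J u F w) (hG : IsDirichletVersion J v G z) :
    (brownianForm J).energy u v = 1 / 2 * ∫ x, w x * z x := by
  simp only [brownianForm]
  rw [← integral_indicator hJ.measurableSet]
  congr 1
  apply integral_congr_ae
  filter_upwards [hJ.deriv_h1Version_ae_eq hF, hJ.deriv_h1Version_ae_eq hG] with x h1 h2
  rw [← h1, ← h2]
  by_cases hx : x ∈ J <;> simp [hx]

/-- The derivatives of an approximating sequence converge to the derivative of the limit. -/
theorem exists_pair_of_approximates {un : ℕ → Lp ℝ 2 (lebesgueOn J)} {u : J → ℝ}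
    (h : (brownianForm J).Approximates un u) :
    ∃ F w, ∃ hP : IsDirichletPair J F w, (∀ᵐ x : J ∂(lebesgueOn J), u x = F x) ∧
      ∀ (Fn wn : ℕ → ℝ → ℝ) (hn : ∀ n, IsDirichletVersion J (un n) (Fn n) (wn n)),
        Tendsto (fun n => (hn n).memLp.toLp (wn n)) atTop (𝓝 (hP.memLp.toLp w)) := by
  choose Fn wn hn using fun n => hJ.mem_dom_iff.1 (h.mem n)
  have hC : CauchySeq fun n => (hn n).memLp.toLp (wn n) := by
    rw [Metric.cauchySeq_iff]
    intro ε hε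
    obtain ⟨N, hN⟩ := h.cauchy (1 / 2 * ε ^ 2) (by positivity)
    refine ⟨N, fun i hi j hj => ?_⟩
    have h1 := hN i hi j hj
    rw [hJ.energy_eq ((hn i).sub (hn j)) ((hn i).sub (hn j)),
      ← (hn i).memLp.norm_toLp_sub_sq (hn j).memLp] at h1
    rw [dist_eq_norm]
    exact lt_of_pow_lt_pow_left₀ 2 hε.le (by linarith)
  obtain ⟨W, hW⟩ := cauchySeq_tendsto_of_complete hC
  -- The derivatives `wn` vanish off `J`, so replacing their limit by its restriction to `J` can
  -- only bring it closer to them; the pair then has support in `J` everywhere, not merely almost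
  -- everywhere.
  have hw : MemLp (J.indicator W) 2 volume := (Lp.memLp W).indicator hJ.measurableSet
  have hlim : Tendsto (fun n => (hn n).memLp.toLp (wn n)) atTop (𝓝 (hw.toLp _)) := by
    rw [tendsto_iff_norm_sub_tendsto_zero] at hW ⊢
    refine squeeze_zero (fun _ => norm_nonneg _) (fun n => ?_) hW
    have h2 : ‖(hn n).memLp.toLp (wn n) - W‖ ^ 2
        = ‖(hn n).memLp.toLp (wn n) - (Lp.memLp W).toLp W‖ ^ 2 := by rw [Lp.toLp_coeFn]
    refine le_of_sq_le_sq ?_ (norm_nonneg _)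
    rw [h2, MemLp.norm_toLp_sub_sq, MemLp.norm_toLp_sub_sq]
    have hi := ((hn n).memLp.sub (Lp.memLp W)).integrable_mul ((hn n).memLp.sub (Lp.memLp W))
    refine integral_mono_of_nonneg (ae_of_all _ fun _ => mul_self_nonneg _) hi
      (ae_of_all _ fun x => ?_)
    by_cases hx : x ∈ J
    · simp [hx]
    · simpa [hx, (hn n).support x hx] using mul_self_nonneg (W x)
  have hae : ∀ᵐ x : J ∂(lebesgueOn J), ∀ n, un n x = Fn n x :=
    ae_all_iff.2 fun n => (hn n).ae_eq
  have := hJ.isOpenPosMeasure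
  have hne : (lebesgueOn J) ≠ 0 := by
    obtain ⟨x, hx⟩ := hJ.interior_nonempty
    have : Nonempty J := ⟨⟨x, interior_subset hx⟩⟩
    exact NeZero.ne _
  have : (ae (lebesgueOn J)).NeBot := ae_neBot.2 hne
  -- One anchor point suffices: convergence at `y₀` and L² convergence of the derivatives give, by
  -- Cauchy–Schwarz, convergence at every point of `closure J`, excluded endpoints included. The
  -- zero boundary values therefore survive in the limit.
  obtain ⟨y₀, hy1, hy2⟩ := (h.tendsto.and hae).exists
  have hpt : ∀ y ∈ closure J, Tendsto (fun n => Fn n y) atTop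
      (𝓝 (u y₀ + ∫ t in (y₀ : ℝ)..y, J.indicator W t)) := by
    intro y hy
    have e : ∀ n, Fn n y = un n y₀ + ∫ t in (y₀ : ℝ)..y, wn n t := fun n => by
      rw [hy2 n, ← (hn n).eq_add]
    simp_rw [e]
    refine hy1.add ?_
    rw [tendsto_iff_norm_sub_tendsto_zero] at hlim ⊢
    have h3 : Tendsto (fun n => √|y - y₀| * ‖(hn n).memLp.toLp (wn n) - hw.toLp _‖) atTop (𝓝 0) := by
      simpa using hlim.const_mul (√|y - y₀|)
    refine squeeze_zero (fun _ => norm_nonneg _) (fun n => ?_) h3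
    rw [← intervalIntegral.integral_sub ((hn n).memLp.intervalIntegrable_of_two _ _)
      (hw.intervalIntegrable_of_two _ _)]
    refine le_of_sq_le_sq ?_ (by positivity)
    rw [mul_pow, Real.sq_sqrt (abs_nonneg _), MemLp.norm_toLp_sub_sq, Real.norm_eq_abs, sq_abs]
    refine (sq_intervalIntegral_le ((hn n).memLp.sub hw)).trans_eq ?_
    simp only [Pi.sub_apply, sq]
  have hP : IsDirichletPair J (fun y => u y₀ + ∫ t in (y₀ : ℝ)..y, J.indicator W t)
      (J.indicator W) := by
    refine ⟨IsL2Primitive.of_integral hw _ _, fun x hx => indicator_of_notMem hx _,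
      fun j hj => ?_⟩
    refine tendsto_nhds_unique (hpt j hj.1) ?_
    simp [fun n => (hn n).boundary j hj]
  refine ⟨_, _, hP, ?_, fun Gn zn hGn => ?_⟩
  · filter_upwards [h.tendsto, hae] with x hx1 hx2
    refine tendsto_nhds_unique hx1 ?_
    simp_rw [hx2]
    exact hpt x (subset_closure x.2)
  · convert! hlim using 2 with n
    rw [MemLp.toLp_eq_toLp_iff]
    exact hJ.version_ae_eq (hGn n) (hn n)

theorem exists_pair_of_memExtended {u : J → ℝ} (h : (brownianForm J).MemExtended u)
    (hu : Continuous u) : ∃ F w, IsDirichletPair J F w ∧ ∀ x : J, u x = F x := by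
  obtain ⟨un, hn⟩ := h
  obtain ⟨F, w, hP, hae, -⟩ := hJ.exists_pair_of_approximates hn
  exact ⟨F, w, hP, fun x =>
    congrFun (hJ.eq_of_ae_eq hu (hP.continuous.comp continuous_subtype_val) hae) x⟩

/-- The limit of the derivatives depends only on the limit function, not on the approximating
sequence; this makes the extended energy well defined. -/
theorem tendsto_toLp_of_approximates {un : ℕ → Lp ℝ 2 (lebesgueOn J)} {F w : ℝ → ℝ}
    (hP : IsDirichletPair J F w)
    (h : (brownianForm J).Approximates un fun x => F x) (Fn wn : ℕ → ℝ → ℝ)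
    (hn : ∀ n, IsDirichletVersion J (un n) (Fn n) (wn n)) :
    Tendsto (fun n => (hn n).memLp.toLp (wn n)) atTop (𝓝 (hP.memLp.toLp w)) := by
  obtain ⟨G, z, hG, hae, hlim⟩ := hJ.exists_pair_of_approximates h
  convert! hlim Fn wn hn using 2
  rw [MemLp.toLp_eq_toLp_iff]
  exact hJ.pair_ae_eq hP hG (hJ.eqOn_of_ae_eq hP hG hae)

end IsProperInterval

/-! ### Cut-offs at infinity. -/

/-- A primitive of a square integrable function can be cut off at infinity at the price of
arbitrarily little energy. -/
theorem IsL2Primitive.exists_cutoff {F w : ℝ → ℝ} (hF : IsL2Primitive F w) {R : ℝ} (hR : 0 ≤ R) :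
    ∃ Fn wn : ℕ → ℝ → ℝ, ∃ hn : ∀ n, IsL2Primitive (Fn n) (wn n),
      (∀ n, HasCompactSupport (Fn n)) ∧ (∀ (n : ℕ) x, |x| ≤ n + R → Fn n x = F x) ∧
        Tendsto (fun n => (hn n).memLp.toLp (wn n)) atTop (𝓝 (hF.memLp.toLp w)) := by
  -- `F` is kept on `[-N, N]` and brought linearly to zero within a further distance `L`. A ramp of
  -- height `c` and length `L` has squared slope norm `c ^ 2 / L`, so this `L` makes it at most `1 /
  -- (n + 1)` for both end values; the summand `1` keeps `L` positive when they vanish.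
  let N : ℕ → ℝ := fun n => n + R
  let L : ℕ → ℝ := fun n => (n + 1) * (1 + F (N n) ^ 2 + F (-N n) ^ 2)
  have hN : ∀ n, 0 ≤ N n := fun n => by positivity
  have hL : ∀ n, 0 < L n := fun n => by positivity
  have hone : ∀ p q : ℝ, IsL2Primitive (fun x => max p (min q x)) ((Ioc p q).indicator 1) := by
    refine fun p q => ⟨memLp_indicator_const 2 measurableSet_Ioc 1 (Or.inr (by simp)), ?_⟩
    intro a b
    wlog hab : a ≤ b generalizing a b
    · have := this b a (le_of_not_ge hab)
      rw [intervalIntegral.integral_symm, ← this]; ring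
    rw [intervalIntegral.integral_of_le hab, setIntegral_indicator measurableSet_Ioc, Ioc_inter_Ioc]
    simp only [Pi.one_apply, setIntegral_const, smul_eq_mul, mul_one, measureReal_def,
      Real.volume_Ioc]
    rw [ENNReal.toReal_ofReal']
    grind
  -- `P` freezes `F` outside `[-N, N]`; `A` rises from `0` to `F N` on the right of `N`, and `B`
  -- takes the value `0` right of `-N` and `-F (-N)` left of `-N - L`. The cut-off is `P - A + B`.
  let P : ℕ → ℝ → ℝ := fun n x => F (max (-N n) (min (N n) x))
  let A : ℕ → ℝ → ℝ := fun n x => (F (N n) / L n) * (max (N n) (min (N n + L n) x) + (-N n))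
  let B : ℕ → ℝ → ℝ := fun n x =>
    (F (-N n) / L n) * (max (-N n - L n) (min (-N n) x) + N n)
  let p : ℕ → ℝ → ℝ := fun n => (Ioc (-N n) (N n)).indicator w
  let a : ℕ → ℝ → ℝ := fun n x => (F (N n) / L n) * (Ioc (N n) (N n + L n)).indicator 1 x
  let b : ℕ → ℝ → ℝ := fun n x => (F (-N n) / L n) * (Ioc (-N n - L n) (-N n)).indicator 1 x
  have hP : ∀ n, IsL2Primitive (P n) (p n) := fun n => hF.clamp _ _
  have hA : ∀ n, IsL2Primitive (A n) (a n) := fun n =>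
    ((hone _ _).add_const _).const_mul _
  have hB : ∀ n, IsL2Primitive (B n) (b n) := fun n =>
    ((hone _ _).add_const _).const_mul _
  have hn : ∀ n, IsL2Primitive (fun x => P n x - A n x + B n x) (fun x => p n x - a n x + b n x) :=
    fun n => ((hP n).sub (hA n)).add (hB n)
  refine ⟨_, _, hn, fun n => ?_, fun n x hx => ?_, ?_⟩
  · refine HasCompactSupport.intro (isCompact_Icc (a := -N n - L n) (b := N n + L n))
      fun x hx => ?_
    have hNn := hN n
    have hLn := hL n
    simp only [P, A, B]
    by_cases h : x < -N n - L n
    · rw [min_eq_right (by linarith : x ≤ N n), max_eq_left (by linarith : x ≤ -N n),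
        min_eq_right (by linarith : x ≤ N n + L n), max_eq_left (by linarith : x ≤ N n),
        min_eq_right (by linarith : x ≤ -N n), max_eq_left h.le]
      field_simp
      ring
    · have h' : N n + L n < x := by
        by_contra hc
        exact hx ⟨not_lt.1 h, not_lt.1 hc⟩
      rw [min_eq_left (by linarith : N n ≤ x), max_eq_right (by linarith : -N n ≤ N n),
        min_eq_left h'.le, max_eq_right (by linarith : N n ≤ N n + L n),
        min_eq_left (by linarith : -N n ≤ x), max_eq_right (by linarith : -N n - L n ≤ -N n)]
      field_simp
      ring
  · obtain ⟨h1, h2⟩ := abs_le.1 (show |x| ≤ N n from hx)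
    have hLn := hL n
    simp only [P, A, B]
    rw [min_eq_right h2, max_eq_right h1, min_eq_right (by linarith : x ≤ N n + L n),
      max_eq_left h2, min_eq_left h1, max_eq_right (by linarith : -N n - L n ≤ -N n)]
    ring
  · have key : ∀ n, ‖(hn n).memLp.toLp _ - hF.memLp.toLp w‖ ≤
        ‖(hP n).memLp.toLp _ - hF.memLp.toLp w‖ + ‖(hA n).memLp.toLp _‖
          + ‖(hB n).memLp.toLp _‖ := fun n => by
      have e : (hn n).memLp.toLp _ = (hP n).memLp.toLp _ - (hA n).memLp.toLp _
          + (hB n).memLp.toLp _ := by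
        rw [← MemLp.toLp_sub, ← MemLp.toLp_add]; rfl
      rw [e, show ∀ x y z t : Lp ℝ 2 (volume : Measure ℝ), x - y + z - t = (x - t) - y + z from
        fun x y z t => by abel]
      exact (norm_add_le _ _).trans (add_le_add_left (norm_sub_le _ _) _)
    have hsmall : ∀ (c : ℕ → ℝ) (s : ℕ → Set ℝ) (hs : ∀ n, MeasurableSet (s n))
        (hv : ∀ n, volume.real (s n) = L n) (hc : ∀ n, c n ^ 2 ≤ 1 + F (N n) ^ 2 + F (-N n) ^ 2)
        (hm : ∀ n, MemLp (fun x => (c n / L n) * (s n).indicator 1 x) 2 volume),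
        Tendsto (fun n => ‖(hm n).toLp _‖) atTop (𝓝 0) := by
      intro c s hs hv hc hm
      have h1 : Tendsto (fun n : ℕ => √(1 / ((n : ℝ) + 1))) atTop (𝓝 0) := by
        have h := (Real.continuous_sqrt.tendsto 0).comp
          (tendsto_one_div_add_atTop_nhds_zero_nat (𝕜 := ℝ))
        rwa [Real.sqrt_zero] at h
      refine squeeze_zero (fun _ => norm_nonneg _) (fun n => Real.le_sqrt_of_sq_le ?_) h1
      rw [← real_inner_self_eq_norm_sq, MemLp.inner_toLp]
      have e : ∀ x, (c n / L n) * (s n).indicator 1 x * ((c n / L n) * (s n).indicator 1 x)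
          = (s n).indicator (fun _ => (c n / L n) ^ 2) x := fun x => by
        by_cases hx : x ∈ s n
        · simp [hx]; ring
        · simp [hx]
      simp_rw [e]
      rw [integral_indicator (hs n), setIntegral_const, hv, smul_eq_mul]
      have hq : 0 < 1 + F (N n) ^ 2 + F (-N n) ^ 2 := by positivity
      have : L n * (c n / L n) ^ 2 = c n ^ 2 / L n := by
        field_simp [(hL n).ne']
      rw [this, div_le_div_iff₀ (hL n) (by positivity)]
      have hc' := mul_le_mul_of_nonneg_right (hc n) (by positivity : (0 : ℝ) ≤ (n : ℝ) + 1)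
      simp only [L]
      linarith
    have hA0 : Tendsto (fun n => ‖(hA n).memLp.toLp _‖) atTop (𝓝 0) :=
      hsmall (fun n => F (N n)) _ (fun n => measurableSet_Ioc)
        (fun n => by simp [measureReal_def, (hL n).le])
        (fun n => by nlinarith [sq_nonneg (F (-N n))]) _
    have hB0 : Tendsto (fun n => ‖(hB n).memLp.toLp _‖) atTop (𝓝 0) :=
      hsmall (fun n => F (-N n)) _ (fun n => measurableSet_Ioc)
        (fun n => by simp [measureReal_def, (hL n).le])
        (fun n => by nlinarith [sq_nonneg (F (N n))]) _
    have hP0 : Tendsto (fun n => ‖(hP n).memLp.toLp _ - hF.memLp.toLp w‖) atTop (𝓝 0) := by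
      have h2 : Tendsto (fun n => ∫ x, (p n x - w x) * (p n x - w x)) atTop (𝓝 0) := by
        have h0 : (0 : ℝ) = ∫ _ : ℝ, (0 : ℝ) := by simp
        rw [h0]
        refine tendsto_integral_of_dominated_convergence (fun x => w x * w x) (fun n => ?_)
          (hF.memLp.integrable_mul hF.memLp) (fun n => ae_of_all _ fun x => ?_)
          (ae_of_all _ fun x => ?_)
        · exact (((hP n).memLp.sub hF.memLp).integrable_mul
            ((hP n).memLp.sub hF.memLp)).aestronglyMeasurable
        · by_cases hx : x ∈ Ioc (-N n) (N n)
          · simp [p, hx, mul_self_nonneg]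
          · simp [p, hx]
        · refine tendsto_const_nhds.congr' ?_
          filter_upwards [eventually_gt_atTop ⌈|x|⌉₊] with n hn'
          have : |x| < n := (Nat.le_ceil _).trans_lt (by exact_mod_cast hn')
          have hx : x ∈ Ioc (-N n) (N n) := by
            obtain ⟨h3, h4⟩ := abs_lt.1 this
            constructor <;> simp only [N] <;> linarith
          simp [p, hx]
      have h3 := (Real.continuous_sqrt.tendsto 0).comp h2
      rw [Real.sqrt_zero] at h3
      refine h3.congr fun n => ?_
      simp only [Function.comp_apply]
      rw [← MemLp.norm_toLp_sub_sq (hP n).memLp hF.memLp, Real.sqrt_sq (norm_nonneg _)]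
    rw [tendsto_iff_norm_sub_tendsto_zero]
    refine squeeze_zero (fun _ => norm_nonneg _) key ?_
    simpa using (hP0.add hA0).add hB0

namespace IsProperInterval
variable {J : Set ℝ} (hJ : IsProperInterval J)
include hJ

/-- A pair need not be square integrable itself, but its cut-offs have compact support. Their
derivatives converge in L², and at each point they are eventually equal to `F`. -/
theorem memExtended_of_pair {F w : ℝ → ℝ} (hF : IsDirichletPair J F w) :
    (brownianForm J).MemExtended fun x => F x := by
  obtain ⟨R, hR⟩ := hJ.boundary_bounded
  -- With `R` bounding the excluded endpoints, every cut-off agrees with `F` there and keeps its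
  -- zero boundary values.
  obtain ⟨Fn, wn, hn, hsupp, heq, hlim⟩ :=
    hF.toIsL2Primitive.exists_cutoff (R := max R 0) (le_max_right _ _)
  have hb : ∀ n, ∀ j ∈ closure J \ J, Fn n j = 0 := fun n j hj => by
    rw [heq n j, hF.boundary j hj]
    have := hR j hj
    have := le_max_left R 0
    have : (0 : ℝ) ≤ n := n.cast_nonneg
    linarith
  choose Gn hGn heqG using fun n => hJ.exists_pair (hn n) (hb n)
  have hL : ∀ n, MemLp (fun x : J => Fn n x) 2 (lebesgueOn J) := fun n =>
    MemLp.comp_measurePreserving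
      (((hn n).continuous.memLp_of_hasCompactSupport (hsupp n)).restrict J) hJ.measurePreserving_val
  have hv : ∀ n, IsDirichletVersion J ((hL n).toLp _) (Gn n) (J.indicator (wn n)) := fun n =>
    ⟨hGn n, by
      filter_upwards [(hL n).coeFn_toLp] with x hx
      rw [hx, heqG n (subset_closure x.2)]⟩
  refine ⟨fun n => (hL n).toLp _, fun n => hJ.mem_dom_iff.2 ⟨_, _, hv n⟩, fun ε hε => ?_, ?_⟩
  · obtain ⟨N, hN⟩ := Metric.cauchySeq_iff.1 hlim.cauchySeq (√ε) (Real.sqrt_pos.2 hε)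
    refine ⟨N, fun i hi j hj => ?_⟩
    rw [hJ.energy_eq ((hv i).sub (hv j)) ((hv i).sub (hv j))]
    have h1 := hN i hi j hj
    rw [dist_eq_norm, Real.lt_sqrt (norm_nonneg _), MemLp.norm_toLp_sub_sq] at h1
    have h2 : ∫ x, (J.indicator (wn i) x - J.indicator (wn j) x)
        * (J.indicator (wn i) x - J.indicator (wn j) x)
        ≤ ∫ x, (wn i x - wn j x) * (wn i x - wn j x) := by
      refine integral_mono_of_nonneg (ae_of_all _ fun _ => mul_self_nonneg _)
        (((hn i).memLp.sub (hn j).memLp).integrable_mul ((hn i).memLp.sub (hn j).memLp))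
        (ae_of_all _ fun x => ?_)
      by_cases hx : x ∈ J
      · simp [hx]
      · simpa [hx] using mul_self_nonneg _
    have h3 : 0 ≤ ∫ x, (wn i x - wn j x) * (wn i x - wn j x) :=
      integral_nonneg fun _ => mul_self_nonneg _
    linarith
  · have hae : ∀ᵐ x : J ∂(lebesgueOn J), ∀ n, (hL n).toLp _ x = Fn n x :=
      ae_all_iff.2 fun n => (hL n).coeFn_toLp
    filter_upwards [hae] with x hx
    refine tendsto_const_nhds.congr' ?_
    filter_upwards [eventually_gt_atTop ⌈|(x : ℝ)|⌉₊] with n hn'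
    have : |(x : ℝ)| < n := (Nat.le_ceil _).trans_lt (by exact_mod_cast hn')
    rw [hx n, heq n x]
    have := le_max_right R 0
    linarith

theorem hasExtEnergy {F G w z : ℝ → ℝ} (hF : IsDirichletPair J F w) (hG : IsDirichletPair J G z) :
    (brownianForm J).HasExtEnergy (fun x => F x) (fun x => G x) (1 / 2 * ∫ x, w x * z x) := by
  refine ⟨hJ.memExtended_of_pair hF, hJ.memExtended_of_pair hG, fun un vn hu hv => ?_⟩
  choose Fn wn hn using fun n => hJ.mem_dom_iff.1 (hu.mem n)
  choose Gn zn hk using fun n => hJ.mem_dom_iff.1 (hv.mem n)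
  have h := (hJ.tendsto_toLp_of_approximates hF hu Fn wn hn).inner
    (hJ.tendsto_toLp_of_approximates hG hv Gn zn hk) (𝕜 := ℝ)
  simp only [MemLp.inner_toLp] at h
  exact (h.const_mul (1 / 2)).congr fun n => (hJ.energy_eq (hn n) (hk n)).symm

/-- The value is unique since both functions do possess approximating sequences, along which the
energies have one limit. -/
theorem hasExtEnergy_iff {F G w z : ℝ → ℝ} (hF : IsDirichletPair J F w)
    (hG : IsDirichletPair J G z) {c : ℝ} :
    (brownianForm J).HasExtEnergy (fun x => F x) (fun x => G x) c ↔
      c = 1 / 2 * ∫ x, w x * z x := by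
  have h := hJ.hasExtEnergy hF hG
  constructor
  · intro h'
    obtain ⟨un, hu⟩ := h.1
    obtain ⟨vn, hv⟩ := h.2.1
    exact tendsto_nhds_unique (h'.2.2 un vn hu hv) (h.2.2 un vn hu hv)
  · rintro rfl
    exact h

/-! ### Points have positive capacity, uniformly -/

/-- If `u ≥ 1` on a nonempty open set, its representative is at least `1` at some `z`, and by
Cauchy–Schwarz it can only become small near `z` at the price of a large derivative. So either the
norm or the energy is large, with a constant independent of `z`. -/
theorem exists_le_energyOne : ∃ c > (0 : ℝ), ∀ u ∈ (brownianForm J).dom, ∀ G : Set J,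
    IsOpen G → G.Nonempty → (∀ᵐ x ∂(lebesgueOn J), x ∈ G → 1 ≤ u x) →
      c ≤ (brownianForm J).energyOne u := by
  obtain ⟨x₀, hx₀⟩ := hJ.interior_nonempty
  obtain ⟨ε, hε, hball⟩ := Metric.isOpen_iff.1 isOpen_interior x₀ hx₀
  set δ := min 1 (ε / 2) with hδ
  have hδ0 : 0 < δ := lt_min one_pos (by positivity)
  have hδ1 : δ ≤ 1 := min_le_left _ _
  have hδε : δ ≤ ε / 2 := min_le_right _ _
  have hsub : ∀ y, |y - x₀| ≤ δ → y ∈ J := fun y hy => interior_subset (hball (by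
    rw [Metric.mem_ball, Real.dist_eq]; linarith))
  -- The constant comes from integrating `1 ≤ 2 * F y ^ 2 + 2 * δ * D` over an interval of length
  -- `δ`; as `δ ≤ 1`, this gives `δ ≤ 2 * ‖u‖ ^ 2 + 2 * D`, while the energy is `D / 2`.
  refine ⟨δ / 4, by positivity, fun u hu G hG hne h1 => ?_⟩
  obtain ⟨F, w, hF⟩ := hJ.mem_dom_iff.1 hu
  obtain ⟨z, hzG, hz⟩ : ∃ z : J, z ∈ G ∧ 1 ≤ F z := by
    have := hJ.isOpenPosMeasure
    have hpos : lebesgueOn J G ≠ 0 := (hG.measure_pos _ hne).ne'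
    obtain ⟨z, hz, h3⟩ := Frequently.exists
      ((frequently_ae_mem_iff.2 hpos).and_eventually (h1.and hF.ae_eq))
    exact ⟨z, hz, by rw [← h3.2]; exact h3.1 hz⟩
  -- However close `z` is to the boundary, one can move a distance `δ` from it towards `x₀` inside
  -- `J`, because `x₀ - δ` and `x₀ + δ` belong to `J`.
  obtain ⟨p, q, hpq, hpJ, hpz⟩ : ∃ p q : ℝ, q - p = δ ∧ Icc p q ⊆ J ∧
      ∀ y ∈ Icc p q, |y - z| ≤ δ := by
    rcases le_total (z : ℝ) x₀ with hle | hle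
    · refine ⟨z, z + δ, by ring, fun y hy => ?_, fun y hy => ?_⟩
      · exact hJ.ordConnected.out z.2 (hsub (x₀ + δ) (by simp [abs_of_pos hδ0]))
          ⟨hy.1, by linarith [hy.2]⟩
      · rw [abs_le]; constructor <;> linarith [hy.1, hy.2]
    · refine ⟨z - δ, z, by ring, fun y hy => ?_, fun y hy => ?_⟩
      · exact hJ.ordConnected.out (hsub (x₀ - δ) (by simp [abs_of_pos hδ0])) z.2
          ⟨by linarith [hy.1], hy.2⟩
      · rw [abs_le]; constructor <;> linarith [hy.1, hy.2]
  set D := ∫ t, w t ^ 2 with hD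
  have hDe : (brownianForm J).energy u u = 1 / 2 * D := by
    rw [hJ.energy_eq hF hF]; simp only [hD, sq]
  have hpt : ∀ y ∈ Icc p q, 1 ≤ 2 * F y ^ 2 + 2 * δ * D := by
    intro y hy
    have e1 := hF.sub_eq y z
    have e2 := sq_intervalIntegral_le hF.memLp (a := y) (b := z)
    rw [← e1] at e2
    have e3 : |(z : ℝ) - y| * D ≤ δ * D := by
      refine mul_le_mul_of_nonneg_right ?_ (integral_nonneg fun _ => sq_nonneg _)
      rw [abs_sub_comm]; exact hpz y hy
    nlinarith [sq_nonneg (F z - 2 * F y), sq_nonneg (F z + F y), sq_nonneg (F z - F y - F y)]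
  have hFm : MemLp (fun x : J => F x) 2 (lebesgueOn J) :=
    (Lp.memLp u).ae_eq (by filter_upwards [hF.ae_eq] with x hx using hx)
  have hnorm : ‖u‖ ^ 2 = ∫ x in J, F x ^ 2 := by
    rw [← real_inner_self_eq_norm_sq, L2.inner_def,
      ← hJ.measurePreserving_val.map_eq,
      (MeasurableEmbedding.subtype_coe hJ.measurableSet).integral_map]
    apply integral_congr_ae
    filter_upwards [hF.ae_eq] with x hx
    rw [hx, real_inner_self_eq_norm_sq, Real.norm_eq_abs, sq_abs]
  have hFi : IntegrableOn (fun x => F x ^ 2) J := by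
    rw [IntegrableOn, ← hJ.measurePreserving_val.integrable_comp_emb
      (MeasurableEmbedding.subtype_coe hJ.measurableSet)]
    exact hFm.integrable_sq
  have hint : δ ≤ 2 * ‖u‖ ^ 2 + 2 * δ ^ 2 * D := by
    have hc : Continuous fun y => 2 * F y ^ 2 + 2 * δ * D := by
      have := hF.continuous; fun_prop
    have e1 : ∫ _ in Icc p q, (1 : ℝ) ≤ ∫ y in Icc p q, (2 * F y ^ 2 + 2 * δ * D) :=
      setIntegral_mono_on (by simp) (hc.integrableOn_Icc) measurableSet_Icc hpt
    have hc2 : Continuous fun y => 2 * F y ^ 2 := by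
      have := hF.continuous; fun_prop
    rw [integral_add hc2.integrableOn_Icc (integrable_const _), integral_const_mul, setIntegral_const,
      setIntegral_const, measureReal_def, Real.volume_Icc, hpq, ENNReal.toReal_ofReal hδ0.le] at e1
    have e2 : ∫ y in Icc p q, F y ^ 2 ≤ ∫ y in J, F y ^ 2 :=
      setIntegral_mono_set hFi (ae_of_all _ fun _ => sq_nonneg _) hpJ.eventuallyLE
    rw [← hnorm] at e2
    simp only [smul_eq_mul, mul_one] at e1
    nlinarith
  have hD0 : 0 ≤ D := integral_nonneg fun _ => sq_nonneg _
  rw [L2Form.energyOne, hDe]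
  have : δ ^ 2 * D ≤ D := by
    have : δ ^ 2 ≤ 1 := pow_le_one₀ hδ0.le hδ1
    nlinarith
  linarith [sq_nonneg ‖u‖]

/-- This uniform bound turns the potential theory of the Brownian form into topology: a set whose
capacity is below `c` is empty, so every "up to small capacity" below becomes exact. -/
theorem exists_le_cap : ∃ c > (0 : ℝ≥0∞), ∀ A : Set J, A.Nonempty → c ≤ (brownianForm J).cap A := by
  obtain ⟨c, hc, h⟩ := hJ.exists_le_energyOne
  refine ⟨ENNReal.ofReal c, ENNReal.ofReal_pos.2 hc, fun A hA => ?_⟩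
  refine le_iInf₂ fun G hG => le_iInf fun hAG => le_iInf₂ fun u hu => le_iInf fun h1 => ?_
  exact ENNReal.ofReal_le_ofReal (h u hu G hG (hA.mono hAG) h1)

theorem cap_empty : (brownianForm J).cap ∅ = 0 := by
  refine le_antisymm ?_ bot_le
  refine (iInf₂_le ∅ isOpen_empty).trans ((iInf_le _ (empty_subset _)).trans ?_)
  refine (iInf₂_le 0 (hJ.mem_dom_iff.2 ⟨_, _, IsDirichletVersion.zero J⟩)).trans
    ((iInf_le _ (ae_of_all _ fun x hx => hx.elim)).trans ?_)
  rw [L2Form.energyOne, hJ.energy_eq (IsDirichletVersion.zero J) (IsDirichletVersion.zero J)]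
  simp

theorem cap_eq_zero_iff {A : Set J} : (brownianForm J).cap A = 0 ↔ A = ∅ := by
  constructor
  · intro h
    by_contra hne
    obtain ⟨c, hc, h'⟩ := hJ.exists_le_cap
    exact absurd (h' A (nonempty_iff_ne_empty.2 hne)) (by rw [h]; exact not_le.2 hc)
  · rintro rfl
    exact hJ.cap_empty

theorem quasiContinuous_iff {f : J → ℝ} : (brownianForm J).QuasiContinuous f ↔ Continuous f := by
  constructor
  · intro h
    obtain ⟨c, hc, h'⟩ := hJ.exists_le_cap
    obtain ⟨G, -, hG, hf⟩ := h c hc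
    have : G = ∅ := not_nonempty_iff_eq_empty.1 fun hne => absurd (h' G hne) (not_le.2 hG)
    rw [this, compl_empty] at hf
    exact continuousOn_univ.1 hf
  · exact fun h ε hε => ⟨∅, isOpen_empty, by rwa [hJ.cap_empty], h.continuousOn⟩

theorem quasiOpen_iff {A : Set J} : (brownianForm J).QuasiOpen A ↔ IsOpen A := by
  constructor
  · intro h
    obtain ⟨c, hc, h'⟩ := hJ.exists_le_cap
    obtain ⟨G, hG, hAG, hGA⟩ := h c hc
    have : G \ A = ∅ := not_nonempty_iff_eq_empty.1 fun hne => absurd (h' _ hne) (not_le.2 hGA)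
    rwa [hAG.antisymm (sdiff_eq_empty.1 this)]
  · exact fun h ε hε => ⟨A, h, Subset.rfl, by rwa [sdiff_self, hJ.cap_empty]⟩

theorem quasiClosed_iff {A : Set J} : (brownianForm J).QuasiClosed A ↔ IsClosed A := by
  rw [L2Form.QuasiClosed, hJ.quasiOpen_iff, isOpen_compl_iff]

end IsProperInterval

/-! ### One-sided limits of the scale. -/

noncomputable section

namespace ScaleTriple

variable (T : ScaleTriple)

theorem l_lt_r : T.l < T.r := T.l_neg.trans T.r_pos

theorem zero_mem : (0 : EReal) ∈ Ioo T.l T.r := ⟨T.l_neg, T.r_pos⟩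

variable {T}

theorem sExt_of_mem {x : EReal} (hx : x ∈ Ioo T.l T.r) : T.sExt x = T.s x.toReal := by
  rw [sExt, if_neg (not_le.2 hx.1), if_neg (not_le.2 hx.2)]

theorem sExt_of_le {x : EReal} (hx : x ≤ T.l) : T.sExt x = T.lhat := if_pos hx

theorem sExt_of_ge {x : EReal} (hx : T.r ≤ x) : T.sExt x = T.rhat := by
  rw [sExt, if_neg (not_le.2 (T.l_lt_r.trans_le hx)), if_pos hx]

theorem exists_sExt_lt {y : EReal} (hy : T.lhat < y) : ∃ x ∈ Ioo T.l T.r, T.sExt x < y := by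
  obtain ⟨x, hx⟩ := iInf_lt_iff.1 hy
  obtain ⟨hx', h⟩ := iInf_lt_iff.1 hx
  exact ⟨x, hx', by rwa [sExt_of_mem (T := T) (x := (x : EReal)) hx', EReal.toReal_coe]⟩

theorem exists_lt_sExt {y : EReal} (hy : y < T.rhat) : ∃ x ∈ Ioo T.l T.r, y < T.sExt x := by
  obtain ⟨x, hx⟩ := lt_iSup_iff.1 hy
  obtain ⟨hx', h⟩ := lt_iSup_iff.1 hx
  exact ⟨x, hx', by rwa [sExt_of_mem (T := T) (x := (x : EReal)) hx', EReal.toReal_coe]⟩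

variable (T) in
theorem sExt_zero : T.sExt 0 = 0 := by
  rw [sExt_of_mem T.zero_mem]; simp [T.s_zero]

variable (T) in
theorem lhat_le_zero : T.lhat ≤ 0 := by rw [← T.sExt_zero]; exact (T.sExt_mem 0).1

variable (T) in
theorem zero_le_rhat : 0 ≤ T.rhat := by rw [← T.sExt_zero]; exact (T.sExt_mem 0).2

variable (T) in
theorem lhat_lt_rhat : T.lhat < T.rhat := by
  refine lt_of_le_of_ne T.lhat_le_rhat fun h => ?_
  obtain ⟨x, y, hx, hy, hxy⟩ := T.s_nonconst
  have h1 := T.sExt_mem x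
  have h2 := T.sExt_mem y
  rw [← h, Icc_self, mem_singleton_iff, sExt_of_mem (T := T) (x := (x : EReal)) hx,
    EReal.toReal_coe] at h1
  rw [← h, Icc_self, mem_singleton_iff, sExt_of_mem (T := T) (x := (y : EReal)) hy,
    EReal.toReal_coe] at h2
  exact hxy (EReal.coe_injective (h1.trans h2.symm))

theorem nhdsLT_neBot {x : EReal} (hx : T.l < x) : (𝓝[<] x).NeBot :=
  nhdsLT_neBot_of_exists_lt ⟨_, hx⟩

theorem nhdsGT_neBot {x : EReal} (hx : x < T.r) : (𝓝[>] x).NeBot :=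
  nhdsGT_neBot_of_exists_gt ⟨_, hx⟩

theorem sLeft_le_sExt (x : EReal) : T.sLeft x ≤ T.sExt x := T.sExt_mono.leftLim_le le_rfl

theorem sExt_le_sRight (x : EReal) : T.sExt x ≤ T.sRight x := T.sExt_mono.le_rightLim le_rfl

theorem sExt_le_sLeft {x y : EReal} (h : x < y) : T.sExt x ≤ T.sLeft y := T.sExt_mono.le_leftLim h

theorem sRight_le_sExt {x y : EReal} (h : x < y) : T.sRight x ≤ T.sExt y :=
  T.sExt_mono.rightLim_le h

theorem sLeft_le_of_forall {x y : EReal} (hx : T.l < x) (h : ∀ z < x, T.sExt z ≤ y) :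
    T.sLeft x ≤ y := by
  have := nhdsLT_neBot hx
  exact le_of_tendsto (T.sExt_mono.tendsto_leftLim x) (eventually_mem_nhdsWithin.mono h)

theorem le_sRight_of_forall {x y : EReal} (hx : x < T.r) (h : ∀ z > x, y ≤ T.sExt z) :
    y ≤ T.sRight x := by
  have := nhdsGT_neBot hx
  exact ge_of_tendsto (T.sExt_mono.tendsto_rightLim x) (eventually_mem_nhdsWithin.mono h)

variable (T) in
theorem sLeft_l : T.sLeft T.l = T.lhat :=
  le_antisymm ((sLeft_le_sExt _).trans_eq (sExt_of_le le_rfl)) (T.sLeft_mem _).1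

variable (T) in
theorem sRight_r : T.sRight T.r = T.rhat :=
  le_antisymm (T.sRight_mem _).2 ((sExt_of_ge le_rfl).symm.trans_le (sExt_le_sRight _))

-- The value assigned at `l` is the infimum over `(l, r)`, hence also the limit from the right.
-- Together with its counterparts this excludes jumps at `l` and `r`, so `D⁺` and `D⁻` lie in the
-- open interval.
variable (T) in
theorem sRight_l : T.sRight T.l = T.lhat := by
  refine le_antisymm (le_of_forall_gt fun y hy => ?_) (T.sRight_mem _).1
  obtain ⟨x, hx, hxy⟩ := exists_sExt_lt hy
  exact (sRight_le_sExt hx.1).trans_lt hxy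

variable (T) in
theorem sLeft_r : T.sLeft T.r = T.rhat := by
  refine le_antisymm (T.sLeft_mem _).2 (le_of_forall_lt fun y hy => ?_)
  obtain ⟨x, hx, hxy⟩ := exists_lt_sExt hy
  exact hxy.trans_le (sExt_le_sLeft hx.2)

theorem mem_Ioo_of_mem_Dminus {x : EReal} (hx : x ∈ T.Dminus) : x ∈ Ioo T.l T.r := by
  obtain ⟨⟨h1, h2⟩, h3⟩ := hx
  refine ⟨h1.lt_of_ne ?_, h2.lt_of_ne ?_⟩
  · rintro rfl
    exact h3 (by rw [T.sLeft_l, sExt_of_le le_rfl])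
  · rintro rfl
    exact h3 (by rw [T.sLeft_r, sExt_of_ge le_rfl])

theorem mem_Ioo_of_mem_Dplus {x : EReal} (hx : x ∈ T.Dplus) : x ∈ Ioo T.l T.r := by
  obtain ⟨⟨h1, h2⟩, h3⟩ := hx
  refine ⟨h1.lt_of_ne ?_, h2.lt_of_ne ?_⟩
  · rintro rfl
    exact h3 (by rw [T.sRight_l, sExt_of_le le_rfl])
  · rintro rfl
    exact h3 (by rw [T.sRight_r, sExt_of_ge le_rfl])

theorem coe_sExt {x : EReal} (hx : x ∈ Ioo T.l T.r) : ((T.sExt x).toReal : EReal) = T.sExt x := by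
  rw [sExt_of_mem hx, EReal.toReal_coe]

theorem coe_sLeft {x : EReal} (hx : x ∈ Ioo T.l T.r) : ((T.sLeft x).toReal : EReal) = T.sLeft x := by
  obtain ⟨z, hz1, hz2⟩ := exists_between hx.1
  refine EReal.coe_toReal (ne_top_of_le_ne_top ?_ (sLeft_le_sExt x))
    (ne_bot_of_le_ne_bot ?_ (sExt_le_sLeft hz2))
  · rw [← coe_sExt hx]; exact EReal.coe_ne_top _
  · rw [← coe_sExt (T := T) (x := z) ⟨hz1, hz2.trans hx.2⟩]; exact EReal.coe_ne_bot _

theorem coe_sRight {x : EReal} (hx : x ∈ Ioo T.l T.r) :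
    ((T.sRight x).toReal : EReal) = T.sRight x := by
  obtain ⟨z, hz1, hz2⟩ := exists_between hx.2
  refine EReal.coe_toReal (ne_top_of_le_ne_top ?_ (sRight_le_sExt hz1))
    (ne_bot_of_le_ne_bot ?_ (sExt_le_sRight x))
  · rw [← coe_sExt (T := T) (x := z) ⟨hx.1.trans hz1, hz2⟩]; exact EReal.coe_ne_top _
  · rw [← coe_sExt hx]; exact EReal.coe_ne_bot _

variable (T) in
theorem continuousAt_sExt_zero : ContinuousAt T.sExt 0 := by
  have h1 : T.sExt =ᶠ[𝓝 0] fun x => (T.s x.toReal : EReal) := by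
    filter_upwards [Ioo_mem_nhds T.l_neg T.r_pos] with x hx using sExt_of_mem hx
  refine ContinuousAt.congr ?_ h1.symm
  have h2 : ContinuousAt (fun x : EReal => T.s x.toReal) 0 :=
    ContinuousAt.comp (g := T.s) (by simpa using T.s_cont_zero)
      (EReal.tendsto_toReal (by simp) (by simp))
  exact continuous_coe_real_ereal.continuousAt.comp h2

variable (T) in
theorem sLeft_zero : T.sLeft 0 = 0 := by
  rw [sLeft, T.continuousAt_sExt_zero.continuousWithinAt.leftLim_eq, T.sExt_zero]

variable (T) in
theorem sRight_zero : T.sRight 0 = 0 := by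
  rw [sRight, T.continuousAt_sExt_zero.continuousWithinAt.rightLim_eq, T.sExt_zero]

/-! ### The generalized inverse of the scale -/

variable (T)

/-- The left-continuous generalized inverse of the scale. -/
def quantile (y : ℝ) : EReal := sInf {x | (y : EReal) ≤ T.sExt x}

/-- The open interval `(l̂, r̂)`. -/
def core : Set ℝ := {y | T.lhat < y ∧ (y : EReal) < T.rhat}

/-- The points of the image of the scale at which it is increasing continuously. -/
def contPart : Set ℝ := {y | (y : EReal) = T.sLeft (T.quantile y)}

/-- The gaps between `𝐬(x)` and `𝐬(x+)`. -/
def plusGap : Set ℝ := {y | T.sExt (T.quantile y) < y}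

/-- The gaps between `𝐬(x-)` and `𝐬(x)`. -/
def minusGap : Set ℝ := {y | T.sLeft (T.quantile y) < y ∧ (y : EReal) ≤ T.sExt (T.quantile y)}

theorem quantile_mono : Monotone T.quantile := fun _ _ h =>
  sInf_le_sInf fun _ hx => (EReal.coe_le_coe_iff.2 h).trans hx

theorem isOpen_core : IsOpen T.core :=
  (isOpen_Ioo (a := T.lhat) (b := T.rhat)).preimage continuous_coe_real_ereal

theorem measurableSet_contPart : MeasurableSet T.contPart :=
  measurableSet_eq_fun measurable_coe_real_ereal
    (T.sExt_mono.leftLim.measurable.comp T.quantile_mono.measurable)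

theorem measurableSet_plusGap : MeasurableSet T.plusGap :=
  measurableSet_lt (T.sExt_mono.measurable.comp T.quantile_mono.measurable)
    measurable_coe_real_ereal

theorem measurableSet_minusGap : MeasurableSet T.minusGap :=
  (measurableSet_lt (T.sExt_mono.leftLim.measurable.comp T.quantile_mono.measurable)
    measurable_coe_real_ereal).inter
  (measurableSet_le measurable_coe_real_ereal
    (T.sExt_mono.measurable.comp T.quantile_mono.measurable))

variable {T}

theorem sExt_lt_of_lt_quantile {x : EReal} {y : ℝ} (h : x < T.quantile y) : T.sExt x < y := by
  by_contra hc
  exact (sInf_le (not_lt.1 hc) : T.quantile y ≤ x).not_gt h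

theorem le_sExt_of_quantile_lt {x : EReal} {y : ℝ} (h : T.quantile y < x) : y ≤ T.sExt x := by
  obtain ⟨z, hz, hzx⟩ := sInf_lt_iff.1 h
  exact le_trans hz (T.sExt_mono hzx.le)

theorem quantile_le {x : EReal} {y : ℝ} (h : y ≤ T.sExt x) : T.quantile y ≤ x := sInf_le h

theorem le_quantile {x : EReal} {y : ℝ} (h : ∀ z < x, T.sExt z < y) : x ≤ T.quantile y :=
  le_sInf fun z hz => by
    by_contra hc
    exact absurd hz (not_le.2 (h z (not_le.1 hc)))

theorem quantile_mem {y : ℝ} (hy : y ∈ T.core) : T.quantile y ∈ Ioo T.l T.r := by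
  obtain ⟨a, ha, hay⟩ := exists_sExt_lt hy.1
  obtain ⟨b, hb, hyb⟩ := exists_lt_sExt hy.2
  refine ⟨ha.1.trans_le (le_quantile fun z hz => (T.sExt_mono hz.le).trans_lt hay),
    (quantile_le hyb.le).trans_lt hb.2⟩

/-- Left of `quantile y` the scale stays below `y`, and right of it the scale is at least `y`. So
`y` lies between the one-sided limits of the scale at `quantile y`. -/
theorem sLeft_quantile_le {y : ℝ} (hy : y ∈ T.core) : T.sLeft (T.quantile y) ≤ y :=
  sLeft_le_of_forall (quantile_mem hy).1 fun _ hz => (sExt_lt_of_lt_quantile hz).le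

theorem le_sRight_quantile {y : ℝ} (hy : y ∈ T.core) : y ≤ T.sRight (T.quantile y) :=
  le_sRight_of_forall (quantile_mem hy).2 fun _ hz => le_sExt_of_quantile_lt hz

theorem quantile_eq_of_minus {x : EReal} {y : ℝ} (h1 : T.sLeft x < y) (h2 : y ≤ T.sExt x) :
    T.quantile y = x :=
  le_antisymm (quantile_le h2) (le_quantile fun _ hz => (sExt_le_sLeft hz).trans_lt h1)

theorem quantile_eq_of_plus {x : EReal} {y : ℝ} (h1 : T.sExt x < y) (h2 : y < T.sRight x) :
    T.quantile y = x := by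
  refine le_antisymm (le_of_forall_gt fun z hz => ?_)
    (le_quantile fun z hz => (T.sExt_mono hz.le).trans_lt h1)
  obtain ⟨t, ht1, ht2⟩ := exists_between hz
  exact (quantile_le (h2.le.trans (sRight_le_sExt ht1))).trans_lt ht2

/-- With `q = quantile y`, the number `y` either equals `𝐬(q-)`, or lies in `(𝐬(q-), 𝐬(q)]`, or
exceeds `𝐬(q)`. The three sets thus partition the core, which lets integrals over it be treated part
by part. -/
theorem mem_cases {y : ℝ} (hy : y ∈ T.core) :
    (y ∈ T.contPart ∧ y ∉ T.plusGap ∧ y ∉ T.minusGap) ∨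
    (y ∉ T.contPart ∧ y ∈ T.plusGap ∧ y ∉ T.minusGap) ∨
    (y ∉ T.contPart ∧ y ∉ T.plusGap ∧ y ∈ T.minusGap) := by
  have h1 := sLeft_quantile_le hy
  have h2 := sLeft_le_sExt (T := T) (T.quantile y)
  simp only [contPart, plusGap, minusGap, mem_ofPred_eq, not_lt, not_and, not_le]
  rcases lt_or_ge (T.sExt (T.quantile y)) y with h | h
  · exact Or.inr (Or.inl ⟨(h2.trans_lt h).ne', h, fun _ => h⟩)
  · rcases h1.eq_or_lt with h3 | h3
    · exact Or.inl ⟨h3.symm, h, fun h4 => absurd h3 h4.ne⟩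
    · exact Or.inr (Or.inr ⟨h3.ne', h, h3, h⟩)

variable (T)

/-- Lebesgue measure on `(l̂, r̂)`. -/
def coreVol : Measure ℝ := volume.restrict T.core

theorem coreVol_eq : T.coreVol = T.coreVol.restrict T.contPart + T.coreVol.restrict T.plusGap +
    T.coreVol.restrict T.minusGap := by
  have h1 : ∀ᵐ y ∂T.coreVol, y ∈ T.core := ae_restrict_mem T.isOpen_core.measurableSet
  ext A hA
  rw [Measure.add_apply, Measure.add_apply, Measure.restrict_apply hA, Measure.restrict_apply hA,
    Measure.restrict_apply hA, ← measure_union₀ (hA.inter T.measurableSet_plusGap).nullMeasurableSet,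
    ← measure_union₀ (hA.inter T.measurableSet_minusGap).nullMeasurableSet]
  · refine measure_congr ?_
    filter_upwards [h1] with y hy
    refine propext ?_
    change y ∈ A ↔ y ∈ A ∩ T.contPart ∪ A ∩ T.plusGap ∪ A ∩ T.minusGap
    simp only [mem_union, mem_inter_iff]
    have := mem_cases hy
    tauto
  · refine measure_mono_null (t := T.coreᶜ) (fun y hy => fun hc => ?_) h1
    have := mem_cases hc
    obtain ⟨(⟨-, h⟩ | ⟨-, h⟩), -, h'⟩ := hy <;> tauto
  · refine measure_mono_null (t := T.coreᶜ) (fun y hy => fun hc => ?_) h1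
    have := mem_cases hc
    obtain ⟨⟨-, h⟩, -, h'⟩ := hy
    tauto

theorem countable_Dminus : T.Dminus.Countable := by
  refine Countable.mono (fun x hx => ?_) T.sExt_mono.countable_not_continuousAt
  refine fun hc : ContinuousAt T.sExt x => hx.2 ?_
  exact hc.continuousWithinAt.leftLim_eq.symm

theorem countable_Dplus : T.Dplus.Countable := by
  refine Countable.mono (fun x hx => ?_) T.sExt_mono.countable_not_continuousAt
  refine fun hc : ContinuousAt T.sExt x => hx.2 ?_
  exact hc.continuousWithinAt.rightLim_eq.symm

end ScaleTriple

/-! ### The images under `quantile` of Lebesgue measure on the gaps. -/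

/-- Measures carried by a countable set are determined by the masses of points. -/
theorem MeasureTheory.Measure.ext_of_countable {α : Type*} [MeasurableSpace α]
    [MeasurableSingletonClass α] {μ ν : Measure α} {D : Set α} (hD : D.Countable)
    (hμ : μ Dᶜ = 0) (hν : ν Dᶜ = 0) (h : ∀ x ∈ D, μ {x} = ν {x}) : μ = ν := by
  ext A hA
  have key : ∀ ρ : Measure α, ρ Dᶜ = 0 → ρ A = ∑' x : ↥(A ∩ D), ρ {(x : α)} := fun ρ hρ => by
    rw [← measure_inter_add_sdiff A hD.measurableSet,
      measure_mono_null (s := A \ D) (fun x hx => hx.2) hρ, add_zero]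
    conv_lhs => rw [← biUnion_of_singleton (A ∩ D)]
    rw [measure_biUnion (hD.mono inter_subset_right)]
    · exact fun x _ y _ hxy => disjoint_singleton.2 hxy
    · exact fun x _ => measurableSet_singleton x
  rw [key μ hμ, key ν hν]
  exact tsum_congr fun x => h x x.2.2

theorem MeasureTheory.Measure.sum_smul_dirac_subtype_apply {α : Type*} [MeasurableSpace α]
    {S : Set α} (c : S → ℝ≥0∞) {A : Set α} (hA : MeasurableSet A) :
    Measure.sum (fun x : S => c x • Measure.dirac (x : α)) A =
      ∑' x : S, A.indicator 1 (x : α) * c x := by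
  rw [Measure.sum_apply _ hA]
  refine tsum_congr fun x => ?_
  rw [Measure.smul_apply, Measure.dirac_apply' _ hA, smul_eq_mul, mul_comm]

theorem MeasureTheory.Measure.sum_smul_dirac_subtype_singleton {α : Type*} [MeasurableSpace α]
    [MeasurableSingletonClass α] {S : Set α} (c : S → ℝ≥0∞) {x : α} (hx : x ∈ S) :
    Measure.sum (fun x : S => c x • Measure.dirac (x : α)) {x} = c ⟨x, hx⟩ := by
  rw [Measure.sum_smul_dirac_subtype_apply _ (measurableSet_singleton x), tsum_eq_single ⟨x, hx⟩]
  · simp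
  · intro y hy
    have : (y : α) ≠ x := fun h => hy (Subtype.ext h)
    simp [this]

namespace ScaleTriple

variable (T : ScaleTriple)

theorem muMinus_singleton {x : EReal} (hx : x ∈ Ioo T.l T.r) :
    T.muMinus {x} = ENNReal.ofReal ((T.sExt x).toReal - (T.sLeft x).toReal) := by
  rw [muMinus, Measure.sum_smul_dirac_subtype_singleton
    (fun x : Ioo T.l T.r => (T.sExt x - T.sLeft x).toENNReal) hx]
  rw [← coe_sExt hx, ← coe_sLeft hx, ← EReal.coe_sub, EReal.toENNReal_of_ne_top (EReal.coe_ne_top _)]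
  simp only [EReal.toReal_coe]

theorem muPlus_singleton {x : EReal} (hx : x ∈ Ioo T.l T.r) :
    T.muPlus {x} = ENNReal.ofReal ((T.sRight x).toReal - (T.sExt x).toReal) := by
  rw [muPlus, Measure.sum_smul_dirac_subtype_singleton
    (fun x : Ioo T.l T.r => (T.sRight x - T.sExt x).toENNReal) hx]
  rw [← coe_sExt hx, ← coe_sRight hx, ← EReal.coe_sub, EReal.toENNReal_of_ne_top (EReal.coe_ne_top _)]
  simp only [EReal.toReal_coe]

theorem muMinus_compl : T.muMinus T.Dminusᶜ = 0 := by
  rw [muMinus, Measure.sum_smul_dirac_subtype_apply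
    (fun x : Ioo T.l T.r => (T.sExt x - T.sLeft x).toENNReal)
    T.countable_Dminus.measurableSet.compl, ENNReal.tsum_eq_zero]
  intro x
  by_cases hx : (x : EReal) ∈ T.Dminus
  · simp [hx]
  · have : T.sExt x = T.sLeft x := by
      by_contra h
      exact hx ⟨Ioo_subset_Icc_self x.2, h⟩
    rw [this, ← coe_sLeft x.2, ← EReal.coe_sub]
    simp

theorem muPlus_compl : T.muPlus T.Dplusᶜ = 0 := by
  rw [muPlus, Measure.sum_smul_dirac_subtype_apply
    (fun x : Ioo T.l T.r => (T.sRight x - T.sExt x).toENNReal)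
    T.countable_Dplus.measurableSet.compl, ENNReal.tsum_eq_zero]
  intro x
  by_cases hx : (x : EReal) ∈ T.Dplus
  · simp [hx]
  · have : T.sExt x = T.sRight x := by
      by_contra h
      exact hx ⟨Ioo_subset_Icc_self x.2, h⟩
    rw [this, ← coe_sRight x.2, ← EReal.coe_sub]
    simp

theorem coreVol_le : T.coreVol ≤ volume := Measure.restrict_le_self

theorem ae_mem_core : ∀ᵐ y ∂T.coreVol, y ∈ T.core := ae_restrict_mem T.isOpen_core.measurableSet

/-- Endpoints are negligible, so the fibre of `quantile` over a jump needs to be located only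
between an open and a closed interval. -/
theorem coreVol_eq_of_sandwich {S : Set ℝ} {a b : ℝ} (h1 : Ioo a b ⊆ T.core)
    (h2 : Ioo a b ⊆ S) (h3 : S ∩ T.core ⊆ Icc a b) (hS : MeasurableSet S) :
    T.coreVol S = ENNReal.ofReal (b - a) := by
  rw [coreVol, Measure.restrict_apply hS]
  refine le_antisymm ?_ ?_
  · rw [← Real.volume_Icc]; exact measure_mono h3
  · rw [← Real.volume_Ioo]; exact measure_mono (subset_inter h2 h1)

/-- On this set, `quantile` collapses the gap between `𝐬(x-)` and `𝐬(x)` to the point `x`, which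
thereby receives the length of the gap. Both measures are carried by the countable set `D⁻`, so
comparing atoms is enough. -/
theorem measurePreserving_minus :
    MeasurePreserving T.quantile (T.coreVol.restrict T.minusGap) T.muMinus := by
  refine ⟨T.quantile_mono.measurable, ?_⟩
  refine Measure.ext_of_countable T.countable_Dminus ?_ T.muMinus_compl fun x hx => ?_
  · rw [Measure.map_apply T.quantile_mono.measurable T.countable_Dminus.measurableSet.compl,
      Measure.restrict_apply (T.quantile_mono.measurable T.countable_Dminus.measurableSet.compl)]
    refine measure_mono_null (t := T.coreᶜ) (fun y hy hc => hy.1 ?_) T.ae_mem_core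
    exact ⟨Ioo_subset_Icc_self (quantile_mem hc), (hy.2.1.trans_le hy.2.2).ne'⟩
  · have hxI := mem_Ioo_of_mem_Dminus hx
    have hm := T.quantile_mono.measurable (measurableSet_singleton x)
    rw [Measure.map_apply T.quantile_mono.measurable (measurableSet_singleton x),
      Measure.restrict_apply hm, T.muMinus_singleton hxI]
    refine T.coreVol_eq_of_sandwich (fun y hy => ?_) (fun y hy => ?_) (fun y hy => ?_)
      (hm.inter T.measurableSet_minusGap)
    · have h1 := EReal.coe_lt_coe_iff.2 hy.1
      have h2 := EReal.coe_lt_coe_iff.2 hy.2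
      rw [coe_sLeft hxI] at h1
      rw [coe_sExt hxI] at h2
      exact ⟨(T.sLeft_mem x).1.trans_lt h1, h2.trans_le (T.sExt_mem x).2⟩
    · have h1 := EReal.coe_lt_coe_iff.2 hy.1
      have h2 := EReal.coe_lt_coe_iff.2 hy.2
      rw [coe_sLeft hxI] at h1
      rw [coe_sExt hxI] at h2
      have h3 := quantile_eq_of_minus h1 h2.le
      exact ⟨h3, by rw [minusGap, mem_ofPred_eq, h3]; exact ⟨h1, h2.le⟩⟩
    · obtain ⟨⟨h0 : T.quantile y = x, h1, h2⟩, -⟩ := hy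
      rw [h0, ← coe_sLeft hxI] at h1
      rw [h0, ← coe_sExt hxI] at h2
      exact ⟨(EReal.coe_lt_coe_iff.1 h1).le, EReal.coe_le_coe_iff.1 h2⟩

theorem measurePreserving_plus :
    MeasurePreserving T.quantile (T.coreVol.restrict T.plusGap) T.muPlus := by
  refine ⟨T.quantile_mono.measurable, ?_⟩
  refine Measure.ext_of_countable T.countable_Dplus ?_ T.muPlus_compl fun x hx => ?_
  · rw [Measure.map_apply T.quantile_mono.measurable T.countable_Dplus.measurableSet.compl,
      Measure.restrict_apply (T.quantile_mono.measurable T.countable_Dplus.measurableSet.compl)]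
    refine measure_mono_null (t := T.coreᶜ) (fun y hy hc => hy.1 ?_) T.ae_mem_core
    exact ⟨Ioo_subset_Icc_self (quantile_mem hc),
      (lt_of_lt_of_le (show T.sExt _ < _ from hy.2) (le_sRight_quantile hc)).ne⟩
  · have hxI := mem_Ioo_of_mem_Dplus hx
    have hm := T.quantile_mono.measurable (measurableSet_singleton x)
    rw [Measure.map_apply T.quantile_mono.measurable (measurableSet_singleton x),
      Measure.restrict_apply hm, T.muPlus_singleton hxI]
    refine T.coreVol_eq_of_sandwich (fun y hy => ?_) (fun y hy => ?_) (fun y hy => ?_)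
      (hm.inter T.measurableSet_plusGap)
    · have h1 := EReal.coe_lt_coe_iff.2 hy.1
      have h2 := EReal.coe_lt_coe_iff.2 hy.2
      rw [coe_sExt hxI] at h1
      rw [coe_sRight hxI] at h2
      exact ⟨(T.sExt_mem x).1.trans_lt h1, h2.trans_le (T.sRight_mem x).2⟩
    · have h1 := EReal.coe_lt_coe_iff.2 hy.1
      have h2 := EReal.coe_lt_coe_iff.2 hy.2
      rw [coe_sExt hxI] at h1
      rw [coe_sRight hxI] at h2
      have h3 := quantile_eq_of_plus h1 h2
      exact ⟨h3, by rw [plusGap, mem_ofPred_eq, h3]; exact h1⟩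
    · obtain ⟨⟨h0 : T.quantile y = x, h1 : T.sExt _ < _⟩, h4⟩ := hy
      have h2 := le_sRight_quantile h4
      rw [h0, ← coe_sExt hxI] at h1
      rw [h0, ← coe_sRight hxI] at h2
      exact ⟨(EReal.coe_lt_coe_iff.1 h1).le, EReal.coe_le_coe_iff.1 h2⟩

end ScaleTriple
end

/-! ### Integrals from `0` as integrals against kernels, compared across the scale. -/

noncomputable section

open Classical in
/-- The kernel of `openIntegral`. -/
def openKernel (x z : EReal) : ℝ :=
  if 0 ≤ x then (Ioo 0 x).indicator 1 z else -(Ico x 0).indicator 1 z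

open Classical in
/-- The kernel of `halfOpenIntegral`. -/
def halfOpenKernel (x z : EReal) : ℝ :=
  if 0 ≤ x then (Ioc 0 x).indicator 1 z else -(Ioo x 0).indicator 1 z

open Classical in
/-- The kernel of the interval integral from `0`. -/
def intervalKernel (x z : ℝ) : ℝ :=
  if 0 ≤ x then (Ioc 0 x).indicator 1 z else -(Ioc x 0).indicator 1 z

theorem integral_indicator_one_mul {α : Type*} [MeasurableSpace α] {μ : Measure α} {s : Set α}
    (hs : MeasurableSet s) (g : α → ℝ) :
    ∫ y, s.indicator 1 y * g y ∂μ = ∫ y in s, g y ∂μ := by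
  rw [← integral_indicator hs]
  congr 1
  ext y
  by_cases hy : y ∈ s <;> simp [hy]

theorem indicator_one_congr {α β : Type*} {s : Set α} {t : Set β} {a : α} {b : β}
    (h : a ∈ s ↔ b ∈ t) : s.indicator (1 : α → ℝ) a = t.indicator (1 : β → ℝ) b := by
  by_cases ha : a ∈ s
  · rw [indicator_of_mem ha, indicator_of_mem (h.1 ha)]; rfl
  · rw [indicator_of_notMem ha, indicator_of_notMem (mt h.2 ha)]

theorem openIntegral_eq (μ : Measure EReal) (g : EReal → ℝ) (x : EReal) :
    openIntegral μ g x = ∫ y, openKernel x y * g y ∂μ := by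
  unfold openIntegral openKernel
  split_ifs with h
  · rw [integral_indicator_one_mul measurableSet_Ioo]
  · simp_rw [neg_mul]
    rw [integral_neg, integral_indicator_one_mul measurableSet_Ico]

theorem halfOpenIntegral_eq (μ : Measure EReal) (g : EReal → ℝ) (x : EReal) :
    halfOpenIntegral μ g x = ∫ y, halfOpenKernel x y * g y ∂μ := by
  unfold halfOpenIntegral halfOpenKernel
  split_ifs with h
  · rw [integral_indicator_one_mul measurableSet_Ioc]
  · simp_rw [neg_mul]
    rw [integral_neg, integral_indicator_one_mul measurableSet_Ioo]

theorem intervalIntegral_eq_kernel (g : ℝ → ℝ) (x : ℝ) :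
    ∫ t in (0 : ℝ)..x, g t = ∫ y, intervalKernel x y * g y := by
  unfold intervalKernel
  split_ifs with h
  · rw [integral_indicator_one_mul measurableSet_Ioc, intervalIntegral.integral_of_le h]
  · simp_rw [neg_mul]
    rw [integral_neg, integral_indicator_one_mul measurableSet_Ioc,
      intervalIntegral.integral_of_ge (not_le.1 h).le]

theorem measurable_openKernel (x : EReal) : Measurable (openKernel x) := by
  unfold openKernel
  split_ifs
  · exact measurable_one.indicator measurableSet_Ioo
  · exact (measurable_one.indicator measurableSet_Ico).neg

theorem measurable_halfOpenKernel (x : EReal) : Measurable (halfOpenKernel x) := by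
  unfold halfOpenKernel
  split_ifs
  · exact measurable_one.indicator measurableSet_Ioc
  · exact (measurable_one.indicator measurableSet_Ioo).neg

theorem memLp_intervalKernel (x : ℝ) : MemLp (intervalKernel x) 2 volume := by
  unfold intervalKernel
  split_ifs
  · exact memLp_indicator_const 2 measurableSet_Ioc 1 (Or.inr (by simp))
  · exact (memLp_indicator_const 2 measurableSet_Ioc (1 : ℝ) (Or.inr (by simp))).neg

theorem integrable_intervalKernel (x : ℝ) : Integrable (intervalKernel x) volume := by
  unfold intervalKernel
  split_ifs
  · exact (integrable_indicator_iff measurableSet_Ioc).2 (integrableOn_const (by simp))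
  · exact ((integrable_indicator_iff measurableSet_Ioc).2
      (integrableOn_const (C := (1 : ℝ)) (by simp))).neg

namespace ScaleTriple

variable {T : ScaleTriple}

/-- Continuity of the scale at `0` enters here: without a jump at `0`, no positive `y` is sent to
`0`, so splitting at the origin means the same on both sides. -/
theorem quantile_pos {y : ℝ} (hy : y ∈ T.core) (h : 0 < y) : 0 < T.quantile y := by
  have h0 : (0 : EReal) < y := by exact_mod_cast h
  by_contra hc
  have h1 := le_sRight_quantile hy
  have h2 := h1.trans (T.sExt_mono.rightLim (not_lt.1 hc))
  exact absurd (h2.trans_eq T.sRight_zero) (not_le.2 h0)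

theorem quantile_neg {y : ℝ} (hy : y ∈ T.core) (h : y < 0) : T.quantile y < 0 := by
  have h0 : (y : EReal) < 0 := by exact_mod_cast h
  by_contra hc
  have h2 := (T.sExt_mono.leftLim (not_lt.1 hc)).trans (sLeft_quantile_le hy)
  exact absurd (T.sLeft_zero.symm.trans_le h2) (not_le.2 h0)

theorem pos_of_quantile_pos {y : ℝ} (h : 0 < T.quantile y) : 0 < y := by
  have := sExt_lt_of_lt_quantile h
  rw [T.sExt_zero] at this
  exact_mod_cast this

theorem nonpos_of_quantile_neg {y : ℝ} (h : T.quantile y < 0) : y ≤ 0 := by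
  have := le_sExt_of_quantile_lt h
  rw [T.sExt_zero] at this
  exact_mod_cast this

theorem coe_lt_sExt_iff {x : EReal} (hx : x ∈ Ioo T.l T.r) {y : ℝ} :
    (y : EReal) < T.sExt x ↔ y < (T.sExt x).toReal := by
  rw [← coe_sExt hx, EReal.coe_lt_coe_iff, EReal.toReal_coe]

theorem sExt_lt_coe_iff {x : EReal} (hx : x ∈ Ioo T.l T.r) {y : ℝ} :
    T.sExt x < (y : EReal) ↔ (T.sExt x).toReal < y := by
  rw [← coe_sExt hx, EReal.coe_lt_coe_iff, EReal.toReal_coe]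

theorem toReal_sExt_nonneg {x : EReal} (hx : 0 ≤ x) : 0 ≤ (T.sExt x).toReal :=
  EReal.toReal_nonneg (T.sExt_zero.symm.trans_le (T.sExt_mono hx))

theorem toReal_sExt_nonpos {x : EReal} (hx : x ≤ 0) : (T.sExt x).toReal ≤ 0 :=
  EReal.toReal_nonpos ((T.sExt_mono hx).trans_eq T.sExt_zero)

/-- A point `x < 0` may have `𝐬(x) = 0`, where the definition takes its other branch; the kernel
vanishes either way. -/
theorem intervalKernel_of_nonpos {x y : ℝ} (hx : x ≤ 0) :
    intervalKernel x y = -(Ioc x 0).indicator 1 y := by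
  unfold intervalKernel
  split_ifs with h
  · simp [le_antisymm hx h]
  · rfl

-- The endpoint conventions of the three integrals are exactly right. For `x ≥ 0`, the interval `(0,
-- 𝐬(x)]` contains the gap below `𝐬(x)` at `x` but not the gap above it, so `μ_d⁻` must count `x`
-- and `μ_d⁺` must not; for `x < 0`, the interval `(𝐬(x), 0]` contains the gap above and misses the
-- one below, and the roles are exchanged. The excluded values of `y` are finitely many, hence null.
open Classical in
theorem intervalKernel_eq {x : EReal} (hx : x ∈ Ioo T.l T.r) {y : ℝ} (hy : y ∈ T.core)
    (h0 : y ≠ 0) (h1 : y ≠ (T.sExt x).toReal) (h2 : y ≠ (T.sLeft x).toReal) :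
    intervalKernel (T.sExt x).toReal y =
      if y ∈ T.minusGap then halfOpenKernel x (T.quantile y) else openKernel x (T.quantile y) := by
  have h2' : (y : EReal) ≠ T.sLeft x := fun h => h2 (by rw [← h, EReal.toReal_coe])
  have h1' : (y : EReal) ≠ T.sExt x := fun h => h1 (by rw [← h, EReal.toReal_coe])
  have hcases := mem_cases hy
  rcases le_or_gt 0 x with hx0 | hx0
  · rw [intervalKernel, if_pos (toReal_sExt_nonneg hx0)]
    unfold halfOpenKernel openKernel
    rw [if_pos hx0, if_pos hx0]
    have e1 : y ∈ Ioc 0 (T.sExt x).toReal ↔ 0 < y ∧ (y : EReal) < T.sExt x := by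
      rw [coe_lt_sExt_iff hx]
      exact ⟨fun h => ⟨h.1, h.2.lt_of_ne h1⟩, fun h => ⟨h.1, h.2.le⟩⟩
    have e2 : 0 < y ↔ 0 < T.quantile y := ⟨quantile_pos hy, pos_of_quantile_pos⟩
    have e3 : (y : EReal) < T.sExt x ↔ T.quantile y < x ∨ (T.quantile y = x ∧ y ∈ T.minusGap) := by
      constructor
      · intro h
        rcases (quantile_le h.le).lt_or_eq with h' | h'
        · exact Or.inl h'
        · refine Or.inr ⟨h', ?_⟩
          rcases hcases with hc | hc | hc
          · exact absurd (show (y : EReal) = T.sLeft _ from hc.1) (by rw [h']; exact h2')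
          · exact absurd (show T.sExt _ < (y : EReal) from hc.2.1) (by rw [h']; exact h.not_gt)
          · exact hc.2.2
      · rintro (h | ⟨h, h'⟩)
        · exact (le_sExt_of_quantile_lt h).lt_of_ne h1'
        · have := h'.2
          rw [h] at this
          exact this.lt_of_ne h1'
    split_ifs with hM
    · have : y ∈ Ioc 0 (T.sExt x).toReal ↔ T.quantile y ∈ Ioc 0 x := by
        rw [e1, e2, e3, mem_Ioc, le_iff_lt_or_eq]
        simp only [hM, and_true]
      rw [indicator_one_congr this]
    · have : y ∈ Ioc 0 (T.sExt x).toReal ↔ T.quantile y ∈ Ioo 0 x := by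
        rw [e1, e2, e3, mem_Ioo]
        simp only [hM, and_false, or_false]
      rw [indicator_one_congr this]
  · rw [intervalKernel_of_nonpos (toReal_sExt_nonpos hx0.le)]
    unfold halfOpenKernel openKernel
    rw [if_neg (not_le.2 hx0), if_neg (not_le.2 hx0)]
    have e1 : y ∈ Ioc (T.sExt x).toReal 0 ↔ T.sExt x < (y : EReal) ∧ y < 0 := by
      rw [sExt_lt_coe_iff hx]
      exact ⟨fun h => ⟨h.1, h.2.lt_of_ne h0⟩, fun h => ⟨h.1, h.2.le⟩⟩
    have e2 : y < 0 ↔ T.quantile y < 0 :=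
      ⟨quantile_neg hy, fun h => (nonpos_of_quantile_neg h).lt_of_ne h0⟩
    have e3 : T.sExt x < (y : EReal) ↔ x < T.quantile y ∨ (x = T.quantile y ∧ y ∉ T.minusGap) := by
      constructor
      · intro h
        rcases (le_quantile fun z hz => (T.sExt_mono hz.le).trans_lt h).lt_or_eq with h' | h'
        · exact Or.inl h'
        · refine Or.inr ⟨h', fun hc => ?_⟩
          have := hc.2
          rw [← h'] at this
          exact absurd h (not_lt.2 this)
      · rintro (h | ⟨h, h'⟩)
        · exact sExt_lt_of_lt_quantile h
        · rcases hcases with hc | hc | hc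
          · exact absurd (show (y : EReal) = T.sLeft _ from hc.1) (by rw [← h]; exact h2')
          · rw [h]; exact hc.2.1
          · exact absurd hc.2.2 h'
    split_ifs with hM
    · have : y ∈ Ioc (T.sExt x).toReal 0 ↔ T.quantile y ∈ Ioo x 0 := by
        rw [e1, e2, e3, mem_Ioo]
        simp only [hM, and_false, or_false, not_true_eq_false]
      rw [indicator_one_congr this]
    · have : y ∈ Ioc (T.sExt x).toReal 0 ↔ T.quantile y ∈ Ico x 0 := by
        rw [e1, e2, e3, mem_Ico, le_iff_lt_or_eq]
        simp only [hM, and_true, not_false_eq_true]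
      rw [indicator_one_congr this]

theorem intervalKernel_eq_zero {x : EReal} (hx : x ∈ Ioo T.l T.r) {y : ℝ} (hy : y ∉ T.core)
    (h0 : y ≠ 0) (h1 : y ≠ (T.sExt x).toReal) : intervalKernel (T.sExt x).toReal y = 0 := by
  have hm := T.sExt_mem x
  rw [← coe_sExt hx] at hm
  unfold intervalKernel
  split_ifs with h
  · have : y ∉ Ioc 0 (T.sExt x).toReal := fun hc => hy
      ⟨T.lhat_le_zero.trans_lt (by exact_mod_cast hc.1),
        lt_of_lt_of_le (EReal.coe_lt_coe_iff.2 (hc.2.lt_of_ne h1)) hm.2⟩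
    simp [this]
  · have : y ∉ Ioc (T.sExt x).toReal 0 := fun hc => hy
      ⟨hm.1.trans_lt (EReal.coe_lt_coe_iff.2 hc.1),
        lt_of_lt_of_le (by exact_mod_cast hc.2.lt_of_ne h0) T.zero_le_rhat⟩
    simp [this]

theorem coreVol_ae_ne (a : ℝ) : ∀ᵐ y ∂T.coreVol, y ≠ a :=
  ae_restrict_of_ae (Measure.ae_ne volume a)

theorem intervalKernel_ae_eq_minus {x : EReal} (hx : x ∈ Ioo T.l T.r) :
    intervalKernel (T.sExt x).toReal =ᵐ[T.coreVol.restrict T.minusGap]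
      fun y => halfOpenKernel x (T.quantile y) := by
  filter_upwards [ae_restrict_mem T.measurableSet_minusGap, ae_restrict_of_ae T.ae_mem_core,
    ae_restrict_of_ae (coreVol_ae_ne 0), ae_restrict_of_ae (coreVol_ae_ne (T.sExt x).toReal),
    ae_restrict_of_ae (coreVol_ae_ne (T.sLeft x).toReal)] with y h1 h2 h3 h4 h5
  rw [intervalKernel_eq hx h2 h3 h4 h5, if_pos h1]

theorem intervalKernel_ae_eq_plus {x : EReal} (hx : x ∈ Ioo T.l T.r) :
    intervalKernel (T.sExt x).toReal =ᵐ[T.coreVol.restrict T.plusGap]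
      fun y => openKernel x (T.quantile y) := by
  filter_upwards [ae_restrict_mem T.measurableSet_plusGap, ae_restrict_of_ae T.ae_mem_core,
    ae_restrict_of_ae (coreVol_ae_ne 0), ae_restrict_of_ae (coreVol_ae_ne (T.sExt x).toReal),
    ae_restrict_of_ae (coreVol_ae_ne (T.sLeft x).toReal)] with y h1 h2 h3 h4 h5
  have := mem_cases h2
  rw [intervalKernel_eq hx h2 h3 h4 h5, if_neg (by tauto)]

theorem intervalKernel_ae_eq_cont {x : EReal} (hx : x ∈ Ioo T.l T.r) :
    intervalKernel (T.sExt x).toReal =ᵐ[T.coreVol.restrict T.contPart]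
      fun y => openKernel x (T.quantile y) := by
  filter_upwards [ae_restrict_mem T.measurableSet_contPart, ae_restrict_of_ae T.ae_mem_core,
    ae_restrict_of_ae (coreVol_ae_ne 0), ae_restrict_of_ae (coreVol_ae_ne (T.sExt x).toReal),
    ae_restrict_of_ae (coreVol_ae_ne (T.sLeft x).toReal)] with y h1 h2 h3 h4 h5
  have := mem_cases h2
  rw [intervalKernel_eq hx h2 h3 h4 h5, if_neg (by tauto)]

theorem restrict_coreVol_le (S : Set ℝ) : T.coreVol.restrict S ≤ volume :=
  Measure.restrict_le_self.trans T.coreVol_le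

variable (T) in
theorem integral_coreVol {k : ℝ → ℝ} (hk : Integrable k T.coreVol) :
    ∫ y, k y ∂T.coreVol = ∫ y in T.contPart, k y ∂T.coreVol + ∫ y in T.plusGap, k y ∂T.coreVol +
      ∫ y in T.minusGap, k y ∂T.coreVol := by
  conv_lhs => rw [T.coreVol_eq]
  rw [integral_add_measure _ hk.restrict, integral_add_measure hk.restrict hk.restrict]
  exact hk.restrict.add_measure hk.restrict

/-- The integral from `0` to `𝐬(x)` splits into the contributions of the continuous part and of the
gaps. -/
theorem intervalIntegral_sExt {x : EReal} (hx : x ∈ Ioo T.l T.r) {W : ℝ → ℝ}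
    (hW : Integrable (fun y => intervalKernel (T.sExt x).toReal y * W y)) :
    ∫ t in (0 : ℝ)..(T.sExt x).toReal, W t =
      ∫ y in T.contPart, openKernel x (T.quantile y) * W y ∂T.coreVol +
      ∫ y in T.plusGap, openKernel x (T.quantile y) * W y ∂T.coreVol +
      ∫ y in T.minusGap, halfOpenKernel x (T.quantile y) * W y ∂T.coreVol := by
  have h1 : ∫ y, intervalKernel (T.sExt x).toReal y * W y =
      ∫ y, intervalKernel (T.sExt x).toReal y * W y ∂T.coreVol := by
    refine (setIntegral_eq_integral_of_ae_compl_eq_zero ?_).symm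
    filter_upwards [Measure.ae_ne volume 0, Measure.ae_ne volume (T.sExt x).toReal] with y h0 h1 h2
    rw [intervalKernel_eq_zero hx h2 h0 h1, zero_mul]
  rw [intervalIntegral_eq_kernel, h1, T.integral_coreVol (hW.mono_measure T.coreVol_le)]
  congr 1
  · congr 1
    · apply integral_congr_ae
      filter_upwards [intervalKernel_ae_eq_cont hx] with y hy
      rw [hy]
    · apply integral_congr_ae
      filter_upwards [intervalKernel_ae_eq_plus hx] with y hy
      rw [hy]
  · apply integral_congr_ae
    filter_upwards [intervalKernel_ae_eq_minus hx] with y hy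
    rw [hy]

theorem memLp_openKernel_cont {x : EReal} (hx : x ∈ Ioo T.l T.r) {ν : Measure EReal}
    (h : MeasurePreserving T.quantile (T.coreVol.restrict T.contPart) ν) :
    MemLp (openKernel x) 2 ν := by
  rw [← h.map_eq, memLp_map_measure_iff (measurable_openKernel x).aestronglyMeasurable
    h.measurable.aemeasurable]
  exact ((memLp_intervalKernel _).mono_measure (restrict_coreVol_le _)).ae_eq
    (intervalKernel_ae_eq_cont hx)

theorem memLp_openKernel_plus {x : EReal} (hx : x ∈ Ioo T.l T.r) :
    MemLp (openKernel x) 2 T.muPlus := by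
  have h := T.measurePreserving_plus
  rw [← h.map_eq, memLp_map_measure_iff (measurable_openKernel x).aestronglyMeasurable
    h.measurable.aemeasurable]
  exact ((memLp_intervalKernel _).mono_measure (restrict_coreVol_le _)).ae_eq
    (intervalKernel_ae_eq_plus hx)

theorem memLp_halfOpenKernel_minus {x : EReal} (hx : x ∈ Ioo T.l T.r) :
    MemLp (halfOpenKernel x) 2 T.muMinus := by
  have h := T.measurePreserving_minus
  rw [← h.map_eq, memLp_map_measure_iff (measurable_halfOpenKernel x).aestronglyMeasurable
    h.measurable.aemeasurable]
  exact ((memLp_intervalKernel _).mono_measure (restrict_coreVol_le _)).ae_eq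
    (intervalKernel_ae_eq_minus hx)

/-! ### The continuous part of the scale -/

variable (T)

/-- The image of Lebesgue measure on the continuous part. -/
def contMeasure : Measure EReal := (T.coreVol.restrict T.contPart).map T.quantile

theorem measurePreserving_contMeasure :
    MeasurePreserving T.quantile (T.coreVol.restrict T.contPart) T.contMeasure :=
  ⟨T.quantile_mono.measurable, rfl⟩

/-- On `contPart` the point `y` is recovered from its quantile as a left limit of the scale, so
fibres have at most one point. -/
theorem contMeasure_singleton (x : EReal) : T.contMeasure {x} = 0 := by
  have hm := T.quantile_mono.measurable (measurableSet_singleton x)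
  rw [contMeasure, Measure.map_apply T.quantile_mono.measurable (measurableSet_singleton x),
    Measure.restrict_apply hm]
  refine measure_mono_null (t := {(T.sLeft x).toReal}) (fun y hy => ?_) ?_
  · obtain ⟨h1 : T.quantile y = x, h2 : (y : EReal) = _⟩ := hy
    rw [mem_singleton_iff, ← h1, ← h2, EReal.toReal_coe]
  · exact nonpos_iff_eq_zero.1 ((T.coreVol_le _).trans_eq (by simp))

theorem contMeasure_compl : T.contMeasure (Ioo T.l T.r)ᶜ = 0 := by
  rw [contMeasure, Measure.map_apply T.quantile_mono.measurable measurableSet_Ioo.compl]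
  refine nonpos_iff_eq_zero.1 ((Measure.restrict_le_self _).trans_eq ?_)
  exact measure_mono_null (t := T.coreᶜ) (fun y hy hc => hy (quantile_mem hc)) T.ae_mem_core

variable {T}

/-- Split `𝐬(x)`, viewed as the integral of `1` from `0`: the gaps account for the two jump parts,
and what remains is the continuous part. -/
theorem sc_eq {x : EReal} (hx : x ∈ Ioo T.l T.r) :
    T.sc x = ∫ z, openKernel x z ∂T.contMeasure := by
  have h1 := intervalIntegral_sExt hx (W := fun _ => 1)
    (by simpa using integrable_intervalKernel (T.sExt x).toReal)
  have hc := T.measurePreserving_contMeasure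
  have hp := T.measurePreserving_plus
  have hm := T.measurePreserving_minus
  rw [sc, sdPlus, sdMinus, openIntegral_eq, halfOpenIntegral_eq]
  simp only [intervalIntegral.integral_const, sub_zero, smul_eq_mul, mul_one] at h1 ⊢
  rw [← hc.map_eq, ← hp.map_eq, ← hm.map_eq,
    integral_map T.quantile_mono.measurable.aemeasurable
      (measurable_openKernel x).aestronglyMeasurable,
    integral_map T.quantile_mono.measurable.aemeasurable
      (measurable_openKernel x).aestronglyMeasurable,
    integral_map T.quantile_mono.measurable.aemeasurable
      (measurable_halfOpenKernel x).aestronglyMeasurable]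
  rw [sExt_of_mem hx, EReal.toReal_coe] at h1
  rw [h1]
  ring

theorem integrable_openKernel_contMeasure {x : EReal} (hx : x ∈ Ioo T.l T.r) :
    Integrable (openKernel x) T.contMeasure := by
  rw [contMeasure, integrable_map_measure (measurable_openKernel x).aestronglyMeasurable
    T.quantile_mono.measurable.aemeasurable]
  exact ((integrable_intervalKernel _).mono_measure (restrict_coreVol_le _)).congr
    (intervalKernel_ae_eq_cont hx)

theorem openKernel_sub {a b z : EReal} (hab : a ≤ b) (h0 : z ≠ 0) (ha : z ≠ a) (hb : z ≠ b) :
    openKernel b z - openKernel a z = (Ioc a b).indicator 1 z := by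
  unfold openKernel
  simp only [indicator, mem_Ioo, mem_Ico, mem_Ioc, Pi.one_apply]
  rcases lt_trichotomy z 0 with h | h | h <;> rcases lt_trichotomy z a with h' | h' | h' <;>
    rcases lt_trichotomy z b with h'' | h'' | h'' <;> grind

theorem sc_sub {a b : EReal} (ha : a ∈ Ioo T.l T.r) (hb : b ∈ Ioo T.l T.r) (hab : a ≤ b) :
    T.contMeasure (Ioc a b) = ENNReal.ofReal (T.sc b - T.sc a) ∧ 0 ≤ T.sc b - T.sc a := by
  have hne : ∀ z, ∀ᵐ y ∂T.contMeasure, y ≠ z := fun z => by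
    rw [ae_iff]; simpa using T.contMeasure_singleton z
  have hae : (fun z => openKernel b z - openKernel a z) =ᵐ[T.contMeasure]
      (Ioc a b).indicator 1 := by
    filter_upwards [hne 0, hne a, hne b] with z h0 h1 h2 using openKernel_sub hab h0 h1 h2
  have hi := ((integrable_openKernel_contMeasure hb).sub
    (integrable_openKernel_contMeasure ha)).congr hae
  have h1 : T.sc b - T.sc a = T.contMeasure.real (Ioc a b) := by
    rw [sc_eq ha, sc_eq hb, ← integral_sub (integrable_openKernel_contMeasure hb)
      (integrable_openKernel_contMeasure ha), integral_congr_ae hae,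
      integral_indicator_one measurableSet_Ioc]
  have hfin : T.contMeasure (Ioc a b) ≠ ∞ := by
    have h2 := (integrable_indicator_iff measurableSet_Ioc).1 hi
    have h3 := (integrable_const_iff_isFiniteMeasure (one_ne_zero (α := ℝ))).1 h2
    simpa using measure_ne_top (T.contMeasure.restrict (Ioc a b)) univ
  rw [h1]
  exact ⟨by rw [measureReal_def, ENNReal.ofReal_toReal hfin], measureReal_nonneg⟩

theorem monotone_sc : Monotone fun x : Ioo T.l T.r => T.sc x := fun a b hab =>
  sub_nonneg.1 (sc_sub a.2 b.2 hab).2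

end ScaleTriple
end

noncomputable section

namespace ScaleTriple

variable {T : ScaleTriple}

/-- The Stieltjes measure is built from right limits. The intervals `(a, uₙ]` shrink to the empty
set, so continuity of `contMeasure` from above makes them harmless. -/
theorem rightLim_sc (a : Ioo T.l T.r) :
    Function.rightLim (fun x : Ioo T.l T.r => T.sc x) a = T.sc a := by
  obtain ⟨u, hu, hau, hua⟩ := exists_seq_strictAnti_tendsto a
  have h1 : ∀ n, T.contMeasure (Ioc (a : EReal) (u n)) = ENNReal.ofReal (T.sc (u n) - T.sc a) :=
    fun n => (sc_sub a.2 (u n).2 (hau n).le).1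
  have hI : ⋂ n, Ioc (a : EReal) (u n) = ∅ := by
    refine eq_empty_of_forall_notMem fun z hz => ?_
    rw [mem_iInter] at hz
    have h2 : Tendsto (fun n => (u n : EReal)) atTop (𝓝 a) :=
      (continuous_subtype_val.tendsto a).comp hua
    exact absurd (ge_of_tendsto' h2 fun n => (hz n).2) (not_le.2 (hz 0).1)
  have h2 : Tendsto (fun n => T.contMeasure (Ioc (a : EReal) (u n))) atTop (𝓝 0) := by
    rw [← measure_empty (μ := T.contMeasure), ← hI]
    refine tendsto_measure_iInter_atTop (fun n => measurableSet_Ioc.nullMeasurableSet)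
      (fun m n hmn => Ioc_subset_Ioc_right (hu.antitone hmn)) ⟨0, ?_⟩
    rw [h1]; exact ENNReal.ofReal_ne_top
  have h3 : Tendsto (fun n => T.sc (u n)) atTop (𝓝 (T.sc a)) := by
    have h4 := (ENNReal.tendsto_toReal (by simp)).comp h2
    have h5 : ∀ n, (T.contMeasure (Ioc (a : EReal) (u n))).toReal = T.sc (u n) - T.sc a :=
      fun n => by rw [h1, ENNReal.toReal_ofReal (sc_sub a.2 (u n).2 (hau n).le).2]
    have h6 := (h4.congr h5).add_const (T.sc a)
    simpa using h6
  exact le_antisymm (ge_of_tendsto' h3 fun n => monotone_sc.rightLim_le (hau n))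
    (monotone_sc.le_rightLim le_rfl)

-- Both measures give `(a, b]` the increment of `𝐬_c`, and neither charges the complement of `(l,
-- r)`. Thus `quantile` is measure preserving on the continuous part as well.
variable (T) in
theorem muC_eq : T.muC = T.contMeasure := by
  rw [muC, lebesgueStieltjes, dif_pos monotone_sc]
  have hemb : MeasurableEmbedding (Subtype.val : Ioo T.l T.r → EReal) :=
    MeasurableEmbedding.subtype_coe measurableSet_Ioo
  have h1 : (monotone_sc (T := T)).stieltjesFunction.measure =
      T.contMeasure.comap Subtype.val := by
    have key : ∀ a b : Ioo T.l T.r, a < b →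
        (monotone_sc (T := T)).stieltjesFunction.measure (Ioc a b) =
          ENNReal.ofReal (T.sc b - T.sc a) := fun a b _ => by
      rw [StieltjesFunction.measure_Ioc, Monotone.stieltjesFunction_eq,
        Monotone.stieltjesFunction_eq, rightLim_sc, rightLim_sc]
    refine Measure.ext_of_Ioc' _ _ (fun a b hab => by rw [key a b hab]; exact ENNReal.ofReal_ne_top)
      fun a b hab => ?_
    rw [key a b hab, hemb.comap_apply, ← (sc_sub a.2 b.2 hab.le).1]
    congr 1
    ext x
    constructor
    · exact fun hx => ⟨⟨x, a.2.1.trans hx.1, hx.2.trans_lt b.2.2⟩, hx, rfl⟩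
    · rintro ⟨y, hy, rfl⟩
      exact hy
  rw [h1, hemb.map_comap, Subtype.range_coe]
  exact Measure.restrict_eq_self_of_ae_mem (measure_eq_zero_iff_ae_notMem.1 T.contMeasure_compl |>.mono
    fun x hx => not_not.1 hx)

variable (T) in
theorem measurePreserving_cont :
    MeasurePreserving T.quantile (T.coreVol.restrict T.contPart) T.muC := by
  rw [T.muC_eq]; exact T.measurePreserving_contMeasure

end ScaleTriple

/-! ### Densities with respect to the scale and primitives on the image side. -/

/-- The adjoint of the isometric embedding of `L²` given by a measure preserving map. -/
theorem MeasureTheory.MeasurePreserving.exists_adjoint {α β : Type*} [MeasurableSpace α]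
    [MeasurableSpace β] {μ : Measure α} {ν : Measure β} {τ : α → β} (hτ : MeasurePreserving τ μ ν)
    {w : α → ℝ} (hw : MemLp w 2 μ) :
    ∃ g, MemLp g 2 ν ∧ ∀ k : β → ℝ, MemLp k 2 ν →
      ∫ x, k (τ x) * w x ∂μ = ∫ z, k z * g z ∂ν := by
  let Φ : Lp ℝ 2 ν →L[ℝ] Lp ℝ 2 μ :=
    (Lp.compMeasurePreservingₗᵢ ℝ τ hτ).toContinuousLinearMap
  let g := ContinuousLinearMap.adjoint Φ (hw.toLp w)
  refine ⟨g, Lp.memLp g, fun k hk => ?_⟩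
  have h1 : Φ (hk.toLp k) = (hk.comp_measurePreserving hτ).toLp (k ∘ τ) :=
    Lp.toLp_compMeasurePreserving hk hτ
  have h2 := ContinuousLinearMap.adjoint_inner_right Φ (hk.toLp k) (hw.toLp w)
  rw [h1, MemLp.inner_toLp] at h2
  have h3 : inner ℝ (hk.toLp k) g = ∫ z, k z * g z ∂ν := by
    rw [← MemLp.inner_toLp hk (Lp.memLp g), Lp.toLp_coeFn]
  rw [← h3, h2]
  rfl

namespace ScaleTriple

variable {T : ScaleTriple}

open Classical in
variable (T) in
/-- The function on the line which has the given densities with respect to the scale. -/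
def spread (p : Densities) (y : ℝ) : ℝ :=
  T.core.indicator (fun y => if y ∈ T.minusGap then p.minus (T.quantile y) else
    if y ∈ T.plusGap then p.plus (T.quantile y) else p.cont (T.quantile y)) y

theorem spread_ae_eq_cont (p : Densities) :
    T.spread p =ᵐ[T.coreVol.restrict T.contPart] fun y => p.cont (T.quantile y) := by
  filter_upwards [ae_restrict_mem T.measurableSet_contPart, ae_restrict_of_ae T.ae_mem_core]
    with y h1 h2
  have := mem_cases h2
  rw [spread, indicator_of_mem h2, if_neg (by tauto), if_neg (by tauto)]

theorem spread_ae_eq_plus (p : Densities) :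
    T.spread p =ᵐ[T.coreVol.restrict T.plusGap] fun y => p.plus (T.quantile y) := by
  filter_upwards [ae_restrict_mem T.measurableSet_plusGap, ae_restrict_of_ae T.ae_mem_core]
    with y h1 h2
  have := mem_cases h2
  rw [spread, indicator_of_mem h2, if_neg (by tauto), if_pos h1]

theorem spread_ae_eq_minus (p : Densities) :
    T.spread p =ᵐ[T.coreVol.restrict T.minusGap] fun y => p.minus (T.quantile y) := by
  filter_upwards [ae_restrict_mem T.measurableSet_minusGap, ae_restrict_of_ae T.ae_mem_core]
    with y h1 h2
  rw [spread, indicator_of_mem h2, if_pos h1]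

theorem spread_of_notMem (p : Densities) {y : ℝ} (hy : y ∉ T.core) : T.spread p y = 0 :=
  indicator_of_notMem hy _

theorem memLp_of_coreVol {w : ℝ → ℝ} (h0 : ∀ y ∉ T.core, w y = 0)
    (hc : MemLp w 2 (T.coreVol.restrict T.contPart)) (hp : MemLp w 2 (T.coreVol.restrict T.plusGap))
    (hm : MemLp w 2 (T.coreVol.restrict T.minusGap)) : MemLp w 2 volume := by
  have h1 : MemLp w 2 T.coreVol := by
    refine ⟨?_, ?_⟩
    · rw [T.coreVol_eq]
      exact (hc.1.add_measure hp.1).add_measure hm.1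
    · rw [eLpNorm_lt_top_iff_lintegral_rpow_enorm_lt_top (by simp) (by simp), T.coreVol_eq,
        lintegral_add_measure, lintegral_add_measure]
      have h : ∀ ν : Measure ℝ, MemLp w 2 ν → ∫⁻ y, ‖w y‖ₑ ^ (2 : ℝ≥0∞).toReal ∂ν < ∞ := fun ν h =>
        (eLpNorm_lt_top_iff_lintegral_rpow_enorm_lt_top (by simp) (by simp)).1 h.2
      exact ENNReal.add_lt_top.2 ⟨ENNReal.add_lt_top.2 ⟨h _ hc, h _ hp⟩, h _ hm⟩
  have h2 : T.core.indicator w = w := indicator_eq_self.2 fun y hy => by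
    by_contra hc
    exact hy (h0 y hc)
  rw [← h2]
  exact (memLp_indicator_iff_restrict T.isOpen_core.measurableSet).2 h1

theorem memLp_spread {p : Densities} (hc : MemLp p.cont 2 T.muC) (hp : MemLp p.plus 2 T.muPlus)
    (hm : MemLp p.minus 2 T.muMinus) : MemLp (T.spread p) 2 volume :=
  memLp_of_coreVol (fun _ => spread_of_notMem p)
    ((hc.comp_measurePreserving T.measurePreserving_cont).ae_eq (spread_ae_eq_cont p).symm)
    ((hp.comp_measurePreserving T.measurePreserving_plus).ae_eq (spread_ae_eq_plus p).symm)
    ((hm.comp_measurePreserving T.measurePreserving_minus).ae_eq (spread_ae_eq_minus p).symm)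

theorem HasDensities.memLp_spread {f : EReal → ℝ} {p : Densities} (h : T.HasDensities f p) :
    MemLp (T.spread p) 2 volume :=
  ScaleTriple.memLp_spread h.cont_memLp h.plus_memLp h.minus_memLp

theorem integral_comp_mul {S : Set ℝ} {ν : Measure EReal}
    (h : MeasurePreserving T.quantile (T.coreVol.restrict S) ν) {g k : EReal → ℝ}
    (hg : MemLp g 2 ν) (hk : MemLp k 2 ν) :
    ∫ y in S, k (T.quantile y) * g (T.quantile y) ∂T.coreVol = ∫ z, k z * g z ∂ν := by
  rw [← h.map_eq] at hg hk ⊢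
  exact (integral_map h.measurable.aemeasurable (hk.1.mul hg.1)).symm

/-- Square integrable functions on `(l̂, r̂)` pair with `spread p` through their densities. -/
theorem integral_spread_mul {p : Densities} (hc : MemLp p.cont 2 T.muC)
    (hp : MemLp p.plus 2 T.muPlus) (hm : MemLp p.minus 2 T.muMinus) {w : ℝ → ℝ}
    (hw : MemLp w 2 volume) :
    ∫ y, T.spread p y * w y =
      ∫ y in T.contPart, p.cont (T.quantile y) * w y ∂T.coreVol +
      ∫ y in T.plusGap, p.plus (T.quantile y) * w y ∂T.coreVol +
      ∫ y in T.minusGap, p.minus (T.quantile y) * w y ∂T.coreVol := by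
  have h1 : ∫ y, T.spread p y * w y = ∫ y, T.spread p y * w y ∂T.coreVol :=
    (setIntegral_eq_integral_of_forall_compl_eq_zero fun y hy => by
      rw [spread_of_notMem p hy, zero_mul]).symm
  have h2 : Integrable (fun y => T.spread p y * w y) T.coreVol :=
    ((memLp_spread hc hp hm).integrable_mul hw).mono_measure T.coreVol_le
  rw [h1, T.integral_coreVol h2]
  congr 1
  · congr 1
    · apply integral_congr_ae
      filter_upwards [spread_ae_eq_cont p] with y hy
      rw [hy]
    · apply integral_congr_ae
      filter_upwards [spread_ae_eq_plus p] with y hy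
      rw [hy]
  · apply integral_congr_ae
    filter_upwards [spread_ae_eq_minus p] with y hy
    rw [hy]

/-- Each part contributes through its measure preserving map; this is the isometry between the
energy of `f` and the Brownian energy of its lift. -/
theorem integral_spread_mul_spread {p q : Densities} {f g : EReal → ℝ}
    (hf : T.HasDensities f p) (hg : T.HasDensities g q) :
    ∫ y, T.spread p y * T.spread q y =
      ∫ x, p.cont x * q.cont x ∂T.muC + ∫ x, p.plus x * q.plus x ∂T.muPlus +
        ∫ x, p.minus x * q.minus x ∂T.muMinus := by
  rw [integral_spread_mul hf.cont_memLp hf.plus_memLp hf.minus_memLp hg.memLp_spread,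
    ← integral_comp_mul T.measurePreserving_cont hg.cont_memLp hf.cont_memLp,
    ← integral_comp_mul T.measurePreserving_plus hg.plus_memLp hf.plus_memLp,
    ← integral_comp_mul T.measurePreserving_minus hg.minus_memLp hf.minus_memLp]
  congr 1
  · congr 1
    · apply integral_congr_ae
      filter_upwards [spread_ae_eq_cont q] with y hy
      rw [hy]
    · apply integral_congr_ae
      filter_upwards [spread_ae_eq_plus q] with y hy
      rw [hy]
  · apply integral_congr_ae
    filter_upwards [spread_ae_eq_minus q] with y hy
    rw [hy]

theorem integrable_intervalKernel_mul {w : ℝ → ℝ} (hw : MemLp w 2 volume) (a : ℝ) :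
    Integrable (fun y => intervalKernel a y * w y) :=
  (memLp_intervalKernel a).integrable_mul hw

/-- The primitive of `spread p` is the function on the image of the scale which corresponds to
the function with densities `p`. -/
theorem intervalIntegral_spread {p : Densities} (hc : MemLp p.cont 2 T.muC)
    (hp : MemLp p.plus 2 T.muPlus) (hm : MemLp p.minus 2 T.muMinus) {x : EReal}
    (hx : x ∈ Ioo T.l T.r) :
    ∫ t in (0 : ℝ)..(T.sExt x).toReal, T.spread p t =
      openIntegral T.muC p.cont x + openIntegral T.muPlus p.plus x +
        halfOpenIntegral T.muMinus p.minus x := by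
  rw [intervalIntegral_sExt hx (integrable_intervalKernel_mul (memLp_spread hc hp hm) _),
    openIntegral_eq, openIntegral_eq, halfOpenIntegral_eq,
    ← integral_comp_mul T.measurePreserving_cont hc
      (memLp_openKernel_cont hx T.measurePreserving_cont),
    ← integral_comp_mul T.measurePreserving_plus hp (memLp_openKernel_plus hx),
    ← integral_comp_mul T.measurePreserving_minus hm (memLp_halfOpenKernel_minus hx)]
  congr 1
  · congr 1
    · apply integral_congr_ae
      filter_upwards [spread_ae_eq_cont p] with y hy
      rw [hy]
    · apply integral_congr_ae
      filter_upwards [spread_ae_eq_plus p] with y hy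
      rw [hy]
  · apply integral_congr_ae
    filter_upwards [spread_ae_eq_minus p] with y hy
    rw [hy]

/-- The function `u ∘ 𝐬` has densities with respect to the scale if `u` is a primitive of a square
integrable function `w`; they are obtained by projecting `w`. -/
theorem exists_hasDensities {F w : ℝ → ℝ} (hF : IsL2Primitive F w) {f : EReal → ℝ}
    (hf : ∀ x ∈ Ioo T.l T.r, f x = F (T.sExt x).toReal) :
    ∃ q, T.HasDensities f q ∧ ∀ p g, T.HasDensities g p →
      ∫ y, T.spread p y * w y = ∫ y, T.spread p y * T.spread q y := by
  have hr : ∀ S, MemLp w 2 (T.coreVol.restrict S) := fun S =>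
    hF.memLp.mono_measure (restrict_coreVol_le S)
  -- On each part, the adjoint replaces `w` by its projection onto functions of `quantile`. The
  -- kernels of the integrals from `0` are such functions, so they do not notice the replacement.
  obtain ⟨gc, hgc, hc⟩ := T.measurePreserving_cont.exists_adjoint (hr _)
  obtain ⟨gp, hgp, hp⟩ := T.measurePreserving_plus.exists_adjoint (hr _)
  obtain ⟨gm, hgm, hm⟩ := T.measurePreserving_minus.exists_adjoint (hr _)
  have hq : T.HasDensities f ⟨F 0, gc, gp, gm⟩ := by
    refine ⟨hgc, hgp, hgm, fun x hx => ?_⟩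
    rw [hf x hx, hF.eq_add 0, intervalIntegral_sExt hx (integrable_intervalKernel_mul hF.memLp _),
      hc _ (memLp_openKernel_cont hx T.measurePreserving_cont), hp _ (memLp_openKernel_plus hx),
      hm _ (memLp_halfOpenKernel_minus hx), openIntegral_eq, openIntegral_eq, halfOpenIntegral_eq]
    ring
  -- On each part `spread p` is itself a function of `quantile`, hence pairs equally with `w` and
  -- with its projection `spread q`.
  refine ⟨_, hq, fun p g hg => ?_⟩
  rw [integral_spread_mul hg.cont_memLp hg.plus_memLp hg.minus_memLp hF.memLp,
    integral_spread_mul_spread hg hq, hc _ hg.cont_memLp, hp _ hg.plus_memLp, hm _ hg.minus_memLp]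

theorem tendsto_comp_toReal {F : ℝ → ℝ} (hF : Continuous F) {h : EReal → EReal} {k : Filter EReal}
    {a : EReal} (ha : (a.toReal : EReal) = a) (ht : Tendsto h k (𝓝 a)) :
    Tendsto (fun x => F (h x).toReal) k (𝓝 (F a.toReal)) := by
  have h1 : Tendsto EReal.toReal (𝓝 a) (𝓝 a.toReal) :=
    EReal.tendsto_toReal (by rw [← ha]; simp) (by rw [← ha]; simp)
  exact (hF.tendsto _).comp (h1.comp ht)

/-- The function `f` on `I` is given by the function `F` on the image of the scale. -/
structure Corresponds (T : ScaleTriple) (f : EReal → ℝ) (F : ℝ → ℝ) : Prop where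
  continuous : Continuous F
  eq : ∀ x ∈ Ioo T.l T.r, f x = F (T.sExt x).toReal

namespace Corresponds

variable {f : EReal → ℝ} {F : ℝ → ℝ}

theorem tendsto (h : T.Corresponds f F) {k : Filter EReal} {a : EReal}
    (hk : ∀ᶠ x in k, x ∈ Ioo T.l T.r) (ha : (a.toReal : EReal) = a)
    (ht : Tendsto T.sExt k (𝓝 a)) : Tendsto f k (𝓝 (F a.toReal)) :=
  (tendsto_comp_toReal h.continuous ha ht).congr' (hk.mono fun x hx => (h.eq x hx).symm)

theorem tendsto_nhdsLT (h : T.Corresponds f F) {x : EReal} (hx : x ∈ Ioo T.l T.r) :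
    Tendsto f (𝓝[<] x) (𝓝 (F (T.sLeft x).toReal)) :=
  h.tendsto (mem_nhdsWithin_of_mem_nhds (Ioo_mem_nhds hx.1 hx.2)) (coe_sLeft hx)
    (T.sExt_mono.tendsto_leftLim x)

theorem tendsto_nhdsGT (h : T.Corresponds f F) {x : EReal} (hx : x ∈ Ioo T.l T.r) :
    Tendsto f (𝓝[>] x) (𝓝 (F (T.sRight x).toReal)) :=
  h.tendsto (mem_nhdsWithin_of_mem_nhds (Ioo_mem_nhds hx.1 hx.2)) (coe_sRight hx)
    (T.sExt_mono.tendsto_rightLim x)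

theorem leftLim_eq (h : T.Corresponds f F) {x : EReal} (hx : x ∈ Ioo T.l T.r) :
    Function.leftLim f x = F (T.sLeft x).toReal := by
  have := nhdsLT_neBot hx.1
  exact leftLim_eq_of_tendsto (h.tendsto_nhdsLT hx)

theorem rightLim_eq (h : T.Corresponds f F) {x : EReal} (hx : x ∈ Ioo T.l T.r) :
    Function.rightLim f x = F (T.sRight x).toReal := by
  have := nhdsGT_neBot hx.2
  exact rightLim_eq_of_tendsto (h.tendsto_nhdsGT hx)

end Corresponds

variable (T) in
/-- The function on the line with the given densities with respect to the scale, which is affine on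
the gaps of the image of the scale. -/
def lift (p : Densities) (y : ℝ) : ℝ := p.const + ∫ t in (0 : ℝ)..y, T.spread p t

theorem HasDensities.isL2Primitive {f : EReal → ℝ} {p : Densities} (h : T.HasDensities f p) :
    IsL2Primitive (T.lift p) (T.spread p) :=
  IsL2Primitive.of_integral h.memLp_spread _ _

theorem HasDensities.corresponds {f : EReal → ℝ} {p : Densities} (h : T.HasDensities f p) :
    T.Corresponds f (T.lift p) := by
  refine ⟨h.isL2Primitive.continuous, fun x hx => ?_⟩
  rw [lift, intervalIntegral_spread h.cont_memLp h.plus_memLp h.minus_memLp hx, h.eq x hx]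
  ring

theorem eq_zero_of_primitive_eq_zero {F w : ℝ → ℝ} (hF : IsL2Primitive F w) {a b c : ℝ} (hab : a < b)
    (hw : ∀ t ∈ Ioo a b, w t = c) (ha : F a = 0) (hb : F b = 0) : ∀ y ∈ Icc a b, F y = 0 := by
  have h1 : ∀ y ∈ Icc a b, F y = (y - a) * c := fun y hy => by
    rw [hF.eq_add a y, ha, zero_add, ← smul_eq_mul, ← intervalIntegral.integral_const]
    apply intervalIntegral.integral_congr_ae
    filter_upwards [Measure.ae_ne volume b] with t ht h
    rw [uIoc_of_le hy.1] at h
    exact hw t ⟨h.1, (h.2.trans hy.2).lt_of_ne ht⟩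
  have h2 : c = 0 := by
    have := h1 b (right_mem_Icc.2 hab.le)
    rw [hb] at this
    exact (mul_eq_zero.1 this.symm).resolve_left (sub_pos.2 hab).ne'
  intro y hy
  rw [h1 y hy, h2, mul_zero]

/-- The densities of a function with respect to the scale are unique. -/
theorem HasDensities.spread_ae_eq_zero {f : EReal → ℝ} {p : Densities} (h : T.HasDensities f p)
    (hf : ∀ x ∈ Ioo T.l T.r, f x = 0) : T.spread p =ᵐ[volume] 0 := by
  have hP := h.isL2Primitive
  have hC := h.corresponds
  have h0 : ∀ x ∈ Ioo T.l T.r, T.lift p (T.sExt x).toReal = 0 := fun x hx => by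
    rw [← hC.eq x hx, hf x hx]
  have hL : ∀ x ∈ Ioo T.l T.r, T.lift p (T.sLeft x).toReal = 0 := fun x hx => by
    have := nhdsLT_neBot hx.1
    refine tendsto_nhds_unique (hC.tendsto_nhdsLT hx) (tendsto_const_nhds.congr' ?_)
    filter_upwards [mem_nhdsWithin_of_mem_nhds (Ioo_mem_nhds hx.1 hx.2)] with z hz
    exact (hf z hz).symm
  have hR : ∀ x ∈ Ioo T.l T.r, T.lift p (T.sRight x).toReal = 0 := fun x hx => by
    have := nhdsGT_neBot hx.2
    refine tendsto_nhds_unique (hC.tendsto_nhdsGT hx) (tendsto_const_nhds.congr' ?_)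
    filter_upwards [mem_nhdsWithin_of_mem_nhds (Ioo_mem_nhds hx.1 hx.2)] with z hz
    exact (hf z hz).symm
  -- A point of the core is either a left limit of the scale, where continuity gives zero, or lies
  -- in a gap. There the lift is affine, because `spread p` is constant on the gap, and it vanishes
  -- at both ends.
  have hcore : ∀ y ∈ T.core, T.lift p y = 0 := by
    intro y hy
    have hx := quantile_mem hy
    rcases mem_cases hy with hc | hc | hc
    · rw [← hL _ hx, ← show (y : EReal) = T.sLeft (T.quantile y) from hc.1, EReal.toReal_coe]
    · have h1 : T.sExt (T.quantile y) < y := hc.2.1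
      have h2 := le_sRight_quantile hy
      rw [← coe_sExt hx, EReal.coe_lt_coe_iff] at h1
      rw [← coe_sRight hx, EReal.coe_le_coe_iff] at h2
      refine eq_zero_of_primitive_eq_zero hP (h1.trans_le h2) (c := p.plus (T.quantile y))
        (fun t ht => ?_) (h0 _ hx) (hR _ hx) y ⟨h1.le, h2⟩
      have h3 := EReal.coe_lt_coe_iff.2 ht.1
      have h4 := EReal.coe_lt_coe_iff.2 ht.2
      rw [coe_sExt hx] at h3
      rw [coe_sRight hx] at h4
      have h5 := quantile_eq_of_plus h3 h4
      have h6 : t ∈ T.core := ⟨(T.sExt_mem _).1.trans_lt h3, h4.trans_le (T.sRight_mem _).2⟩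
      have h7 : t ∈ T.plusGap := by
        change T.sExt (T.quantile t) < t
        rwa [h5]
      have := mem_cases h6
      rw [spread, indicator_of_mem h6, if_neg (by tauto), if_pos h7, h5]
    · obtain ⟨h1, h2⟩ := hc.2.2
      rw [← coe_sLeft hx, EReal.coe_lt_coe_iff] at h1
      rw [← coe_sExt hx, EReal.coe_le_coe_iff] at h2
      refine eq_zero_of_primitive_eq_zero hP (h1.trans_le h2) (c := p.minus (T.quantile y))
        (fun t ht => ?_) (hL _ hx) (h0 _ hx) y ⟨h1.le, h2⟩
      have h3 := EReal.coe_lt_coe_iff.2 ht.1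
      have h4 := EReal.coe_lt_coe_iff.2 ht.2
      rw [coe_sLeft hx] at h3
      rw [coe_sExt hx] at h4
      have h5 := quantile_eq_of_minus h3 h4.le
      have h6 : t ∈ T.core := ⟨(T.sLeft_mem _).1.trans_lt h3, h4.trans_le (T.sExt_mem _).2⟩
      have h7 : t ∈ T.minusGap := by
        change T.sLeft (T.quantile t) < t ∧ (t : EReal) ≤ T.sExt (T.quantile t)
        rw [h5]
        exact ⟨h3, h4.le⟩
      rw [spread, indicator_of_mem h6, if_pos h7, h5]
  filter_upwards [hP.deriv_ae_eq] with y hy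
  by_cases hyc : y ∈ T.core
  · have h8 : T.lift p =ᶠ[𝓝 y] fun _ => 0 :=
      eventually_of_mem (T.isOpen_core.mem_nhds hyc) hcore
    rw [← hy, h8.deriv_eq]
    simp
  · exact spread_of_notMem p hyc

/-- The lift of the densities is harmonic on the gaps: it is orthogonal to functions vanishing on
the image of the scale. -/
theorem HasDensities.integral_spread_mul_eq_zero {f : EReal → ℝ} {p : Densities}
    (h : T.HasDensities f p) {F w : ℝ → ℝ} (hF : IsL2Primitive F w)
    (h0 : ∀ x ∈ Ioo T.l T.r, F (T.sExt x).toReal = 0) : ∫ y, T.spread p y * w y = 0 := by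
  obtain ⟨q, hq, h1⟩ := exists_hasDensities hF (f := fun x => F (T.sExt x).toReal)
    fun _ _ => rfl
  rw [h1 p f h]
  have h2 := hq.spread_ae_eq_zero h0
  rw [integral_congr_ae (g := fun _ => 0), integral_zero]
  filter_upwards [h2] with y hy
  rw [hy, Pi.zero_apply, mul_zero]

end ScaleTriple
end

noncomputable section

namespace ScaleTriple

/-! ### The intervals `Ĵ` and `Î` -/

variable {T : ScaleTriple}

-- A missing point `z` between `l̂` and `r̂` lies strictly between `𝐬(x)` and one of the one-sided
-- limits at `x = quantile z`. By monotonicity the whole open gap is then missing.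
variable (T) in
theorem isClosed_IhatS : IsClosed T.IhatS := by
  rw [← isOpen_compl_iff, isOpen_iff_mem_nhds]
  intro z hz
  have hz1 : z ∉ T.sExt '' Icc T.l T.r := fun h => hz (Or.inl (Or.inl h))
  have hz2 : z ∉ T.sLeft '' T.Dminus := fun h => hz (Or.inl (Or.inr h))
  have hz3 : z ∉ T.sRight '' T.Dplus := fun h => hz (Or.inr h)
  rcases lt_trichotomy z T.lhat with hl | hl | hl
  · filter_upwards [Iio_mem_nhds hl] with y hy hy'
    rcases hy' with (⟨x, -, rfl⟩ | ⟨x, -, rfl⟩) | ⟨x, -, rfl⟩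
    · exact absurd (T.sExt_mem x).1 (not_le.2 hy)
    · exact absurd (T.sLeft_mem x).1 (not_le.2 hy)
    · exact absurd (T.sRight_mem x).1 (not_le.2 hy)
  · exact absurd ⟨T.l, left_mem_Icc.2 T.l_lt_r.le, by rw [hl, sExt_of_le le_rfl]⟩ hz1
  rcases lt_trichotomy z T.rhat with hr | hr | hr
  · have hzc : ((z.toReal : ℝ) : EReal) = z := EReal.coe_toReal (ne_top_of_lt hr) (ne_bot_of_gt hl)
    have hcore : z.toReal ∈ T.core := by
      simp only [core, mem_ofPred_eq, hzc]
      exact ⟨hl, hr⟩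
    have hx := quantile_mem hcore
    have h1 := sLeft_quantile_le hcore
    have h2 := le_sRight_quantile hcore
    set x := T.quantile z.toReal
    rw [hzc] at h1 h2
    have hxI : x ∈ Icc T.l T.r := Ioo_subset_Icc_self hx
    have h3 : T.sExt x ≠ z := fun h => hz1 ⟨x, hxI, h⟩
    rcases h3.lt_or_gt with h4 | h4
    · have h5 : z < T.sRight x := h2.lt_of_ne fun h => hz3 ⟨x, ⟨hxI, (h4.trans_eq h).ne⟩, h.symm⟩
      filter_upwards [Ioo_mem_nhds h4 h5] with y hy hy'
      rcases hy' with (⟨t, -, rfl⟩ | ⟨t, -, rfl⟩) | ⟨t, -, rfl⟩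
      · rcases le_or_gt t x with ht | ht
        · exact absurd (T.sExt_mono ht) (not_le.2 hy.1)
        · exact absurd (sRight_le_sExt ht) (not_le.2 hy.2)
      · rcases le_or_gt t x with ht | ht
        · exact absurd (T.sExt_mono.leftLim_le ht) (not_le.2 hy.1)
        · exact absurd (T.sExt_mono.rightLim_le_leftLim ht) (not_le.2 hy.2)
      · rcases lt_or_ge t x with ht | ht
        · exact absurd (sRight_le_sExt ht) (not_le.2 hy.1)
        · exact absurd (T.sExt_mono.rightLim ht) (not_le.2 hy.2)
    · have h5 : T.sLeft x < z := h1.lt_of_ne fun h => hz2 ⟨x, ⟨hxI, (h.trans_lt h4).ne'⟩, h⟩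
      filter_upwards [Ioo_mem_nhds h5 h4] with y hy hy'
      rcases hy' with (⟨t, -, rfl⟩ | ⟨t, -, rfl⟩) | ⟨t, -, rfl⟩
      · rcases lt_or_ge t x with ht | ht
        · exact absurd (sExt_le_sLeft ht) (not_le.2 hy.1)
        · exact absurd (T.sExt_mono ht) (not_le.2 hy.2)
      · rcases le_or_gt t x with ht | ht
        · exact absurd (T.sExt_mono.leftLim ht) (not_le.2 hy.1)
        · exact absurd (sExt_le_sLeft ht) (not_le.2 hy.2)
      · rcases lt_or_ge t x with ht | ht
        · exact absurd (T.sExt_mono.rightLim_le_leftLim ht) (not_le.2 hy.1)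
        · exact absurd (T.sExt_mono.le_rightLim ht) (not_le.2 hy.2)
  · exact absurd ⟨T.r, right_mem_Icc.2 T.l_lt_r.le, by rw [hr, sExt_of_ge le_rfl]⟩ hz1
  · filter_upwards [Ioi_mem_nhds hr] with y hy hy'
    rcases hy' with (⟨x, -, rfl⟩ | ⟨x, -, rfl⟩) | ⟨x, -, rfl⟩
    · exact absurd (T.sExt_mem x).2 (not_le.2 hy)
    · exact absurd (T.sLeft_mem x).2 (not_le.2 hy)
    · exact absurd (T.sRight_mem x).2 (not_le.2 hy)

theorem core_subset_Jhat : T.core ⊆ T.Jhat := fun _ hy =>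
  ⟨⟨hy.1.le, hy.2.le⟩, fun h => absurd h hy.1.ne', fun h => absurd h hy.2.ne⟩

theorem mem_Ihat_iff {y : ℝ} : y ∈ T.Ihat ↔ y ∈ T.Jhat ∧ (y : EReal) ∈ T.IhatS :=
  ⟨fun h => ⟨T.Ihat_subset_Jhat h, h.1⟩, fun h =>
    ⟨h.2, fun h' => (h.1.2.1 h').2.1 h', fun h' => (h.1.2.2 h').2.2 h'⟩⟩

theorem mem_Jhat_of_eq_lhat {y : ℝ} (hy : (y : EReal) = T.lhat) :
    y ∈ T.Jhat ↔ T.ReflectingLeft := by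
  refine ⟨fun h => (h.2.1 hy).2.1 hy, fun h => T.Ihat_subset_Jhat ⟨?_, fun _ => h, fun h' => ?_⟩⟩
  · exact Or.inl (Or.inl ⟨T.l, left_mem_Icc.2 T.l_lt_r.le, by rw [hy, sExt_of_le le_rfl]⟩)
  · exact absurd (hy.symm.trans h') T.lhat_lt_rhat.ne

theorem mem_Jhat_of_eq_rhat {y : ℝ} (hy : (y : EReal) = T.rhat) :
    y ∈ T.Jhat ↔ T.ReflectingRight := by
  refine ⟨fun h => (h.2.2 hy).2.2 hy, fun h => T.Ihat_subset_Jhat ⟨?_, fun h' => ?_, fun _ => h⟩⟩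
  · exact Or.inl (Or.inl ⟨T.r, right_mem_Icc.2 T.l_lt_r.le, by rw [hy, sExt_of_ge le_rfl]⟩)
  · exact absurd (h'.symm.trans hy) T.lhat_lt_rhat.ne

variable (T) in
theorem closure_Jhat_subset {y : ℝ} (hy : y ∈ closure T.Jhat) : (y : EReal) ∈ Icc T.lhat T.rhat := by
  have h1 : IsClosed ((fun y : ℝ => (y : EReal)) ⁻¹' Icc T.lhat T.rhat) :=
    isClosed_Icc.preimage continuous_coe_real_ereal
  exact closure_minimal (fun y hy => hy.1) h1 hy

/-- For a real `y`, the equations force the endpoint to be finite, that is, approachable. So the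
Dirichlet conditions on `Ĵ` sit exactly at the approachable endpoints that do not reflect. -/
theorem mem_closure_diff_iff {y : ℝ} : y ∈ closure T.Jhat \ T.Jhat ↔
    ((y : EReal) = T.lhat ∧ ¬T.ReflectingLeft) ∨ ((y : EReal) = T.rhat ∧ ¬T.ReflectingRight) := by
  constructor
  · rintro ⟨h1, h2⟩
    have h3 := T.closure_Jhat_subset h1
    rcases h3.1.eq_or_lt with h4 | h4
    · exact Or.inl ⟨h4.symm, fun h => h2 ((mem_Jhat_of_eq_lhat h4.symm).2 h)⟩
    · rcases h3.2.eq_or_lt with h5 | h5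
      · exact Or.inr ⟨h5, fun h => h2 ((mem_Jhat_of_eq_rhat h5).2 h)⟩
      · exact absurd (core_subset_Jhat ⟨h4, h5⟩) h2
  · rintro (⟨h1, h2⟩ | ⟨h1, h2⟩)
    · refine ⟨?_, fun h => h2 ((mem_Jhat_of_eq_lhat h1).1 h)⟩
      obtain ⟨b, hb1, hb2⟩ := EReal.lt_iff_exists_real_btwn.1 (h1.trans_lt T.lhat_lt_rhat)
      have hb : y < b := EReal.coe_lt_coe_iff.1 hb1
      refine closure_mono (s := Ioo y b) (fun z hz => core_subset_Jhat ⟨?_, ?_⟩) ?_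
      · rw [← h1]; exact EReal.coe_lt_coe_iff.2 hz.1
      · exact (EReal.coe_lt_coe_iff.2 hz.2).trans hb2
      · rw [closure_Ioo hb.ne]; exact left_mem_Icc.2 hb.le
    · refine ⟨?_, fun h => h2 ((mem_Jhat_of_eq_rhat h1).1 h)⟩
      obtain ⟨b, hb1, hb2⟩ := EReal.lt_iff_exists_real_btwn.1 (T.lhat_lt_rhat.trans_eq h1.symm)
      have hb : b < y := EReal.coe_lt_coe_iff.1 hb2
      refine closure_mono (s := Ioo b y) (fun z hz => core_subset_Jhat ⟨?_, ?_⟩) ?_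
      · exact hb1.trans (EReal.coe_lt_coe_iff.2 hz.1)
      · rw [← h1]; exact EReal.coe_lt_coe_iff.2 hz.2
      · rw [closure_Ioo hb.ne]; exact right_mem_Icc.2 hb.le

variable (T) in
theorem finite_closure_diff : (closure T.Jhat \ T.Jhat).Finite := by
  refine (Set.toFinite {T.lhat.toReal, T.rhat.toReal}).subset fun y hy => ?_
  rcases mem_closure_diff_iff.1 hy with ⟨h, -⟩ | ⟨h, -⟩
  · exact Or.inl (by rw [← h, EReal.toReal_coe])
  · exact Or.inr (by rw [mem_singleton_iff, ← h, EReal.toReal_coe])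

variable (T) in
theorem isProperInterval_Jhat : IsProperInterval T.Jhat where
  ordConnected := by
    refine ⟨fun x hx y hy z hz => ?_⟩
    have h1 := EReal.coe_le_coe_iff.2 hz.1
    have h2 := EReal.coe_le_coe_iff.2 hz.2
    refine ⟨⟨hx.1.1.trans h1, h2.trans hy.1.2⟩, fun h => ?_, fun h => ?_⟩
    · have : x = z := le_antisymm hz.1 (EReal.coe_le_coe_iff.1 (h.trans_le hx.1.1))
      exact this ▸ hx.2.1 (this ▸ h)
    · have : z = y := le_antisymm hz.2 (EReal.coe_le_coe_iff.1 (hy.1.2.trans_eq h.symm))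
      exact this ▸ hy.2.2 (this ▸ h)
  interior_nonempty := by
    obtain ⟨b, hb1, hb2⟩ := EReal.lt_iff_exists_real_btwn.1 T.lhat_lt_rhat
    exact ⟨b, interior_maximal core_subset_Jhat T.isOpen_core ⟨hb1, hb2⟩⟩
  boundary_bounded := by
    obtain ⟨R, hR⟩ := T.finite_closure_diff.isBounded.exists_norm_le
    exact ⟨R, hR⟩

/-- `Ĵ` is its closure minus finitely many points, hence locally closed; this supplies the compact
exhaustion needed for smoothness. -/
theorem locallyCompactSpace_Jhat : LocallyCompactSpace T.Jhat := by
  have h1 : IsLocallyClosed T.Jhat := by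
    refine ⟨(closure T.Jhat \ T.Jhat)ᶜ, closure T.Jhat, T.finite_closure_diff.isClosed.isOpen_compl,
      isClosed_closure, ?_⟩
    ext y
    simp only [mem_inter_iff, mem_compl_iff, Set.mem_sdiff, not_and, not_not]
    exact ⟨fun h => ⟨fun _ => h, subset_closure h⟩, fun h => h.1 h.2⟩
  exact h1.locallyCompactSpace

variable (T) in
theorem range_inclusion : range T.inclusion = Subtype.val ⁻¹' T.Ihat := by
  ext y
  constructor
  · rintro ⟨z, rfl⟩
    exact z.2
  · intro hy
    exact ⟨⟨y, hy⟩, rfl⟩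

variable (T) in
theorem isClosed_range_inclusion : IsClosed (range T.inclusion) := by
  have h1 : range T.inclusion = (fun y : T.Jhat => ((y : ℝ) : EReal)) ⁻¹' T.IhatS := by
    rw [range_inclusion]
    ext y
    exact mem_Ihat_iff.trans (and_iff_right y.2)
  rw [h1]
  exact T.isClosed_IhatS.preimage (continuous_coe_real_ereal.comp continuous_subtype_val)

variable (T) in
theorem measurableSet_Ihat : MeasurableSet T.Ihat := by
  have h1 : T.Ihat = T.Jhat ∩ (fun y : ℝ => (y : EReal)) ⁻¹' T.IhatS := by
    ext y; exact mem_Ihat_iff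
  rw [h1]
  exact T.isProperInterval_Jhat.measurableSet.inter
    (T.isClosed_IhatS.preimage continuous_coe_real_ereal).measurableSet

variable (T) in
theorem measurableEmbedding_coe :
    MeasurableEmbedding fun y : T.Ihat => ((y : ℝ) : EReal) :=
  EReal.isOpenEmbedding_coe.measurableEmbedding.comp
    (MeasurableEmbedding.subtype_coe T.measurableSet_Ihat)

/-! ### The measure `𝔪̂` -/

variable (T) in
/-- The points of the extended line which the scale maps into `Î`. -/
def domIhat : Set EReal := T.sExt ⁻¹' range fun y : T.Ihat => ((y : ℝ) : EReal)

variable (T) in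
theorem measurableSet_domIhat : MeasurableSet T.domIhat :=
  T.sExt_mono.measurable T.measurableEmbedding_coe.measurableSet_range

variable (T) in
theorem map_mhat : T.mhat.map (fun y : T.Ihat => ((y : ℝ) : EReal)) =
    (T.m.restrict T.domIhat).map T.sExt := by
  rw [mhat, T.measurableEmbedding_coe.map_comap,
    Measure.restrict_map T.sExt_mono.measurable T.measurableEmbedding_coe.measurableSet_range,
    domIhat]

theorem mhat_preimage {V : Set EReal} (hV : MeasurableSet V) :
    T.mhat ((fun y : T.Ihat => ((y : ℝ) : EReal)) ⁻¹' V) = T.m (T.sExt ⁻¹' V ∩ T.domIhat) := by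
  rw [← Measure.map_apply T.measurableEmbedding_coe.measurable hV, T.map_mhat,
    Measure.map_apply T.sExt_mono.measurable hV,
    Measure.restrict_apply (T.sExt_mono.measurable hV)]

theorem exists_measure_Iic_lt_top (h : T.ReflectingLeft) {b : EReal} (hb : b < T.r) :
    T.m (Iic b) < ∞ := by
  obtain ⟨-, ⟨b₀, hb₀, h1⟩, h2⟩ := h
  obtain ⟨c, hc1, hc2⟩ := exists_between hb₀
  have hsub : Iic b ⊆ (Icc T.l T.r)ᶜ ∪ {T.l} ∪ Ioo T.l b₀ ∪ Icc c b := by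
    intro x hx
    rcases lt_trichotomy x T.l with h3 | h3 | h3
    · exact Or.inl (Or.inl (Or.inl fun h => absurd h.1 (not_le.2 h3)))
    · exact Or.inl (Or.inl (Or.inr h3))
    · rcases lt_or_ge x b₀ with h4 | h4
      · exact Or.inl (Or.inr ⟨h3, h4⟩)
      · exact Or.inr ⟨hc2.le.trans h4, hx⟩
  refine (measure_mono hsub).trans_lt ?_
  refine (measure_union_le _ _).trans_lt (ENNReal.add_lt_top.2 ⟨?_, T.m_radon c b hc1 hb⟩)
  refine (measure_union_le _ _).trans_lt (ENNReal.add_lt_top.2 ⟨?_, h1⟩)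
  refine (measure_union_le _ _).trans_lt (ENNReal.add_lt_top.2 ⟨?_, h2⟩)
  rw [T.m_compl]; exact ENNReal.zero_lt_top

theorem exists_measure_Ici_lt_top (h : T.ReflectingRight) {a : EReal} (ha : T.l < a) :
    T.m (Ici a) < ∞ := by
  obtain ⟨-, ⟨b₀, hb₀, h1⟩, h2⟩ := h
  obtain ⟨c, hc1, hc2⟩ := exists_between hb₀
  have hsub : Ici a ⊆ (Icc T.l T.r)ᶜ ∪ {T.r} ∪ Ioo b₀ T.r ∪ Icc a c := by
    intro x hx
    rcases lt_trichotomy T.r x with h3 | h3 | h3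
    · exact Or.inl (Or.inl (Or.inl fun h => absurd h.2 (not_le.2 h3)))
    · exact Or.inl (Or.inl (Or.inr h3.symm))
    · rcases lt_or_ge b₀ x with h4 | h4
      · exact Or.inl (Or.inr ⟨h4, h3⟩)
      · exact Or.inr ⟨hx, h4.trans hc1.le⟩
  refine (measure_mono hsub).trans_lt ?_
  refine (measure_union_le _ _).trans_lt (ENNReal.add_lt_top.2 ⟨?_, T.m_radon a c ha hc2⟩)
  refine (measure_union_le _ _).trans_lt (ENNReal.add_lt_top.2 ⟨?_, h1⟩)
  refine (measure_union_le _ _).trans_lt (ENNReal.add_lt_top.2 ⟨?_, h2⟩)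
  rw [T.m_compl]; exact ENNReal.zero_lt_top

variable (T) in
theorem isEmbedding_inclusion : IsEmbedding T.inclusion := IsEmbedding.inclusion T.Ihat_subset_Jhat

-- A point strictly between `l̂` and `r̂` has a neighbourhood whose preimage lies in some `[a, b]`
-- inside `(l, r)`, where `𝔪` is finite. An endpoint belongs to `Ĵ` only if it reflects, and then
-- `𝔪` is finite all the way up to it.
variable (T) in
theorem isLocallyFiniteMeasure_map_mhat : IsLocallyFiniteMeasure (T.mhat.map T.inclusion) := by
  refine ⟨fun y => ?_⟩
  have hcont : Continuous fun y : T.Jhat => ((y : ℝ) : EReal) :=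
    continuous_coe_real_ereal.comp continuous_subtype_val
  have key : ∀ V : Set EReal, IsOpen V → ((y : ℝ) : EReal) ∈ V → T.m (T.sExt ⁻¹' V) < ∞ →
      (T.mhat.map T.inclusion).FiniteAtFilter (𝓝 y) := by
    intro V hV hy hfin
    refine ⟨(fun y : T.Jhat => ((y : ℝ) : EReal)) ⁻¹' V, (hV.preimage hcont).mem_nhds hy, ?_⟩
    rw [Measure.map_apply T.isEmbedding_inclusion.continuous.measurable
      (hV.preimage hcont).measurableSet]
    refine lt_of_le_of_lt ?_ hfin
    exact (mhat_preimage hV.measurableSet).trans_le (measure_mono inter_subset_left)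
  rcases y.2.1.1.eq_or_lt with hl | hl
  · obtain ⟨b, hb, hyb⟩ := exists_lt_sExt (hl.symm.trans_lt T.lhat_lt_rhat)
    refine key (Iio (T.sExt b)) isOpen_Iio hyb (lt_of_le_of_lt (measure_mono fun x hx => ?_)
      (exists_measure_Iic_lt_top ((mem_Jhat_of_eq_lhat hl.symm).1 y.2) hb.2))
    exact (T.sExt_mono.reflect_lt hx).le
  obtain ⟨a, ha, hya⟩ := exists_sExt_lt hl
  rcases y.2.1.2.eq_or_lt with hr | hr
  · refine key (Ioi (T.sExt a)) isOpen_Ioi hya (lt_of_le_of_lt (measure_mono fun x hx => ?_)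
      (exists_measure_Ici_lt_top ((mem_Jhat_of_eq_rhat hr).1 y.2) ha.1))
    exact (T.sExt_mono.reflect_lt hx).le
  · obtain ⟨b, hb, hyb⟩ := exists_lt_sExt hr
    refine key (Ioo (T.sExt a) (T.sExt b)) isOpen_Ioo ⟨hya, hyb⟩
      (lt_of_le_of_lt (measure_mono fun x hx => ?_) (T.m_radon a b ha.1 hb.2))
    exact ⟨(T.sExt_mono.reflect_lt hx.1).le, (T.sExt_mono.reflect_lt hx.2).le⟩

-- No nonempty set has capacity zero, so only an exhaustion is required. A compact exhaustion has
-- finite measure by local finiteness and eventually swallows every compact set, leaving the empty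
-- set.
variable (T) in
theorem isSmooth : (brownianForm T.Jhat).IsSmooth (T.mhat.map T.inclusion) := by
  have hJ := T.isProperInterval_Jhat
  have := T.isLocallyFiniteMeasure_map_mhat
  have := locallyCompactSpace_Jhat (T := T)
  refine ⟨fun A hA => by rw [hJ.cap_eq_zero_iff.1 hA, measure_empty], ?_⟩
  let K : CompactExhaustion T.Jhat := CompactExhaustion.choice _
  refine ⟨K, fun m n h => K.subset h, fun n => (K.isCompact n).isClosed,
    fun n => (K.isCompact n).measure_lt_top, fun L hL => ?_⟩
  obtain ⟨n, hn⟩ := K.exists_superset_of_isCompact hL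
  refine tendsto_const_nhds.congr' ?_
  filter_upwards [eventually_ge_atTop n] with k hk
  rw [sdiff_eq_empty.2 (hn.trans (K.subset hk)), hJ.cap_empty]

/-! ### The support of `𝔪̂` -/

variable (T) in
/-- `U \ {l, r}`. -/
def openU : Set EReal := T.U \ {T.l, T.r}

theorem openU_subset : T.openU ⊆ Ioo T.l T.r := fun _ hx =>
  ⟨hx.1.1.1.lt_of_ne fun h => hx.2 (Or.inl h.symm), hx.1.1.2.lt_of_ne fun h => hx.2 (Or.inr h)⟩

theorem mem_openU_iff {x : EReal} (hx : x ∈ Ioo T.l T.r) :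
    x ∈ T.openU ↔ ∀ᶠ y in 𝓝 x, T.sExt y = T.sExt x := by
  constructor
  · rintro ⟨⟨-, V, hV, c, hc⟩, -⟩
    have hxc : T.sExt x = c := hc x ⟨mem_of_mem_nhds hV, Ioo_subset_Icc_self hx⟩
    filter_upwards [hV, Ioo_mem_nhds hx.1 hx.2] with y hy hy'
    rw [hxc, hc y ⟨hy, Ioo_subset_Icc_self hy'⟩]
  · intro h
    refine ⟨⟨Ioo_subset_Icc_self hx, _, h, T.sExt x, fun y hy => hy.1⟩, ?_⟩
    rintro (h' | h')
    · exact hx.1.ne' h'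
    · exact hx.2.ne h'

variable (T) in
theorem isOpen_openU : IsOpen T.openU := by
  rw [isOpen_iff_mem_nhds]
  intro x hx
  have hxI := openU_subset hx
  filter_upwards [((mem_openU_iff hxI).1 hx).eventually_nhds, Ioo_mem_nhds hxI.1 hxI.2] with y hy hyI
  refine (mem_openU_iff hyI).2 ?_
  filter_upwards [hy] with z hz
  rw [hz, hy.self_of_nhds]

/-- A point of an open set of extended reals which is bounded on both sides by points outside of
the set lies in a maximal interval contained in it. -/
theorem exists_maximal_Ioo {W : Set EReal} (hW : IsOpen W) {a b x : EReal} (ha : a ∉ W) (hb : b ∉ W)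
    (hx : x ∈ W) (hax : a ≤ x) (hxb : x ≤ b) :
    ∃ c d, x ∈ Ioo c d ∧ Ioo c d ⊆ W ∧ c ∉ W ∧ d ∉ W := by
  have h1 : IsClosed (Iic x ∩ Wᶜ) := isClosed_Iic.inter hW.isClosed_compl
  have h2 : IsClosed (Ici x ∩ Wᶜ) := isClosed_Ici.inter hW.isClosed_compl
  have h3 : sSup (Iic x ∩ Wᶜ) ∈ Iic x ∩ Wᶜ := h1.sSup_mem ⟨a, hax, ha⟩
  have h4 : sInf (Ici x ∩ Wᶜ) ∈ Ici x ∩ Wᶜ := h2.sInf_mem ⟨b, hxb, hb⟩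
  have h5 : ∀ {t}, t ∉ W → t ≠ x := fun ht h => ht (h ▸ hx)
  refine ⟨_, _, ⟨lt_of_le_of_ne h3.1 (h5 h3.2), lt_of_le_of_ne h4.1 (h5 h4.2).symm⟩,
    fun y hy => ?_, h3.2, h4.2⟩
  by_contra hc
  rcases le_total y x with h | h
  · exact absurd (le_sSup (show y ∈ Iic x ∩ Wᶜ from ⟨h, hc⟩)) (not_le.2 hy.1)
  · exact absurd (sInf_le (show y ∈ Ici x ∩ Wᶜ from ⟨h, hc⟩)) (not_le.2 hy.2)

theorem exists_isComponent {x : EReal} (hx : x ∈ T.openU) :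
    ∃ c d, x ∈ Ioo c d ∧ T.IsComponent c d := by
  obtain ⟨c, d, h1, h2, h3, h4⟩ := exists_maximal_Ioo T.isOpen_openU
    (fun h => (openU_subset h).1.ne rfl) (fun h => (openU_subset h).2.ne rfl) hx
    (openU_subset hx).1.le (openU_subset hx).2.le
  exact ⟨c, d, h1, h1.1.trans h1.2, h2, h3, h4⟩

theorem IsComponent.sExt_eq {c d x y : EReal} (h : T.IsComponent c d) (hx : x ∈ Ioo c d)
    (hy : y ∈ Ioo c d) : T.sExt x = T.sExt y := by
  refine isPreconnected_Ioo.induction₂ (fun x y => T.sExt x = T.sExt y) (fun z hz => ?_)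
    (fun _ _ _ _ _ _ h1 h2 => h1.trans h2) (fun _ _ _ _ h => h.symm) hx hy
  have hz' : z ∈ T.openU := h.2.1 hz
  exact mem_nhdsWithin_of_mem_nhds (((mem_openU_iff (openU_subset hz')).1 hz').mono
    fun t ht => ht.symm)

theorem IsComponent.mem_Icc {c d : EReal} (h : T.IsComponent c d) :
    c ∈ Icc T.l T.r ∧ d ∈ Icc T.l T.r := by
  obtain ⟨x, hx⟩ := exists_between h.1
  have hs : Ioo c d ⊆ Ioo T.l T.r := fun y hy => openU_subset (h.2.1 hy)
  have h1 := (Ioo_subset_Ioo_iff h.1).1 hs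
  exact ⟨⟨h1.1, h.1.le.trans h1.2⟩, ⟨h1.1.trans h.1.le, h1.2⟩⟩

theorem IsComponent.sRight_eq {c d x : EReal} (h : T.IsComponent c d) (hx : x ∈ Ioo c d) :
    T.sRight c = T.sExt x := by
  have : (𝓝[>] c).NeBot := nhdsGT_neBot_of_exists_gt ⟨d, h.1⟩
  refine tendsto_nhds_unique (T.sExt_mono.tendsto_rightLim c) (tendsto_const_nhds.congr' ?_)
  filter_upwards [Ioo_mem_nhdsGT h.1] with z hz using h.sExt_eq hx hz

theorem IsComponent.sLeft_eq {c d x : EReal} (h : T.IsComponent c d) (hx : x ∈ Ioo c d) :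
    T.sLeft d = T.sExt x := by
  have : (𝓝[<] d).NeBot := nhdsLT_neBot_of_exists_lt ⟨c, h.1⟩
  refine tendsto_nhds_unique (T.sExt_mono.tendsto_leftLim d) (tendsto_const_nhds.congr' ?_)
  filter_upwards [Ioo_mem_nhdsLT h.1] with z hz using h.sExt_eq hx hz

theorem continuousAt_sExt {x : EReal} (hx : x ∈ Icc T.l T.r) (hD : x ∉ T.D) :
    ContinuousAt T.sExt x := by
  rw [T.sExt_mono.continuousAt_iff_leftLim_eq_rightLim]
  have h1 : T.sExt x = T.sRight x := by
    by_contra h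
    exact hD (Or.inl ⟨hx, h⟩)
  have h2 : T.sExt x = T.sLeft x := by
    by_contra h
    exact hD (Or.inr ⟨hx, h⟩)
  exact h2.symm.trans h1

theorem measure_pos_of_notMem_U (hDM : T.DM) {x : EReal} (hx : x ∈ Icc T.l T.r) (hU : x ∉ T.U)
    {S : Set EReal} (hS : S ∈ 𝓝 x) : 0 < T.m S :=
  (Measure.mem_support_iff_forall x).1 (hDM.support ⟨hx, hU⟩) S hS

/-- If an end of the component is outside `D ∪ {l, r}`, the scale is continuous there with the
constant value of the component, and the end lies outside `U`, hence in the support of `𝔪`.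
Otherwise the component is isolated, and (DM) gives mass to it together with those ends at which the
scale still has that value. -/
theorem measure_pos_of_isComponent (hDM : T.DM) {c d x : EReal} (h : T.IsComponent c d)
    (hx : x ∈ Ioo c d) {V : Set EReal} (hV : V ∈ 𝓝 (T.sExt x)) : 0 < T.m (T.sExt ⁻¹' V) := by
  obtain ⟨hc, hd⟩ := h.mem_Icc
  by_cases hcD : c ∈ T.D ∪ {T.l, T.r}
  · by_cases hdD : d ∈ T.D ∪ {T.l, T.r}
    · refine (hDM.isolated_interval c d ⟨h, hcD, hdD⟩).trans_le (measure_mono ?_)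
      have hxV := mem_of_mem_nhds hV
      rintro y ((hy | ⟨rfl, hy⟩) | ⟨rfl, hy⟩)
      · rw [mem_preimage, h.sExt_eq hy hx]; exact hxV
      · have : T.sExt y = T.sRight y := by
          by_contra h'
          exact hy ⟨hc, h'⟩
        rw [mem_preimage, this, h.sRight_eq hx]; exact hxV
      · have : T.sExt y = T.sLeft y := by
          by_contra h'
          exact hy ⟨hd, h'⟩
        rw [mem_preimage, this, h.sLeft_eq hx]; exact hxV
    · rw [mem_union, not_or] at hdD
      have hcont := continuousAt_sExt hd hdD.1
      have hU : d ∉ T.U := fun hU => h.2.2.2 ⟨hU, hdD.2⟩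
      refine measure_pos_of_notMem_U hDM hd hU (hcont.preimage_mem_nhds ?_)
      rwa [← hcont.continuousWithinAt.leftLim_eq, show Function.leftLim T.sExt d = T.sExt x from
        h.sLeft_eq hx]
  · rw [mem_union, not_or] at hcD
    have hcont := continuousAt_sExt hc hcD.1
    have hU : c ∉ T.U := fun hU => h.2.2.1 ⟨hU, hcD.2⟩
    refine measure_pos_of_notMem_U hDM hc hU (hcont.preimage_mem_nhds ?_)
    rwa [← hcont.continuousWithinAt.rightLim_eq, show Function.rightLim T.sExt c = T.sExt x from
      h.sRight_eq hx]

theorem measure_pos_of_mem_openU (hDM : T.DM) {x : EReal} (hx : x ∈ T.openU) {V : Set EReal}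
    (hV : V ∈ 𝓝 (T.sExt x)) : 0 < T.m (T.sExt ⁻¹' V) := by
  obtain ⟨c, d, h1, h2⟩ := exists_isComponent hx
  exact measure_pos_of_isComponent hDM h2 h1 hV

/-- Points `z` slightly left of `x` have values near `𝐬(x-)`. Such a `z` lies either in a component
of constancy or in the support of `𝔪`, and both yield mass. -/
theorem measure_pos_of_sLeft (hDM : T.DM) {x : EReal} (hx : x ∈ Ioo T.l T.r)
    {V : Set EReal} (hV : V ∈ 𝓝 (T.sLeft x)) : 0 < T.m (T.sExt ⁻¹' V) := by
  obtain ⟨V', hV'V, hV'o, hxV'⟩ := mem_nhds_iff.1 hV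
  have h1 : ∀ᶠ z in 𝓝[<] x, T.sExt z ∈ V' := T.sExt_mono.tendsto_leftLim x (hV'o.mem_nhds hxV')
  obtain ⟨t, ht, htV⟩ := (mem_nhdsLT_iff_exists_Ioo_subset' hx.1).1 h1
  have hlt : max t T.l < x := max_lt ht hx.1
  obtain ⟨z, hz1, hz2⟩ := exists_between hlt
  have hzl : T.l < z := (le_max_right _ _).trans_lt hz1
  have hzt : t < z := (le_max_left _ _).trans_lt hz1
  have hzI : z ∈ Icc T.l T.r := ⟨hzl.le, (hz2.trans hx.2).le⟩
  have hzV : T.sExt z ∈ V' := htV ⟨hzt, hz2⟩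
  by_cases hU : z ∈ T.U
  · have hzU : z ∈ T.openU := ⟨hU, by
      rintro (h | h)
      · exact hzl.ne' h
      · exact (hz2.trans hx.2).ne h⟩
    exact measure_pos_of_mem_openU hDM hzU (mem_of_superset (hV'o.mem_nhds hzV) hV'V)
  · exact measure_pos_of_notMem_U hDM hzI hU
      (mem_of_superset (Ioo_mem_nhds hzt hz2) fun y hy => hV'V (htV hy))

theorem measure_pos_of_sRight (hDM : T.DM) {x : EReal} (hx : x ∈ Ioo T.l T.r)
    {V : Set EReal} (hV : V ∈ 𝓝 (T.sRight x)) : 0 < T.m (T.sExt ⁻¹' V) := by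
  obtain ⟨V', hV'V, hV'o, hxV'⟩ := mem_nhds_iff.1 hV
  have h1 : ∀ᶠ z in 𝓝[>] x, T.sExt z ∈ V' := T.sExt_mono.tendsto_rightLim x (hV'o.mem_nhds hxV')
  obtain ⟨t, ht, htV⟩ := (mem_nhdsGT_iff_exists_Ioo_subset' hx.2).1 h1
  have hlt : x < min t T.r := lt_min ht hx.2
  obtain ⟨z, hz1, hz2⟩ := exists_between hlt
  have hzr : z < T.r := hz2.trans_le (min_le_right _ _)
  have hzt : z < t := hz2.trans_le (min_le_left _ _)
  have hzI : z ∈ Icc T.l T.r := ⟨(hx.1.trans hz1).le, hzr.le⟩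
  have hzV : T.sExt z ∈ V' := htV ⟨hz1, hzt⟩
  by_cases hU : z ∈ T.U
  · have hzU : z ∈ T.openU := ⟨hU, by
      rintro (h | h)
      · exact (hx.1.trans hz1).ne' h
      · exact hzr.ne h⟩
    exact measure_pos_of_mem_openU hDM hzU (mem_of_superset (hV'o.mem_nhds hzV) hV'V)
  · exact measure_pos_of_notMem_U hDM hzI hU
      (mem_of_superset (Ioo_mem_nhds hz1 hzt) fun y hy => hV'V (htV hy))

theorem measure_pos_of_sExt (hDM : T.DM) {x : EReal} (hx : x ∈ Icc T.l T.r)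
    {V : Set EReal} (hV : V ∈ 𝓝 (T.sExt x)) : 0 < T.m (T.sExt ⁻¹' V) := by
  by_cases hp : x ∈ T.Dplus
  · by_cases hm : x ∈ T.Dminus
    · refine (hDM.isolated_point x ⟨hp, hm⟩).trans_le (measure_mono ?_)
      rintro y rfl
      exact mem_of_mem_nhds (x := T.sExt y) hV
    · have : T.sExt x = T.sLeft x := by
        by_contra h
        exact hm ⟨hx, h⟩
      exact measure_pos_of_sLeft hDM (mem_Ioo_of_mem_Dplus hp) (this ▸ hV)
  · by_cases hm : x ∈ T.Dminus
    · have : T.sExt x = T.sRight x := by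
        by_contra h
        exact hp ⟨hx, h⟩
      exact measure_pos_of_sRight hDM (mem_Ioo_of_mem_Dminus hm) (this ▸ hV)
    · have hcont := continuousAt_sExt hx (fun h => h.elim hp hm)
      by_cases hU : x ∈ T.U
      · obtain ⟨V', hV'V, hV'o, hxV'⟩ := mem_nhds_iff.1 (hcont.preimage_mem_nhds hV)
        obtain ⟨N, hN, k, hk⟩ := hU.2
        have hxk : T.sExt x = k := hk x ⟨mem_of_mem_nhds hN, hx⟩
        -- `x` may be an endpoint of `I`, and components avoid these; an interior point near `x` has
        -- the same value of the scale.
        obtain ⟨z, hzN, hz⟩ : ∃ z ∈ interior N, z ∈ Ioo T.l T.r := by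
          have hxc : x ∈ closure (Ioo T.l T.r) := by
            rw [closure_Ioo T.l_lt_r.ne]; exact hx
          exact mem_closure_iff.1 hxc _ isOpen_interior (mem_interior_iff_mem_nhds.2 hN)
        have hzk : T.sExt z = k := hk z ⟨interior_subset hzN, Ioo_subset_Icc_self hz⟩
        have hzU : z ∈ T.openU := by
          refine (mem_openU_iff hz).2 ?_
          filter_upwards [isOpen_interior.mem_nhds hzN, Ioo_mem_nhds hz.1 hz.2] with y hy hyI
          rw [hzk, hk y ⟨interior_subset hy, Ioo_subset_Icc_self hyI⟩]
        refine measure_pos_of_mem_openU hDM hzU ?_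
        rwa [hzk, ← hxk]
      · exact measure_pos_of_notMem_U hDM hx hU (hcont.preimage_mem_nhds hV)

/-- `𝔪̂` has full support. -/
theorem mhat_pos (hDM : T.DM) (y : T.Ihat) {G : Set ℝ} (hG : G ∈ 𝓝 (y : ℝ)) :
    0 < T.mhat (Subtype.val ⁻¹' G) := by
  obtain ⟨G', hG'G, hG'o, hyG'⟩ := mem_nhds_iff.1 hG
  have hemb : IsOpenEmbedding ((↑) : ℝ → EReal) := EReal.isOpenEmbedding_coe
  have hVo : IsOpen (((↑) : ℝ → EReal) '' G') := hemb.isOpenMap _ hG'o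
  -- `𝔪̂` ignores mass that the scale sends to an excluded endpoint, so such values are removed from
  -- the neighbourhood. Since `y ∈ Î` is not one of them, `V` remains a neighbourhood of `y`.
  set V : Set EReal := ((↑) : ℝ → EReal) '' G' ∩ {z | z = T.lhat → T.ReflectingLeft} ∩
    {z | z = T.rhat → T.ReflectingRight} with hVdef
  have hne : ∀ (a : EReal) (p : Prop), (((y : ℝ) : EReal) = a → p) →
      {z : EReal | z = a → p} ∈ 𝓝 ((y : ℝ) : EReal) := by
    intro a p h
    by_cases hya : ((y : ℝ) : EReal) = a
    · exact univ_mem' fun _ _ => h hya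
    · exact mem_of_superset (isOpen_ne.mem_nhds hya) fun z hz h' => absurd h' hz
  have hV : V ∈ 𝓝 ((y : ℝ) : EReal) :=
    inter_mem (inter_mem (hVo.mem_nhds ⟨y, hyG', rfl⟩) (hne _ _ y.2.2.1)) (hne _ _ y.2.2.2)
  have hpos : 0 < T.m (T.sExt ⁻¹' V) := by
    rcases y.2.1 with (⟨x, hx, hxy⟩ | ⟨x, hx, hxy⟩) | ⟨x, hx, hxy⟩
    · exact measure_pos_of_sExt hDM hx (hxy.symm ▸ hV)
    · exact measure_pos_of_sLeft hDM (mem_Ioo_of_mem_Dminus hx) (hxy.symm ▸ hV)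
    · exact measure_pos_of_sRight hDM (mem_Ioo_of_mem_Dplus hx) (hxy.symm ▸ hV)
  have hpre : Subtype.val ⁻¹' G' = (fun y : T.Ihat => ((y : ℝ) : EReal)) ⁻¹'
      (((↑) : ℝ → EReal) '' G') := by
    ext z
    exact ⟨fun h => ⟨z, h, rfl⟩, fun ⟨t, ht, h⟩ => by rwa [EReal.coe_injective h] at ht⟩
  refine lt_of_lt_of_le ?_ (measure_mono (preimage_mono hG'G))
  rw [hpre, mhat_preimage hVo.measurableSet]
  refine hpos.trans_le ?_
  have hae : T.sExt ⁻¹' V ≤ᵐ[T.m] (T.sExt ⁻¹' (((↑) : ℝ → EReal) '' G') ∩ T.domIhat : Set EReal) := by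
    have hI : ∀ᵐ x ∂T.m, x ∈ Icc T.l T.r := T.m_compl
    filter_upwards [hI] with x hx hxV
    obtain ⟨⟨h1, h2⟩, h3⟩ : (T.sExt x ∈ ((↑) : ℝ → EReal) '' G' ∧ _) ∧ _ := hxV
    refine ⟨h1, ?_⟩
    obtain ⟨t, -, ht⟩ := h1
    refine ⟨⟨t, ?_, ?_, ?_⟩, ht⟩
    · rw [ht]; exact Or.inl (Or.inl ⟨x, hx, rfl⟩)
    · rw [ht]; exact h2
    · rw [ht]; exact h3
  exact measure_mono_ae hae

/-- Quasi-closed means closed and capacity zero means empty, so this is the topological support: a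
closed set carrying `𝔪̂` cannot miss a point of `Î`, all of whose neighbourhoods are charged. -/
theorem isQuasiSupport (hDM : T.DM) :
    (brownianForm T.Jhat).IsQuasiSupport (range T.inclusion) (T.mhat.map T.inclusion) := by
  have hJ := T.isProperInterval_Jhat
  have hm : Measurable T.inclusion := T.isEmbedding_inclusion.continuous.measurable
  refine ⟨hJ.quasiClosed_iff.2 T.isClosed_range_inclusion, ?_, fun S hS h0 => ?_⟩
  · rw [Measure.map_apply hm T.isClosed_range_inclusion.measurableSet.compl]
    simp
  · rw [hJ.quasiClosed_iff] at hS
    rw [hJ.cap_eq_zero_iff, sdiff_eq_empty]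
    rintro _ ⟨y, rfl⟩
    by_contra hy
    rw [Measure.map_apply hm hS.measurableSet.compl] at h0
    obtain ⟨G, hG, hGS⟩ := isOpen_induced_iff.1 hS.isOpen_compl
    have hyG : (y : ℝ) ∈ G := by
      have : T.inclusion y ∈ Subtype.val ⁻¹' G := by rw [hGS]; exact hy
      exact this
    have h1 := mhat_pos hDM y (hG.mem_nhds hyG)
    rw [← hGS] at h0
    exact h1.ne' h0

theorem eq_of_ae_eq_mhat (hDM : T.DM) {F G : ℝ → ℝ} (hF : Continuous F) (hG : Continuous G)
    (h : ∀ᵐ y : T.Ihat ∂T.mhat, F y = G y) : EqOn F G T.Ihat := by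
  intro y hy
  by_contra hne
  have h1 := mhat_pos hDM ⟨y, hy⟩ ((isOpen_ne_fun hF hG).mem_nhds hne)
  exact h1.ne' h

end ScaleTriple
end

noncomputable section

namespace ScaleTriple

variable {T : ScaleTriple}

/-! ### Functions on `I` and functions on `Ĵ` -/

theorem coe_lhat (h : T.ApproachableLeft) : (T.lhat.toReal : EReal) = T.lhat :=
  EReal.coe_toReal (ne_top_of_lt T.lhat_lt_rhat) h.ne'

theorem coe_rhat (h : T.ApproachableRight) : (T.rhat.toReal : EReal) = T.rhat :=
  EReal.coe_toReal h.ne (ne_bot_of_gt T.lhat_lt_rhat)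

variable (T) in
theorem tendsto_sExt_l : Tendsto T.sExt (𝓝[Ioo T.l T.r] T.l) (𝓝 T.lhat) := by
  have h := T.sExt_mono.tendsto_rightLim T.l
  rw [show Function.rightLim T.sExt T.l = T.lhat from T.sRight_l] at h
  exact h.mono_left (nhdsWithin_mono _ fun x hx => hx.1)

variable (T) in
theorem tendsto_sExt_r : Tendsto T.sExt (𝓝[Ioo T.l T.r] T.r) (𝓝 T.rhat) := by
  have h := T.sExt_mono.tendsto_leftLim T.r
  rw [show Function.leftLim T.sExt T.r = T.rhat from T.sLeft_r] at h
  exact h.mono_left (nhdsWithin_mono _ fun x hx => hx.2)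

variable (T) in
theorem neBot_l : (𝓝[Ioo T.l T.r] T.l).NeBot := by
  rw [← mem_closure_iff_nhdsWithin_neBot, closure_Ioo T.l_lt_r.ne]
  exact left_mem_Icc.2 T.l_lt_r.le

variable (T) in
theorem neBot_r : (𝓝[Ioo T.l T.r] T.r).NeBot := by
  rw [← mem_closure_iff_nhdsWithin_neBot, closure_Ioo T.l_lt_r.ne]
  exact right_mem_Icc.2 T.l_lt_r.le

theorem l_mem_I0_iff : T.l ∈ T.I0 ↔ T.ReflectingLeft :=
  ⟨fun h => h.2.1 rfl, fun h => ⟨left_mem_Icc.2 T.l_lt_r.le, fun _ => h,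
    fun h' => absurd h' T.l_lt_r.ne⟩⟩

theorem r_mem_I0_iff : T.r ∈ T.I0 ↔ T.ReflectingRight :=
  ⟨fun h => h.2.2 rfl, fun h => ⟨right_mem_Icc.2 T.l_lt_r.le, fun h' => absurd h' T.l_lt_r.ne',
    fun _ => h⟩⟩

theorem Ioo_subset_I0 : Ioo T.l T.r ⊆ T.I0 := fun _ hx =>
  ⟨Ioo_subset_Icc_self hx, fun h => absurd h hx.1.ne', fun h => absurd h hx.2.ne⟩

theorem cases_of_mem_Icc {x : EReal} (hx : x ∈ Icc T.l T.r) :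
    x ∈ Ioo T.l T.r ∨ x = T.l ∨ x = T.r := by
  rcases hx.1.eq_or_lt with h | h
  · exact Or.inr (Or.inl h.symm)
  rcases hx.2.eq_or_lt with h' | h'
  · exact Or.inr (Or.inr h')
  · exact Or.inl ⟨h, h'⟩

variable (T) in
theorem measurableSet_I0 : MeasurableSet T.I0 := by
  have key : ∀ (a : EReal) (p : Prop), MeasurableSet {x : EReal | x = a → p} := fun a p => by
    by_cases hp : p
    · simp [hp]
    · have h : {x : EReal | x = a → p} = {a}ᶜ := by ext x; simp [hp]
      rw [h]
      exact (measurableSet_singleton a).compl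
  exact measurableSet_Icc.inter ((key _ _).inter (key _ _))

/-- The scale maps `I₀` into `Î` and the set of excluded endpoints of `Ĵ`. -/
theorem sExt_mem_of_mem_I0 {x : EReal} (hx : x ∈ T.I0) :
    ((T.sExt x).toReal : EReal) = T.sExt x ∧
      ((T.sExt x).toReal ∈ T.Ihat ∨ (T.sExt x).toReal ∈ closure T.Jhat \ T.Jhat) := by
  have h1 : ((T.sExt x).toReal : EReal) = T.sExt x := by
    rcases cases_of_mem_Icc hx.1 with h | h | h
    · exact coe_sExt h
    · rw [h, sExt_of_le le_rfl, coe_lhat (hx.2.1 h).1]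
    · rw [h, sExt_of_ge le_rfl, coe_rhat (hx.2.2 h).1]
  refine ⟨h1, ?_⟩
  rw [mem_closure_diff_iff]
  by_cases hl : ((T.sExt x).toReal : EReal) = T.lhat → T.ReflectingLeft
  · by_cases hr : ((T.sExt x).toReal : EReal) = T.rhat → T.ReflectingRight
    · exact Or.inl ⟨by rw [h1]; exact Or.inl (Or.inl ⟨x, hx.1, rfl⟩), hl, hr⟩
    · exact Or.inr (Or.inr (Classical.not_imp.1 hr))
  · exact Or.inr (Or.inl (Classical.not_imp.1 hl))

/-- A continuous function on the image side is determined by its values on `Î`. -/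
theorem eq_zero_of_eqOn_Ihat {F w : ℝ → ℝ} (hF : IsDirichletPair T.Jhat F w)
    (h : ∀ y ∈ T.Ihat, F y = 0) {x : EReal} (hx : x ∈ Ioo T.l T.r) : F (T.sExt x).toReal = 0 :=
  -- Even for `x` in `(l, r)` the value `𝐬(x)` can be an excluded endpoint, when the scale is
  -- constant near `l` or `r`; the boundary condition covers this case.
  (sExt_mem_of_mem_I0 (Ioo_subset_I0 hx)).2.elim (h _) (hF.boundary _)

theorem MemS.left_eq {f : EReal → ℝ} {F : ℝ → ℝ} (hf : T.MemS f) (hF : T.Corresponds f F)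
    (h : T.ApproachableLeft) : f T.l = F T.lhat.toReal := by
  have := T.neBot_l
  exact tendsto_nhds_unique (hf.left h)
    (hF.tendsto eventually_mem_nhdsWithin (coe_lhat h) T.tendsto_sExt_l)

theorem MemS.right_eq {f : EReal → ℝ} {F : ℝ → ℝ} (hf : T.MemS f) (hF : T.Corresponds f F)
    (h : T.ApproachableRight) : f T.r = F T.rhat.toReal := by
  have := T.neBot_r
  exact tendsto_nhds_unique (hf.right h)
    (hF.tendsto eventually_mem_nhdsWithin (coe_rhat h) T.tendsto_sExt_r)

theorem MemS.eq_of_mem_I0 {f : EReal → ℝ} {F : ℝ → ℝ} (hf : T.MemS f) (hF : T.Corresponds f F)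
    {x : EReal} (hx : x ∈ T.I0) : f x = F (T.sExt x).toReal := by
  rcases cases_of_mem_Icc hx.1 with h | h | h
  · exact hF.eq x h
  · rw [h, hf.left_eq hF (hx.2.1 h).1, sExt_of_le le_rfl]
  · rw [h, hf.right_eq hF (hx.2.2 h).1, sExt_of_ge le_rfl]

/-- A point of `Î` may arise both as a value and as a one-sided limit of the scale, at different
points of `I`. All prescriptions for `f̂` there are read off from the one continuous function `F`,
so they are consistent and determine `f̂`. -/
theorem MemS.isImage_iff {f : EReal → ℝ} {F : ℝ → ℝ} (hf : T.MemS f) (hF : T.Corresponds f F)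
    {fhat : T.Ihat → ℝ} : T.IsImage f fhat ↔ ∀ y : T.Ihat, fhat y = F y := by
  constructor
  · intro h y
    rcases y.2.1 with (⟨x, hx, hxy⟩ | ⟨x, hx, hxy⟩) | ⟨x, hx, hxy⟩
    · have hx0 : x ∈ T.I0 := by
        refine ⟨hx, fun h' => y.2.2.1 ?_, fun h' => y.2.2.2 ?_⟩
        · rw [← hxy, h', sExt_of_le le_rfl]
        · rw [← hxy, h', sExt_of_ge le_rfl]
      rw [h.at_point x hx0 y hxy.symm, hf.eq_of_mem_I0 hF hx0, hxy, EReal.toReal_coe]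
    · rw [h.at_left x hx y hxy.symm, hF.leftLim_eq (mem_Ioo_of_mem_Dminus hx), hxy,
        EReal.toReal_coe]
    · rw [h.at_right x hx y hxy.symm, hF.rightLim_eq (mem_Ioo_of_mem_Dplus hx), hxy,
        EReal.toReal_coe]
  · intro h
    refine ⟨fun x hx y hxy => ?_, fun x hx y hxy => ?_, fun x hx y hxy => ?_⟩
    · rw [h, hf.eq_of_mem_I0 hF hx, ← hxy, EReal.toReal_coe]
    · rw [h, hF.leftLim_eq (mem_Ioo_of_mem_Dminus hx), ← hxy, EReal.toReal_coe]
    · rw [h, hF.rightLim_eq (mem_Ioo_of_mem_Dplus hx), ← hxy, EReal.toReal_coe]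

/-- An excluded finite endpoint of `Ĵ` comes from an approachable endpoint outside `I₀`, where
membership in `𝓕` imposes the value zero; the lift inherits it by continuity. -/
theorem MemF.isDirichletPair {f : EReal → ℝ} (hf : T.MemF f) {p : Densities}
    (hp : T.HasDensities f p) : IsDirichletPair T.Jhat (T.lift p) (T.spread p) where
  toIsL2Primitive := hp.isL2Primitive
  support x hx := spread_of_notMem p fun h => hx (core_subset_Jhat h)
  boundary j hj := by
    rcases mem_closure_diff_iff.1 hj with ⟨h1, h2⟩ | ⟨h1, h2⟩
    · have h3 : T.ApproachableLeft := by
        rw [ApproachableLeft, ← h1]; exact EReal.bot_lt_coe j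
      have h4 := hf.memS.left_eq hp.corresponds h3
      rw [hf.left (fun h => h2 (l_mem_I0_iff.1 h)) h3, ← h1, EReal.toReal_coe] at h4
      exact h4.symm
    · have h3 : T.ApproachableRight := by
        rw [ApproachableRight, ← h1]; exact EReal.coe_lt_top j
      have h4 := hf.memS.right_eq hp.corresponds h3
      rw [hf.right (fun h => h2 (r_mem_I0_iff.1 h)) h3, ← h1, EReal.toReal_coe] at h4
      exact h4.symm

theorem Represents.ae_eq {f : EReal → ℝ} {φ : Lp ℝ 2 T.mhat} (h : T.Represents f φ)
    {p : Densities} (hp : T.HasDensities f p) : ∀ᵐ y ∂T.mhat, φ y = T.lift p y := by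
  obtain ⟨hf, fhat, himg, hae⟩ := h
  filter_upwards [hae] with y hy
  rw [hy, (hf.memS.isImage_iff hp.corresponds).1 himg y]

/-- The function `u ∘ 𝐬` belongs to `𝓕` if `u` is an element of the extended domain of the Brownian
form whose restriction to `Î` is square integrable. -/
theorem represents_comp {F w : ℝ → ℝ} (hF : IsDirichletPair T.Jhat F w) {φ : Lp ℝ 2 T.mhat}
    (hφ : ∀ᵐ y : T.Ihat ∂T.mhat, φ y = F y) :
    T.Represents (fun x => F (T.sExt x).toReal) φ := by
  have hcor : T.Corresponds (fun x => F (T.sExt x).toReal) F := ⟨hF.continuous, fun _ _ => rfl⟩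
  obtain ⟨q, hq, -⟩ := exists_hasDensities hF.toIsL2Primitive
    (f := fun x => F (T.sExt x).toReal) fun _ _ => rfl
  have hS : T.MemS fun x => F (T.sExt x).toReal := by
    refine ⟨⟨q, hq⟩, fun h => ?_, fun h => ?_⟩
    · rw [sExt_of_le le_rfl]
      exact hcor.tendsto eventually_mem_nhdsWithin (coe_lhat h) T.tendsto_sExt_l
    · rw [sExt_of_ge le_rfl]
      exact hcor.tendsto eventually_mem_nhdsWithin (coe_rhat h) T.tendsto_sExt_r
  have hmeas : Measurable fun z : EReal => F z.toReal :=
    hF.continuous.measurable.comp measurable_ereal_toReal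
  have hL1 : MemLp (fun y : T.Ihat => F y) 2 T.mhat := (Lp.memLp φ).ae_eq hφ
  have hL2 : MemLp (fun z : EReal => F z.toReal) 2
      (T.mhat.map fun y : T.Ihat => ((y : ℝ) : EReal)) := by
    rw [memLp_map_measure_iff hmeas.aestronglyMeasurable
      T.measurableEmbedding_coe.measurable.aemeasurable]
    exact hL1
  rw [T.map_mhat, memLp_map_measure_iff hmeas.aestronglyMeasurable
    T.sExt_mono.measurable.aemeasurable, ← memLp_indicator_iff_restrict T.measurableSet_domIhat]
    at hL2
  refine ⟨⟨hS, ?_, fun h1 h2 => ?_, fun h1 h2 => ?_⟩, fun y => F y,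
    (hS.isImage_iff hcor).2 fun _ => rfl, hφ⟩
  -- Square integrability is known only over the points mapped into `Î`. The other points of `I₀` go
  -- to excluded endpoints, where `F` vanishes.
  · refine (hL2.restrict T.I0).ae_eq ?_
    filter_upwards [ae_restrict_mem T.measurableSet_I0] with x hx
    by_cases hd : x ∈ T.domIhat
    · rw [indicator_of_mem hd]; rfl
    · rw [indicator_of_notMem hd]
      obtain ⟨h1, h2 | h2⟩ := sExt_mem_of_mem_I0 hx
      · exact absurd ⟨⟨_, h2⟩, h1⟩ hd
      · exact (hF.boundary _ h2).symm
  · simp only [sExt_of_le le_rfl]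
    exact hF.boundary _ (mem_closure_diff_iff.2
      (Or.inl ⟨coe_lhat h2, fun h => h1 (l_mem_I0_iff.2 h)⟩))
  · simp only [sExt_of_ge le_rfl]
    exact hF.boundary _ (mem_closure_diff_iff.2
      (Or.inr ⟨coe_rhat h2, fun h => h1 (r_mem_I0_iff.2 h)⟩))

/-! ### The trace form -/

theorem hasDensities_densities {f : EReal → ℝ} (hf : T.MemS f) :
    T.HasDensities f (T.densities f) := by
  have : Nonempty Densities := ⟨⟨0, 0, 0, 0⟩⟩
  exact Classical.epsilon_spec (p := T.HasDensities f) hf.exists_densities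

theorem represents_preimage {φ : Lp ℝ 2 T.mhat} (h : φ ∈ T.imageRegularization.dom) :
    T.Represents (T.preimage φ) φ :=
  Classical.epsilon_spec (p := fun f => T.Represents f φ) h

theorem energy_eq_integral {f g : EReal → ℝ} (hf : T.MemS f) (hg : T.MemS g) :
    T.energy f g = 1 / 2 * ∫ y, T.spread (T.densities f) y * T.spread (T.densities g) y := by
  rw [energy, integral_spread_mul_spread (hasDensities_densities hf) (hasDensities_densities hg)]

/-- Lifting densities leads from `𝓕` to pairs, and composing with the scale leads back. In view of
the description of the extended domain, the right-hand side is the trace domain. -/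
theorem mem_imageRegularization_dom_iff {φ : Lp ℝ 2 T.mhat} :
    φ ∈ T.imageRegularization.dom ↔ ∃ F w, IsDirichletPair T.Jhat F w ∧
      ∀ᵐ y : T.Ihat ∂T.mhat, φ y = F y := by
  constructor
  · rintro ⟨f, hf⟩
    obtain ⟨p, hp⟩ := hf.1.memS.exists_densities
    exact ⟨_, _, hf.1.isDirichletPair hp, hf.ae_eq hp⟩
  · rintro ⟨F, w, hF, hφ⟩
    exact ⟨_, represents_comp hF hφ⟩

/-- A quasi-continuous competitor vanishing quasi-everywhere on `Î` vanishes at every point of it,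
so its composition with the scale is zero on `(l, r)`; the lift is orthogonal to it. -/
theorem Represents.isHarmonicExtension {f : EReal → ℝ} {φ : Lp ℝ 2 T.mhat}
    (h : T.Represents f φ) {p : Densities} (hp : T.HasDensities f p) :
    (brownianForm T.Jhat).IsHarmonicExtension T.inclusion φ fun x => T.lift p x := by
  have hJ := T.isProperInterval_Jhat
  have hP := h.1.isDirichletPair hp
  refine ⟨hJ.memExtended_of_pair hP,
    hJ.quasiContinuous_iff.2 (hP.continuous.comp continuous_subtype_val), h.ae_eq hp,
    fun v hv hvc hv0 => ?_⟩
  obtain ⟨F, w, hF, hvF⟩ := hJ.exists_pair_of_memExtended hv (hJ.quasiContinuous_iff.1 hvc)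
  obtain rfl : v = fun x : T.Jhat => F x := funext hvF
  rw [hJ.cap_eq_zero_iff] at hv0
  have h0 : ∀ y ∈ T.Ihat, F y = 0 := fun y hy => by
    by_contra hne
    exact (eq_empty_iff_forall_notMem.1 hv0) (T.inclusion ⟨y, hy⟩) ⟨⟨_, rfl⟩, hne⟩
  rw [hJ.hasExtEnergy_iff hP hF, hp.integral_spread_mul_eq_zero hF.toIsL2Primitive
    fun x hx => eq_zero_of_eqOn_Ihat hF h0 hx, mul_zero]

/-- Harmonic extensions are unique, and have the lift of the densities as derivative. -/
theorem Represents.exists_pair_of_isHarmonicExtension (hDM : T.DM) {f : EReal → ℝ}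
    {φ : Lp ℝ 2 T.mhat} (h : T.Represents f φ) {p : Densities} (hp : T.HasDensities f p)
    {u : T.Jhat → ℝ} (hu : (brownianForm T.Jhat).IsHarmonicExtension T.inclusion φ u) :
    ∃ F w, IsDirichletPair T.Jhat F w ∧ u = (fun x : T.Jhat => F x) ∧
      w =ᵐ[volume] T.spread p := by
  have hJ := T.isProperInterval_Jhat
  have hP := h.1.isDirichletPair hp
  obtain ⟨F, w, hF, huF⟩ := hJ.exists_pair_of_memExtended hu.memExtended
    (hJ.quasiContinuous_iff.1 hu.quasiContinuous)
  obtain rfl : u = fun x : T.Jhat => F x := funext huF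
  -- Both extensions agree with `φ` only `𝔪̂`-almost everywhere; full support and continuity make
  -- them equal on all of `Î`, so that their difference is an admissible test function.
  have heq : EqOn F (T.lift p) T.Ihat := by
    refine eq_of_ae_eq_mhat hDM hF.continuous hP.continuous ?_
    filter_upwards [hu.restrict, h.ae_eq hp] with y h1 h2
    exact h1.symm.trans h2
  have hV := hF.sub' hP
  have h0 : ∀ y ∈ T.Ihat, F y - T.lift p y = 0 := fun y hy => sub_eq_zero.2 (heq hy)
  have h1 := hu.orthogonal (fun x => F x - T.lift p x) (hJ.memExtended_of_pair hV)
    (hJ.quasiContinuous_iff.2 (hV.continuous.comp continuous_subtype_val)) (by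
      rw [hJ.cap_eq_zero_iff, eq_empty_iff_forall_notMem]
      rintro _ ⟨⟨y, rfl⟩, hy⟩
      exact hy (h0 y y.2))
  rw [hJ.hasExtEnergy_iff hF hV] at h1
  have h2 := hp.integral_spread_mul_eq_zero hV.toIsL2Primitive
    fun x hx => eq_zero_of_eqOn_Ihat hV h0 hx
  refine ⟨F, w, hF, rfl, ?_⟩
  have h3 : Integrable (fun y => w y * (w y - T.spread p y)) := hF.memLp.integrable_mul hV.memLp
  have h4 : Integrable (fun y => T.spread p y * (w y - T.spread p y)) :=
    hP.memLp.integrable_mul hV.memLp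
  -- The given extension and the lift are both orthogonal to their difference, which therefore has
  -- energy zero.
  have h5 : ∫ y, (w y - T.spread p y) * (w y - T.spread p y) = 0 := by
    simp_rw [sub_mul (w _)]
    rw [integral_sub h3 h4, h2]
    linarith
  rw [integral_eq_zero_iff_of_nonneg (fun y => mul_self_nonneg _)
    (hV.memLp.integrable_mul hV.memLp)] at h5
  filter_upwards [h5] with y hy
  exact sub_eq_zero.1 (mul_self_eq_zero.1 hy)

end ScaleTriple
end

theorem theorem3p7 (T : ScaleTriple) (hDK : T.DK) (hDM : T.DM) :
    (brownianForm T.Jhat).IsTraceDirichletForm T.inclusion T.imageRegularization := by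
  have hJ := T.isProperInterval_Jhat
  refine ⟨T.isEmbedding_inclusion, T.isSmooth, ScaleTriple.isQuasiSupport hDM, fun φ => ?_,
    fun φ hφ => ?_, fun φ hφ ψ hψ h k hh hk => ?_⟩
  · rw [ScaleTriple.mem_imageRegularization_dom_iff]
    constructor
    · rintro ⟨F, w, hF, hφ⟩
      exact ⟨fun x => F x, hJ.memExtended_of_pair hF,
        hJ.quasiContinuous_iff.2 (hF.continuous.comp continuous_subtype_val), hφ⟩
    · rintro ⟨u, hu, huc, hφ⟩
      obtain ⟨F, w, hF, huF⟩ := hJ.exists_pair_of_memExtended hu (hJ.quasiContinuous_iff.1 huc)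
      refine ⟨F, w, hF, ?_⟩
      filter_upwards [hφ] with y hy
      rw [hy, huF]
      rfl
  · obtain ⟨f, hf⟩ := hφ
    obtain ⟨p, hp⟩ := hf.1.memS.exists_densities
    exact ⟨_, hf.isHarmonicExtension hp⟩
  -- The preimages and their densities are selected by choice, but whichever are selected, the
  -- harmonic extensions `h` and `k` have the corresponding spreads as derivatives almost
  -- everywhere. Hence both energies are the same integral.
  · have hφ' := ScaleTriple.represents_preimage hφ
    have hψ' := ScaleTriple.represents_preimage hψ
    obtain ⟨F, w, hF, rfl, hw⟩ := hφ'.exists_pair_of_isHarmonicExtension hDM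
      (ScaleTriple.hasDensities_densities hφ'.1.memS) hh
    obtain ⟨G, z, hG, rfl, hz⟩ := hψ'.exists_pair_of_isHarmonicExtension hDM
      (ScaleTriple.hasDensities_densities hψ'.1.memS) hk
    rw [hJ.hasExtEnergy_iff hF hG]
    refine (ScaleTriple.energy_eq_integral hφ'.1.memS hψ'.1.memS).trans ?_
    congr 1
    apply integral_congr_ae
    filter_upwards [hw, hz] with y h1 h2
    rw [h1, h2]
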